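/- Notation. Let $m\ge 1$, $s>0$ and $p>1$. For a map $u$ from an $m$-dimensional Riemannian manifold $\mathcal M$ to a metric space $(\mathcal E,d_{\mathcal E})$, let $$\mathcal E_{s,p}(u)=\iint_{\mathcal M\times\mathcal M}\frac{d_{\mathcal E}(u(y),u(x))^p}{d_{\mathcal M}(y,x)^{m+sp}}\,\mathrm dy\,\mathrm dx ,$$ and write $u\in\dot W^{s,p}(\mathcal M,\mathcal E)$ if $u$ is measurable and $\mathcal E_{s,p}(u)<\infty$. Here $d_{\mathcal M}$ is the geodesic distance ($\infty$ between different components) and $\mathrm dx$, $\mathrm dy$ denote the Riemannian volume. For a Riemannian covering map $\pi:\widetilde{\mathcal N}\to\mathcal N$ (a smooth covering map that is a local isometry), let $X(\mathcal M,\widetilde{\mathcal N})$ be the set of measurable maps $\tilde u:\mathcal M\to\widetilde{\mathcal N}$ such that $$\iint_{\{(x,y)\in\mathcal M\times\mathcal M\,:\;d_{\widetilde{\mathcal N}}(\tilde u(x),\tilde u(y))\ge \operatorname{inj}(\mathcal N)/2\}}\frac{1}{d_{\mathcal M}(x,y)^{m+1}}\,\mathrm dy\,\mathrm dx<\infty ,$$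 where $\operatorname{inj}(\mathcal N)$ is the injectivity radius of $\mathcal N$. Theorem. Let $m\in\mathbb N$, $0<s<1$ and $1<p<\infty$ satisfy $sp>1$ and $$1-s<\frac{sp}{m}<1,\qquad\text{and set}\qquad s_\flat=s-(1-s)\Bigl(\frac{m}{sp}-1\Bigr).$$ (i) Let $\mathcal M$ be a compact Riemannian manifold of dimension $m$ (possibly with boundary), let $\mathcal N$ be a compact Riemannian manifold (without boundary), and let $\pi:\widetilde{\mathcal N}\to\mathcal N$ be a Riemannian covering map. There exists a constant $C<\infty$ such that for every $\tilde u\in X(\mathcal M,\widetilde{\mathcal N})$ for which $u:=\pi\circ\tilde u\in\dot W^{s,p}(\mathcal M,\mathcal N)$, one has $\tilde u\in\dot W^{s_\flat,p}(\mathcal M,\widetilde{\mathcal N})$ and $$\mathcal E_{s_\flat,p}(\tilde u)\le C\bigl(\mathcal E_{s,p}(u)+\mathcal E_{s,p}(u)^{1/s}\bigr).$$ (ii) The exponent $s_\flat$ is optimal: let $\pi:\mathbb R\to\mathbb R/2\pi\mathbb Z\simeq\mathbb S^1$ be the universal covering of the unit circle (with its geodesic distance, so that $\operatorname{inj}(\mathbb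 S^1)=\pi$) and let $\mathbb B^m$ be the unit ball of $\mathbb R^m$ (with the Euclidean distance and Lebesgue measure). For every $\sigma$ with $s_\flat<\sigma<1$ there exists $\tilde u\in X(\mathbb B^m,\mathbb R)$ with $\pi\circ\tilde u\in\dot W^{s,p}(\mathbb B^m,\mathbb S^1)$ and $\mathcal E_{\sigma,p}(\tilde u)=\infty$, so that $\tilde u\notin\dot W^{\sigma,p}(\mathbb B^m,\mathbb R)$. -/

import Mathlib

open MeasureTheory Set Topology Manifold Bundle
open scoped ENNReal NNReal ContDiff

noncomputable section

/-! ## Energies and function spaces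

All distances are extended distances with values in `[0, ∞]`, and all integrals are Lebesgue
integrals with values in `[0, ∞]`. In `ℝ≥0∞` one has `a / ∞ = 0`, so that pairs of points in
different components of the domain (if it is disconnected) do not contribute, and `0 / 0 = 0`, so
that the diagonal does not contribute. -/

/-- The Gagliardo energy
`∬ d(u y, u x) ^ p / d(y, x) ^ (m + s p) dy dx` of a map `u` on an `m`-dimensional domain `X`
endowed with the measure `μ`. -/
def gagliardoEnergy {X E : Type*} [EMetricSpace X] [MeasurableSpace X] [EMetricSpace E]
    (m : ℕ) (μ : Measure X) (s p : ℝ) (u : X → E) : ℝ≥0∞ :=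
  ∫⁻ x, ∫⁻ y, edist (u y) (u x) ^ p / edist y x ^ ((m : ℝ) + s * p) ∂μ ∂μ

/-- Membership in the homogeneous fractional Sobolev space `Ẇ^{s,p}`: the map is measurable
(in the sense of Lebesgue, that is, up to a null set) and its Gagliardo energy is finite. -/
def MemFracSobolev {X E : Type*} [EMetricSpace X] [MeasurableSpace X] [EMetricSpace E]
    [MeasurableSpace E] (m : ℕ) (μ : Measure X) (s p : ℝ) (u : X → E) : Prop :=
  AEMeasurable u μ ∧ gagliardoEnergy m μ s p u < ⊤

/-- Membership in the space `X` of measurable maps such that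
`∬_{d(u x, u y) ≥ δ} 1 / d(x, y) ^ (m + 1) dy dx < ∞`. For a Riemannian covering `Ñ → N`, the
space `X(M, Ñ)` is the one with `δ = inj(N) / 2`. -/
def MemLiftingSpace {X E : Type*} [EMetricSpace X] [MeasurableSpace X] [EMetricSpace E]
    [MeasurableSpace E] (m : ℕ) (μ : Measure X) (δ : ℝ≥0∞) (u : X → E) : Prop :=
  AEMeasurable u μ ∧
    ∫⁻ x, ∫⁻ y in {y | δ ≤ edist (u x) (u y)}, 1 / edist x y ^ ((m : ℝ) + 1) ∂μ ∂μ < ⊤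

/-- The exponent `s♭ = s - (1 - s) (m / (s p) - 1)`. -/
def sFlat (m : ℕ) (s p : ℝ) : ℝ := s - (1 - s) * ((m : ℝ) / (s * p) - 1)

/-! ## Injectivity radius -/

/-- `γ` is a geodesic on the set of times `J`: it has constant speed `c` and is locally
length-minimizing. -/
def IsGeodesicOn {N : Type*} [EMetricSpace N] (γ : ℝ → N) (J : Set ℝ) : Prop :=
  ∃ c : ℝ≥0, ∀ t ∈ J, ∃ U ∈ 𝓝 t, ∀ t₁ ∈ U ∩ J, ∀ t₂ ∈ U ∩ J,
    edist (γ t₁) (γ t₂) = c * edist t₁ t₂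

section InjectivityRadius

variable {n : ℕ} {N : Type*} [EMetricSpace N] [ChartedSpace (EuclideanSpace ℝ (Fin n)) N]
  [IsManifold (𝓡 n) ∞ N]
  [RiemannianBundle (fun x : N ↦ TangentSpace (𝓡 n) x)]
  [IsContMDiffRiemannianBundle (𝓡 n) ∞ (EuclideanSpace ℝ (Fin n))
    (fun x : N ↦ TangentSpace (𝓡 n) x)]

/-- On the ball `B(0, r) ⊆ T_x N` (for the Riemannian norm), the map `e` is the exponential map at
`x` (the curves `t ↦ e (t v)` are the geodesics starting from `x` with velocity `v`), and it is a
diffeomorphism of `B(0, r)` onto the geodesic ball `B(x, r)` of `N`. -/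
structure IsNormalBall (x : N) (r : ℝ≥0) (e : TangentSpace (𝓡 n) x → N) : Prop where
  map_zero : e 0 = x
  velocity : ∀ v : TangentSpace (𝓡 n) x,
    mfderiv 𝓘(ℝ, TangentSpace (𝓡 n) x) (𝓡 n) e 0 v = v
  geodesic : ∀ v : TangentSpace (𝓡 n) x,
    IsGeodesicOn (fun t : ℝ ↦ e (t • v)) {t : ℝ | ‖t • v‖ < r}
  smooth : ContMDiffOn 𝓘(ℝ, TangentSpace (𝓡 n) x) (𝓡 n) ∞ e (Metric.ball 0 r)
  bijOn : BijOn e (Metric.ball 0 r) (Metric.eball x r)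
  smooth_inverse : ∃ g : N → TangentSpace (𝓡 n) x,
    ContMDiffOn (𝓡 n) 𝓘(ℝ, TangentSpace (𝓡 n) x) ∞ g (Metric.eball x r) ∧
      ∀ v ∈ Metric.ball (0 : TangentSpace (𝓡 n) x) r, g (e v) = v

variable (n N) in
/-- The injectivity radius of `N`: the supremum of the radii `r` such that, for every `x`, the
exponential map at `x` is a diffeomorphism of `B(0, r) ⊆ T_x N` onto `B(x, r) ⊆ N`. -/
def injectivityRadius : ℝ≥0∞ :=
  ⨆ (r : ℝ≥0) (_ : 0 < r ∧ ∀ x : N, ∃ e : TangentSpace (𝓡 n) x → N, IsNormalBall x r e),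
    (r : ℝ≥0∞)

end InjectivityRadius

/-! ## Riemannian coverings -/

/-- A Riemannian covering map: a smooth covering map whose differential at each point is isometric
for the Riemannian norms. -/
structure IsRiemannianCovering {n : ℕ} {N' N : Type*}
    [TopologicalSpace N'] [ChartedSpace (EuclideanSpace ℝ (Fin n)) N']
    [IsManifold (𝓡 n) ∞ N'] [RiemannianBundle (fun x : N' ↦ TangentSpace (𝓡 n) x)]
    [TopologicalSpace N] [ChartedSpace (EuclideanSpace ℝ (Fin n)) N]
    [IsManifold (𝓡 n) ∞ N] [RiemannianBundle (fun x : N ↦ TangentSpace (𝓡 n) x)]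
    (q : N' → N) : Prop where
  isCoveringMap : IsCoveringMap q
  contMDiff : ContMDiff (𝓡 n) (𝓡 n) ∞ q
  norm_mfderiv : ∀ (x : N') (v : TangentSpace (𝓡 n) x), ‖mfderiv (𝓡 n) (𝓡 n) q x v‖ = ‖v‖

end

open MeasureTheory Set Topology Manifold Bundle
open scoped ENNReal NNReal ContDiff

noncomputable section

set_option linter.unusedSectionVars false

/-! (i) Put d = m, q = sp and a = s♭ p = p - p d / q + d, and let W(x, y) be the distance between
ũ(x) and ũ(y) divided by some δ not exceeding half the injectivity radius. The covering does not
decrease distances smaller than the injectivity radius (`IsRiemannianCovering.edist_le`), so the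
values W < 1 have an energy A = ∬ W^p / |x - y|^(d + q) bounded by the energy of u. About the values
W ≥ 1 only the qualitative membership in X is known. What has to be shown is that ∬ W^p / |x - y|^(d
+ a) is at most C (A + A^(p/q)), where p/q = 1/s, for every measurable pseudo-distance W. This is
done on small convex sets (`lintegral_kernel_le`), and then on M through bi-Lipschitz charts and
chains of overlapping charts (`exists_lintegral_kernel_le_of_charts`).

Large values of W are recovered from small ones by bisecting segments. When a piece is halved, a
large value either passes almost unchanged to one half, or leaves a non-negligible amount on both;
amounts that drop below the threshold are charged to the small values, the others remain large
(`jumpPart_le_add`). On average over all segments in a convex set of diameter ρ, the values still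
large after n bisections sit on pairs at distance at most 2^(-n) ρ and carry the weight 2^(n(d+1));
they are dominated by a tail of the integral that defines X, which tends to 0. The integral defining
X therefore leaves no trace in the constants. The outcome, for any r > 1, is a Poincaré inequality
(`lintegral_large_le`): the mean of the large part of W is at most a multiple of (ρ^(r-d) ∬ W^p / |x
- y|^(d+r))^(1/r), where the integral is restricted to the values W < 1.

To reach the fractional energy, compare the means of W(x, ·) over balls of radius 2^(-k). Let Φ(x)
be the inner integral of A and let M be the maximal function. For 1 < r < q the increments of the
means are bounded by a multiple of 2^(-kq/p) M(Φ^(1/p)) + min(2^(-k) M(Φ^(r/q))^(1/r), 2^(k(d/q-1))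
A^(1/q)): the small part uses Hölder, the large part uses the Poincaré inequality with its integral
estimated locally or globally. By a Hardy inequality it remains to sum the p-th powers with the
weights 2^(ka), which gives M(Φ^(1/p))^p + M(Φ^(r/q))^(q/r) A^(p/q-1) (`tsum_level_rpow_le`). The
exponent a is the one for which M(Φ^(r/q)) appears with the power q/r, so that the maximal theorem
(`lintegral_dyadicMaximal_rpow_le`) returns A + A^(p/q).

(ii) Take ũ(x) = |x|^(-γ). Its gradient has size |x|^(-(γ+1)) and distances on the circle are
bounded, so the projected map has finite energy of order (s, p) when (γ + 1) s p < m. The energy of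
ũ of order (σ, p) is homogeneous under dilations and diverges at the origin as soon as (γ + σ) p ≥
m. Both conditions can be met with some γ > 0 exactly because σ > s♭. -/

/-- The layer-cake formula for a power of an extended nonnegative number. -/
lemma ENNReal.lintegral_rpow_indicator_lt (X : ℝ≥0∞) {P : ℝ} (hP : 0 < P) :
    ∫⁻ t in Ioi (0 : ℝ), (if ENNReal.ofReal t < X then ENNReal.ofReal (t ^ (P - 1)) else 0)
      = X ^ P / ENNReal.ofReal P := by
  have key (x : ℝ) (hx : 0 ≤ x) : ∫⁻ t in Ioo (0 : ℝ) x, ENNReal.ofReal (t ^ (P - 1))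
      = ENNReal.ofReal (x ^ P / P) := by
    have h1 : IntervalIntegrable (fun t : ℝ ↦ t ^ (P - 1)) volume 0 x :=
      intervalIntegral.intervalIntegrable_rpow' (by linarith)
    have h2 := integral_rpow (a := 0) (b := x) (r := P - 1) (Or.inl (by linarith))
    rw [intervalIntegral.integral_of_le hx] at h2
    rw [intervalIntegrable_iff_integrableOn_Ioc_of_le hx] at h1
    rw [restrict_Ioo_eq_restrict_Ioc, ← ofReal_integral_eq_lintegral_ofReal h1, h2]
    · simp [Real.zero_rpow hP.ne']
    · filter_upwards [ae_restrict_mem measurableSet_Ioc] with t ht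
      exact Real.rpow_nonneg ht.1.le _
  have key2 (x : ℝ) (hx : 0 ≤ x) :
      ∫⁻ t in Ioi (0 : ℝ), (if ENNReal.ofReal t < ENNReal.ofReal x
        then ENNReal.ofReal (t ^ (P - 1)) else 0) = ENNReal.ofReal (x ^ P / P) := by
    rw [← key x hx, ← lintegral_indicator measurableSet_Ioi, ← lintegral_indicator measurableSet_Ioo]
    congr 1
    ext t
    simp only [indicator, mem_Ioi, mem_Ioo]
    by_cases ht : 0 < t
    · simp [ht, ENNReal.ofReal_lt_ofReal_iff_of_nonneg ht.le]
    · simp [ht]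
  by_cases hX : X = ⊤
  · subst hX
    rw [ENNReal.top_rpow_of_pos hP, ENNReal.top_div_of_ne_top (by simp)]
    refine ENNReal.eq_top_of_forall_nnreal_le fun r ↦ ?_
    -- The endpoint x = (rP)^(1/P) is the one with x^P / P = r.
    have := key2 ((r * P) ^ (1 / P)) (by positivity)
    rw [← Real.rpow_mul (by positivity), one_div_mul_cancel hP.ne', Real.rpow_one,
      mul_div_assoc, div_self hP.ne', mul_one, ENNReal.ofReal_coe_nnreal] at this
    rw [← this]
    refine lintegral_mono fun t ↦ ?_
    simp only [ENNReal.ofReal_lt_top, if_true]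
    split_ifs <;> simp
  · lift X to ℝ≥0 using hX
    have := key2 X X.2
    rw [ENNReal.ofReal_coe_nnreal] at this
    rw [this, ENNReal.ofReal_div_of_pos hP, ← ENNReal.ofReal_coe_nnreal (p := X),
      ENNReal.ofReal_rpow_of_nonneg X.coe_nonneg hP.le]

/-! ### The dyadic maximal function -/

section Maximal

variable {E : Type*} [NormedAddCommGroup E] [NormedSpace ℝ E] [FiniteDimensional ℝ E]
  [MeasurableSpace E] [BorelSpace E] (μ : Measure E) [μ.IsAddHaarMeasure]

/-- The maximal function over balls of radii `2 ^ (-k)`, `k ∈ ℕ`. -/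
def dyadicMaximal (f : E → ℝ≥0∞) (x : E) : ℝ≥0∞ :=
  ⨆ k : ℕ, (2 : ℝ≥0∞) ^ (k * Module.finrank ℝ E) *
    ∫⁻ y in Metric.closedBall x ((2 : ℝ)⁻¹ ^ k), f y ∂μ

lemma measurable_setLIntegral_closedBall {f : E → ℝ≥0∞} (hf : Measurable f) (r : ℝ) :
    Measurable fun x : E ↦ ∫⁻ y in Metric.closedBall x r, f y ∂μ := by
  have : (fun x : E ↦ ∫⁻ y in Metric.closedBall x r, f y ∂μ)
      = fun x ↦ ∫⁻ y, {z : E × E | dist z.2 z.1 ≤ r}.indicator (fun z ↦ f z.2) (x, y) ∂μ := by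
    ext x
    rw [← lintegral_indicator Metric.isClosed_closedBall.measurableSet]
    rfl
  rw [this]
  refine Measurable.lintegral_prod_right ?_
  refine (hf.comp measurable_snd).indicator ?_
  exact (isClosed_le (by fun_prop) (by fun_prop)).measurableSet

lemma measurable_dyadicMaximal {f : E → ℝ≥0∞} (hf : Measurable f) :
    Measurable (dyadicMaximal μ f) :=
  Measurable.iSup fun _ ↦ (measurable_setLIntegral_closedBall μ hf _).const_mul _

/-- The weak type `(1, 1)` estimate. -/
lemma measure_lt_dyadicMaximal_le (f : E → ℝ≥0∞) {t : ℝ≥0∞} (ht : t ≠ 0) (ht' : t ≠ ⊤) :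
    μ {x | t < dyadicMaximal μ f x} ≤
      ENNReal.ofReal (4 ^ Module.finrank ℝ E) * μ (Metric.closedBall 0 1) * (t⁻¹ * ∫⁻ y, f y ∂μ) := by
  set d := Module.finrank ℝ E
  set S : Set (E × ℕ) := {z | t < (2 : ℝ≥0∞) ^ (z.2 * d) *
    ∫⁻ y in Metric.closedBall z.1 ((2 : ℝ)⁻¹ ^ z.2), f y ∂μ}
  -- Vitali covering of all balls on which the average exceeds t, indexed by centre and scale; the
  -- radii are at most 1. Any enlargement factor above 3 would serve, and 4 produces the constant
  -- 4^d.
  obtain ⟨u, huS, hud, hu⟩ := Vitali.exists_disjoint_subfamily_covering_enlargement_closedBall S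
    (fun z ↦ z.1) (fun z ↦ (2 : ℝ)⁻¹ ^ z.2) 1
    (fun z _ ↦ pow_le_one₀ (by norm_num) (by norm_num)) 4 (by norm_num)
  have hcount : u.Countable := by
    refine hud.countable_of_nonempty_interior fun z _ ↦ ?_
    exact (Metric.nonempty_ball.2 (by positivity)).mono Metric.ball_subset_interior_closedBall
  have hcover : {x | t < dyadicMaximal μ f x} ⊆
      ⋃ z ∈ u, Metric.closedBall z.1 (4 * (2 : ℝ)⁻¹ ^ z.2) := by
    intro x hx
    obtain ⟨k, hk⟩ := lt_iSup_iff.1 (show t < ⨆ k, _ from hx)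
    obtain ⟨b, hb, hb'⟩ := hu (x, k) hk
    exact mem_biUnion hb (hb' (Metric.mem_closedBall_self (by positivity)))
  have hball (z : E × ℕ) (hz : z ∈ u) : μ (Metric.closedBall z.1 (4 * (2 : ℝ)⁻¹ ^ z.2)) ≤
      ENNReal.ofReal (4 ^ d) * μ (Metric.closedBall 0 1) *
        (t⁻¹ * ∫⁻ y in Metric.closedBall z.1 ((2 : ℝ)⁻¹ ^ z.2), f y ∂μ) := by
    rw [Measure.addHaar_closedBall' μ _ (by positivity), mul_pow,
      ENNReal.ofReal_mul (by positivity), mul_right_comm]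
    gcongr
    have h1 : t < (2 : ℝ≥0∞) ^ (z.2 * d) * _ := huS hz
    have h2 : ENNReal.ofReal (((2 : ℝ)⁻¹ ^ z.2) ^ d) = ((2 : ℝ≥0∞) ^ (z.2 * d))⁻¹ := by
      rw [← pow_mul, ENNReal.ofReal_pow (by norm_num), ENNReal.ofReal_inv_of_pos (by norm_num),
        ENNReal.inv_pow]
      simp
    rw [h2]
    rw [ENNReal.inv_le_iff_inv_le, ENNReal.mul_inv (Or.inl (ENNReal.inv_ne_zero.2 ht'))
      (Or.inl (ENNReal.inv_ne_top.2 ht)), inv_inv, ← div_eq_mul_inv]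
    refine ENNReal.div_le_of_le_mul h1.le
  calc μ {x | t < dyadicMaximal μ f x}
      ≤ μ (⋃ z ∈ u, Metric.closedBall z.1 (4 * (2 : ℝ)⁻¹ ^ z.2)) := measure_mono hcover
    _ ≤ ∑' z : u, μ (Metric.closedBall z.1.1 (4 * (2 : ℝ)⁻¹ ^ z.1.2)) :=
        measure_biUnion_le _ hcount _
    _ ≤ ∑' z : u, ENNReal.ofReal (4 ^ d) * μ (Metric.closedBall 0 1) *
        (t⁻¹ * ∫⁻ y in Metric.closedBall z.1.1 ((2 : ℝ)⁻¹ ^ z.1.2), f y ∂μ) :=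
        ENNReal.tsum_le_tsum fun z ↦ hball z.1 z.2
    _ = ENNReal.ofReal (4 ^ d) * μ (Metric.closedBall 0 1) *
        (t⁻¹ * ∑' z : u, ∫⁻ y in Metric.closedBall z.1.1 ((2 : ℝ)⁻¹ ^ z.1.2), f y ∂μ) := by
        rw [ENNReal.tsum_mul_left, ENNReal.tsum_mul_left]
    _ ≤ _ := by
        gcongr
        have : Countable u := hcount
        rw [← lintegral_iUnion (fun z ↦ Metric.isClosed_closedBall.measurableSet)
          (hud.subtype _ _)]
        exact setLIntegral_le_lintegral _ _

/-- The strong type `(P, P)` estimate for the dyadic maximal function. -/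
lemma lintegral_dyadicMaximal_rpow_le {P : ℝ} (hP : 1 < P) :
    ∃ C : ℝ≥0, ∀ f : E → ℝ≥0∞, Measurable f →
      ∫⁻ x, dyadicMaximal μ f x ^ P ∂μ ≤ C * ∫⁻ x, f x ^ P ∂μ := by
  set V : ℝ≥0∞ := μ (Metric.closedBall 0 1)
  have hV0 : V ≠ 0 := (Metric.measure_closedBall_pos μ 0 one_pos).ne'
  have hVt : V ≠ ⊤ := measure_closedBall_lt_top.ne
  set c : ℝ≥0∞ := ENNReal.ofReal (4 ^ Module.finrank ℝ E) * V
  have hP0 : 0 < P := by linarith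
  have hP1 : 0 < P - 1 := by linarith
  have hct : c ≠ ⊤ := ENNReal.mul_ne_top ENNReal.ofReal_ne_top hVt
  set D : ℝ≥0∞ := ENNReal.ofReal P * (2 * c * ((2 * V) ^ (P - 1) / ENNReal.ofReal (P - 1)))
  have hD : D ≠ ⊤ := by
    refine ENNReal.mul_ne_top ENNReal.ofReal_ne_top (ENNReal.mul_ne_top
      (ENNReal.mul_ne_top (by simp) hct) (ENNReal.div_ne_top ?_ (by simpa using hP)))
    exact ENNReal.rpow_ne_top_of_nonneg hP1.le (ENNReal.mul_ne_top (by simp) hVt)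
  refine ⟨D.toNNReal, fun f hf ↦ ?_⟩
  rw [ENNReal.coe_toNNReal hD]
  have hM := measurable_dyadicMaximal μ hf
  have level (t : ℝ) (ht : 0 < t) : μ {x | ENNReal.ofReal t < dyadicMaximal μ f x} ≤
      2 * c * ((ENNReal.ofReal t)⁻¹ *
        ∫⁻ y, (if ENNReal.ofReal t < 2 * V * f y then f y else 0) ∂μ) := by
    -- Averages are normalized by 2^(kd) and not by the measure of the ball, so the values of f
    -- below t / (2V) contribute at most t / 2 to each of them. Only the part of f above that height
    -- matters for the level t.
    set g : E → ℝ≥0∞ := fun y ↦ if ENNReal.ofReal t < 2 * V * f y then f y else 0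
    have ht0 : ENNReal.ofReal t / 2 ≠ 0 := by simp [ht]
    have htt : ENNReal.ofReal t / 2 ≠ ⊤ := ENNReal.div_ne_top ENNReal.ofReal_ne_top (by simp)
    have hsub : {x | ENNReal.ofReal t < dyadicMaximal μ f x} ⊆
        {x | ENNReal.ofReal t / 2 < dyadicMaximal μ g x} := by
      intro x hx
      by_contra hx'
      replace hx' : dyadicMaximal μ g x ≤ ENNReal.ofReal t / 2 := not_lt.1 hx'
      refine (not_le.2 (show ENNReal.ofReal t < dyadicMaximal μ f x from hx)) ?_
      refine iSup_le fun k ↦ ?_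
      have h1 : ∫⁻ y in Metric.closedBall x ((2 : ℝ)⁻¹ ^ k), f y ∂μ ≤
          (∫⁻ y in Metric.closedBall x ((2 : ℝ)⁻¹ ^ k), g y ∂μ)
            + ENNReal.ofReal t / 2 / V * μ (Metric.closedBall x ((2 : ℝ)⁻¹ ^ k)) := by
        rw [← setLIntegral_const, ← lintegral_add_right _ measurable_const]
        refine lintegral_mono fun y ↦ ?_
        simp only [g]
        split_ifs with h
        · exact le_self_add
        · rw [zero_add, ENNReal.le_div_iff_mul_le (Or.inl hV0) (Or.inl hVt),
            ENNReal.le_div_iff_mul_le (by simp) (by simp)]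
          calc f y * V * 2 = 2 * V * f y := by ring
            _ ≤ _ := not_lt.1 h
      have h2 : (2 : ℝ≥0∞) ^ (k * Module.finrank ℝ E) *
          (ENNReal.ofReal t / 2 / V * μ (Metric.closedBall x ((2 : ℝ)⁻¹ ^ k))) =
            ENNReal.ofReal t / 2 := by
        rw [Measure.addHaar_closedBall' μ _ (by positivity), ← pow_mul,
          ENNReal.ofReal_pow (by norm_num), ENNReal.ofReal_inv_of_pos (by norm_num),
          ENNReal.ofReal_ofNat]
        calc (2 : ℝ≥0∞) ^ (k * Module.finrank ℝ E) * (ENNReal.ofReal t / 2 / V *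
            (2⁻¹ ^ (k * Module.finrank ℝ E) * V))
            = ((2 * 2⁻¹) ^ (k * Module.finrank ℝ E)) * (ENNReal.ofReal t / 2 / V * V) := by
              rw [mul_pow]; ring
          _ = _ := by
              rw [ENNReal.mul_inv_cancel (by simp) (by simp), one_pow, one_mul,
                ENNReal.div_mul_cancel hV0 hVt]
      calc _ ≤ (2 : ℝ≥0∞) ^ (k * Module.finrank ℝ E) *
            ((∫⁻ y in Metric.closedBall x ((2 : ℝ)⁻¹ ^ k), g y ∂μ)
            + ENNReal.ofReal t / 2 / V * μ (Metric.closedBall x ((2 : ℝ)⁻¹ ^ k))) := by gcongr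
        _ ≤ ENNReal.ofReal t / 2 + ENNReal.ofReal t / 2 := by
          rw [mul_add, h2]
          gcongr
          exact (le_iSup (fun k : ℕ ↦ (2 : ℝ≥0∞) ^ (k * Module.finrank ℝ E) *
            ∫⁻ y in Metric.closedBall x ((2 : ℝ)⁻¹ ^ k), g y ∂μ) k).trans hx'
        _ = _ := ENNReal.add_halves _
    calc _ ≤ _ := measure_mono hsub
      _ ≤ _ := measure_lt_dyadicMaximal_le μ g ht0 htt
      _ = _ := by
        rw [ENNReal.inv_div (by simp) (by simp), div_eq_mul_inv]
        ring
  have hmeas1 : Measurable fun z : E × ℝ ↦ (if ENNReal.ofReal z.2 < dyadicMaximal μ f z.1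
      then ENNReal.ofReal (z.2 ^ (P - 1)) else 0) :=
    Measurable.ite (measurableSet_lt (by fun_prop) (hM.comp measurable_fst)) (by fun_prop)
      measurable_const
  have hmeas2 : Measurable fun z : ℝ × E ↦ (if ENNReal.ofReal z.1 < 2 * V * f z.2
      then ENNReal.ofReal (z.1 ^ (P - 1 - 1)) * f z.2 else 0) :=
    Measurable.ite (measurableSet_lt (by fun_prop) (by fun_prop)) (by fun_prop)
      measurable_const
  -- The layer-cake formula is used twice: for the power P of the maximal function, and, after
  -- Tonelli, to integrate t^(P-2) up to 2 V f(x), where P > 1 is needed.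
  calc ∫⁻ x, dyadicMaximal μ f x ^ P ∂μ
      = ∫⁻ x, ENNReal.ofReal P * (∫⁻ t in Ioi (0 : ℝ),
        (if ENNReal.ofReal t < dyadicMaximal μ f x
          then ENNReal.ofReal (t ^ (P - 1)) else 0)) ∂μ := by
        refine lintegral_congr fun x ↦ ?_
        rw [ENNReal.lintegral_rpow_indicator_lt _ hP0, ENNReal.mul_div_cancel (by simpa using hP0)
          ENNReal.ofReal_ne_top]
    _ = ENNReal.ofReal P * ∫⁻ t in Ioi (0 : ℝ), ∫⁻ x,
        (if ENNReal.ofReal t < dyadicMaximal μ f x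
          then ENNReal.ofReal (t ^ (P - 1)) else 0) ∂μ := by
        rw [lintegral_const_mul' _ _ ENNReal.ofReal_ne_top,
          lintegral_lintegral_swap hmeas1.aemeasurable]
    _ ≤ ENNReal.ofReal P * ∫⁻ t in Ioi (0 : ℝ), 2 * c * ∫⁻ x,
        (if ENNReal.ofReal t < 2 * V * f x
          then ENNReal.ofReal (t ^ (P - 1 - 1)) * f x else 0) ∂μ := by
        refine mul_le_mul_right ?_ _
        refine setLIntegral_mono' measurableSet_Ioi fun t (ht : 0 < t) ↦ ?_
        calc _ = ENNReal.ofReal (t ^ (P - 1)) *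
              μ {x | ENNReal.ofReal t < dyadicMaximal μ f x} := by
              rw [← setLIntegral_const, ← lintegral_indicator (measurableSet_lt measurable_const hM)]
              exact lintegral_congr fun x ↦ by simp [indicator_apply]
          _ ≤ ENNReal.ofReal (t ^ (P - 1)) * (2 * c * ((ENNReal.ofReal t)⁻¹ *
                ∫⁻ y, (if ENNReal.ofReal t < 2 * V * f y then f y else 0) ∂μ)) := by
              gcongr
              exact level t ht
          _ = 2 * c * (ENNReal.ofReal (t ^ (P - 1 - 1)) *
                ∫⁻ y, (if ENNReal.ofReal t < 2 * V * f y then f y else 0) ∂μ) := by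
              rw [Real.rpow_sub_one ht.ne' (P - 1), ENNReal.ofReal_div_of_pos ht, div_eq_mul_inv]
              ring
          _ = _ := by
              rw [← lintegral_const_mul' _ _ ENNReal.ofReal_ne_top]
              simp only [mul_ite, mul_zero]
    _ = ENNReal.ofReal P * (2 * c * ∫⁻ x, f x * (∫⁻ t in Ioi (0 : ℝ),
        (if ENNReal.ofReal t < 2 * V * f x
          then ENNReal.ofReal (t ^ (P - 1 - 1)) else 0)) ∂μ) := by
        rw [lintegral_const_mul' _ _ (ENNReal.mul_ne_top (by simp) hct),
          lintegral_lintegral_swap hmeas2.aemeasurable]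
        congr 3
        ext x
        rw [← lintegral_const_mul]
        · simp only [mul_ite, mul_zero, mul_comm]
        · exact Measurable.ite (measurableSet_lt (by fun_prop) (by fun_prop)) (by fun_prop)
            measurable_const
    _ = ENNReal.ofReal P * (2 * c * ∫⁻ x,
          ((2 * V) ^ (P - 1) / ENNReal.ofReal (P - 1)) * f x ^ P ∂μ) := by
        congr 3
        ext x
        rw [ENNReal.lintegral_rpow_indicator_lt _ hP1, ENNReal.mul_rpow_of_nonneg _ _ hP1.le]
        have : f x ^ P = f x * f x ^ (P - 1) := by
          conv_rhs => enter [1]; rw [← ENNReal.rpow_one (f x)]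
          rw [← ENNReal.rpow_add_of_nonneg _ _ zero_le_one hP1.le]
          congr 1
          ring
        rw [this, div_eq_mul_inv, div_eq_mul_inv]
        ring
    _ = D * ∫⁻ x, f x ^ P ∂μ := by
        rw [lintegral_const_mul]
        · simp only [D]
          ring
        · fun_prop

end Maximal

/-! ### Geometric sums and a discrete Hardy inequality -/

section Sums

lemma ENNReal.two_rpow_mul_two_rpow (a b : ℝ) :
    (2 : ℝ≥0∞) ^ a * (2 : ℝ≥0∞) ^ b = (2 : ℝ≥0∞) ^ (a + b) :=
  (ENNReal.rpow_add a b two_ne_zero ENNReal.ofNat_ne_top).symm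

lemma ENNReal.two_rpow_ne_top (a : ℝ) : (2 : ℝ≥0∞) ^ a ≠ ⊤ := by
  simp [ENNReal.rpow_eq_top_iff]

lemma ENNReal.two_rpow_ne_zero (a : ℝ) : (2 : ℝ≥0∞) ^ a ≠ 0 := by
  simp [ENNReal.rpow_eq_zero_iff]

lemma ENNReal.two_rpow_le_two_rpow {a b : ℝ} (h : a ≤ b) : (2 : ℝ≥0∞) ^ a ≤ (2 : ℝ≥0∞) ^ b :=
  ENNReal.rpow_le_rpow_of_exponent_le one_le_two h

lemma ENNReal.inv_two_rpow (a : ℝ) : ((2 : ℝ≥0∞) ^ a)⁻¹ = (2 : ℝ≥0∞) ^ (-a) :=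
  (ENNReal.rpow_neg _ _).symm

lemma ENNReal.tsum_two_rpow_neg_mul_ne_top {a : ℝ} (ha : 0 < a) :
    ∑' k : ℕ, (2 : ℝ≥0∞) ^ (-(k * a)) ≠ ⊤ := by
  have : ∀ k : ℕ, (2 : ℝ≥0∞) ^ (-(k * a)) = ((2 : ℝ≥0∞) ^ (-a)) ^ k := fun k ↦ by
    rw [← ENNReal.rpow_natCast, ← ENNReal.rpow_mul]; ring_nf
  simp_rw [this, ENNReal.tsum_geometric]
  rw [Ne, ENNReal.inv_eq_top, tsub_eq_zero_iff_le, not_le]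
  exact ENNReal.rpow_lt_one_of_one_lt_of_neg one_lt_two (by linarith)

/-- Hölder's inequality against the summable sequence 2^(-i a / p): an arbitrarily small exponential
weight allows the power p to be moved inside the sum. -/
lemma ENNReal.tsum_rpow_le {p a : ℝ} (hp : 1 < p) (ha : 0 < a) :
    ∃ C : ℝ≥0, ∀ ν : ℕ → ℝ≥0∞,
      (∑' i, ν i) ^ p ≤ C * ∑' i : ℕ, (2 : ℝ≥0∞) ^ (i * a) * ν i ^ p := by
  have hpq := Real.HolderConjugate.conjExponent hp
  set p' := p.conjExponent
  have hp0 : 0 < p := by linarith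
  set S := ∑' k : ℕ, (2 : ℝ≥0∞) ^ (-(k * (a / p * p')))
  have hS : S ≠ ⊤ := ENNReal.tsum_two_rpow_neg_mul_ne_top
    (_root_.mul_pos (div_pos ha hp0) hpq.symm.pos)
  have hSp : S ^ (1 / p' * p) ≠ ⊤ := ENNReal.rpow_ne_top_of_nonneg
    (mul_nonneg (by simpa using hpq.symm.pos.le) hp0.le) hS
  refine ⟨(S ^ (1 / p' * p)).toNNReal, fun ν ↦ ?_⟩
  rw [ENNReal.coe_toNNReal hSp]
  have h := ENNReal.lintegral_mul_le_Lp_mul_Lq (Measure.count : Measure ℕ) hpq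
    (f := fun i ↦ (2 : ℝ≥0∞) ^ (i * (a / p)) * ν i) (g := fun i ↦ (2 : ℝ≥0∞) ^ (-(i * (a / p))))
    (measurable_of_countable _).aemeasurable (measurable_of_countable _).aemeasurable
  simp only [lintegral_count, Pi.mul_apply] at h
  have h1 : ∀ i : ℕ, (2 : ℝ≥0∞) ^ (i * (a / p)) * ν i * (2 : ℝ≥0∞) ^ (-(i * (a / p))) = ν i :=
    fun i ↦ by
      rw [mul_right_comm, ENNReal.two_rpow_mul_two_rpow]
      simp
  have h2 : ∀ i : ℕ, ((2 : ℝ≥0∞) ^ (i * (a / p)) * ν i) ^ p = (2 : ℝ≥0∞) ^ (i * a) * ν i ^ p :=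
    fun i ↦ by
      rw [ENNReal.mul_rpow_of_nonneg _ _ hp0.le, ← ENNReal.rpow_mul]
      congr 2
      field_simp
  have h3 : ∀ i : ℕ, ((2 : ℝ≥0∞) ^ (-(i * (a / p)))) ^ p' = (2 : ℝ≥0∞) ^ (-(i * (a / p * p'))) :=
    fun i ↦ by
      rw [← ENNReal.rpow_mul]
      congr 1
      ring
  simp_rw [h1, h2, h3] at h
  calc _ ≤ _ := ENNReal.rpow_le_rpow h hp0.le
    _ = _ := by
      rw [ENNReal.mul_rpow_of_nonneg _ _ hp0.le, ← ENNReal.rpow_mul, ← ENNReal.rpow_mul,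
        one_div_mul_cancel hp0.ne', ENNReal.rpow_one, mul_comm]

/-- A discrete Hardy inequality. -/
lemma ENNReal.tsum_hardy {p a : ℝ} (hp : 1 < p) (ha : 0 < a) :
    ∃ C : ℝ≥0, ∀ ν : ℕ → ℝ≥0∞,
      ∑' k : ℕ, (2 : ℝ≥0∞) ^ (k * a) * (∑' i, ν (k + i)) ^ p ≤
        C * ∑' k : ℕ, (2 : ℝ≥0∞) ^ (k * a) * ν k ^ p := by
  -- Half of the weight is spent here. Since ka + ia/2 = (k + i)a - ia/2, the other half leaves a
  -- convergent series in the shift i.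
  obtain ⟨C, hC⟩ := ENNReal.tsum_rpow_le hp (half_pos ha)
  have hS := ENNReal.tsum_two_rpow_neg_mul_ne_top (half_pos ha)
  set S := ∑' k : ℕ, (2 : ℝ≥0∞) ^ (-(k * (a / 2)))
  refine ⟨C * S.toNNReal, fun ν ↦ ?_⟩
  rw [ENNReal.coe_mul, ENNReal.coe_toNNReal hS]
  calc ∑' k : ℕ, (2 : ℝ≥0∞) ^ (k * a) * (∑' i, ν (k + i)) ^ p
      ≤ ∑' k : ℕ, (2 : ℝ≥0∞) ^ (k * a) *
          (C * ∑' i : ℕ, (2 : ℝ≥0∞) ^ (i * (a / 2)) * ν (k + i) ^ p) := by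
        gcongr; exact hC _
    _ = C * ∑' k : ℕ, ∑' i : ℕ, (2 : ℝ≥0∞) ^ (-(i * (a / 2))) *
          ((2 : ℝ≥0∞) ^ ((k + i : ℕ) * a) * ν (k + i) ^ p) := by
        rw [← ENNReal.tsum_mul_left]
        congr 1; ext k
        rw [← ENNReal.tsum_mul_left, ← ENNReal.tsum_mul_left, ← ENNReal.tsum_mul_left]
        congr 1; ext i
        rw [← mul_assoc (2 ^ (-(i * (a / 2))) : ℝ≥0∞), ENNReal.two_rpow_mul_two_rpow]
        have : (-(i * (a / 2)) + ((k + i : ℕ) : ℝ) * a) = k * a + i * (a / 2) := by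
          push_cast; ring
        rw [this, ← ENNReal.two_rpow_mul_two_rpow]
        ring
    _ = C * ∑' i : ℕ, (2 : ℝ≥0∞) ^ (-(i * (a / 2))) * ∑' k : ℕ,
          ((2 : ℝ≥0∞) ^ ((k + i : ℕ) * a) * ν (k + i) ^ p) := by
        rw [ENNReal.tsum_comm]
        simp_rw [ENNReal.tsum_mul_left]
    _ ≤ C * ∑' i : ℕ, (2 : ℝ≥0∞) ^ (-(i * (a / 2))) * ∑' k : ℕ,
          ((2 : ℝ≥0∞) ^ (k * a) * ν k ^ p) := by
        refine mul_le_mul_right (ENNReal.tsum_le_tsum fun i ↦ mul_le_mul_right ?_ _) _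
        exact ENNReal.tsum_comp_le_tsum_of_injective (add_left_injective i)
          (fun k : ℕ ↦ (2 : ℝ≥0∞) ^ (k * a) * ν k ^ p)
    _ = _ := by rw [ENNReal.tsum_mul_right]; ring

/-- Two geometric series on either side of the peak l. Replacing l by its natural floor changes the
exponent by at most κ; for negative l the floor is 0, which only brings the peak closer. -/
lemma ENNReal.tsum_two_rpow_neg_abs_sub_le {κ : ℝ} (hκ : 0 < κ) :
    ∃ C : ℝ≥0, ∀ l : ℝ, ∑' j : ℕ, (2 : ℝ≥0∞) ^ (-(κ * |j - l|)) ≤ C := by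
  have hS := ENNReal.tsum_two_rpow_neg_mul_ne_top hκ
  set S := ∑' k : ℕ, (2 : ℝ≥0∞) ^ (-(k * κ))
  have hC : (2 : ℝ≥0∞) ^ κ * (S + S) ≠ ⊤ :=
    ENNReal.mul_ne_top (ENNReal.two_rpow_ne_top _) (by simp [hS])
  refine ⟨((2 : ℝ≥0∞) ^ κ * (S + S)).toNNReal, fun l ↦ ?_⟩
  rw [ENNReal.coe_toNNReal hC]
  set n := ⌊l⌋₊
  have hjl (j : ℕ) : |(j : ℝ) - n| - 1 ≤ |(j : ℝ) - l| := by
    rcases le_or_gt 0 l with hl | hl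
    · have h1 : |(j : ℝ) - n| ≤ |(j : ℝ) - l| + |l - n| := abs_sub_le _ _ _
      have h2 : |l - n| ≤ 1 := by
        rw [abs_le]
        constructor <;> linarith [Nat.floor_le hl, Nat.lt_floor_add_one l]
      linarith
    · have hn : n = 0 := Nat.floor_of_nonpos hl.le
      rw [hn, Nat.cast_zero, sub_zero, abs_of_nonneg (by positivity),
        abs_of_nonneg (by linarith [Nat.cast_nonneg (α := ℝ) j])]
      linarith
  calc ∑' j : ℕ, (2 : ℝ≥0∞) ^ (-(κ * |j - l|))
      ≤ ∑' j : ℕ, (2 : ℝ≥0∞) ^ κ * (2 : ℝ≥0∞) ^ (-(|(j : ℝ) - n| * κ)) := by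
        gcongr with j
        rw [ENNReal.two_rpow_mul_two_rpow]
        exact ENNReal.two_rpow_le_two_rpow (by nlinarith [hjl j])
    _ = (2 : ℝ≥0∞) ^ κ * ∑' j : ℕ, (2 : ℝ≥0∞) ^ (-(|(j : ℝ) - n| * κ)) := ENNReal.tsum_mul_left
    _ ≤ _ := by
        gcongr
        rw [← (ENNReal.summable (f := fun j : ℕ ↦ (2 : ℝ≥0∞) ^
          (-(|((j + n : ℕ) : ℝ) - n| * κ)))).sum_add_tsum_nat_add'
          (f := fun j : ℕ ↦ (2 : ℝ≥0∞) ^ (-(|(j : ℝ) - n| * κ)))]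
        gcongr
        · rw [← Finset.sum_range_reflect]
          calc _ ≤ ∑ j ∈ Finset.range n, (2 : ℝ≥0∞) ^ (-((j : ℕ) * κ)) := by
                refine Finset.sum_le_sum fun j hj ↦ ?_
                have hj' : j + 1 ≤ n := Finset.mem_range.1 hj
                refine ENNReal.two_rpow_le_two_rpow ?_
                have : ((n - 1 - j : ℕ) : ℝ) = n - 1 - j := by
                  rw [Nat.sub_sub, Nat.cast_sub (by omega)]; push_cast; ring
                rw [this, abs_sub_comm, abs_of_nonneg (by linarith [Nat.cast_nonneg (α := ℝ) j])]
                nlinarith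
            _ ≤ _ := ENNReal.sum_le_tsum _
        · refine le_of_eq (tsum_congr fun j ↦ ?_)
          push_cast
          rw [add_sub_cancel_right, abs_of_nonneg (by positivity)]

/-- A two-sided geometric sum. -/
lemma ENNReal.tsum_min_two_rpow_le {γ η : ℝ} (hγ : 0 < γ) (hη : 0 < η) :
    ∃ C : ℝ≥0, ∀ X Y : ℝ≥0∞,
      ∑' j : ℕ, min ((2 : ℝ≥0∞) ^ (-(j * γ)) * X) ((2 : ℝ≥0∞) ^ (j * η) * Y) ≤
        C * (X ^ (η / (γ + η)) * Y ^ (γ / (γ + η))) := by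
  set κ := min γ η
  have hκ : 0 < κ := lt_min hγ hη
  obtain ⟨C, hC⟩ := ENNReal.tsum_two_rpow_neg_abs_sub_le hκ
  have e1 : 0 < η / (γ + η) := by positivity
  have e2 : 0 < γ / (γ + η) := by positivity
  refine ⟨C + 1, fun X Y ↦ ?_⟩
  rcases eq_or_ne X 0 with rfl | hX
  · simp
  rcases eq_or_ne Y 0 with rfl | hY
  · simp
  rcases eq_or_ne X ⊤ with rfl | hX'
  · rw [ENNReal.top_rpow_of_pos e1, ENNReal.top_mul (by simp [ENNReal.rpow_eq_zero_iff, hY, e2.le]),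
      ENNReal.mul_top (by simp)]
    exact le_top
  rcases eq_or_ne Y ⊤ with rfl | hY'
  · rw [ENNReal.top_rpow_of_pos e2, ENNReal.mul_top (by simp [ENNReal.rpow_eq_zero_iff, hX, e1.le]),
      ENNReal.mul_top (by simp)]
    exact le_top
  obtain ⟨x, rfl⟩ : ∃ x : ℝ, X = 2 ^ x := by
    refine ⟨Real.logb 2 X.toReal, ?_⟩
    have := Real.rpow_logb two_pos (by norm_num) (ENNReal.toReal_pos hX hX')
    rw [← ENNReal.ofReal_ofNat, ENNReal.ofReal_rpow_of_pos two_pos, this, ENNReal.ofReal_toReal hX']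
  obtain ⟨y, rfl⟩ : ∃ y : ℝ, Y = 2 ^ y := by
    refine ⟨Real.logb 2 Y.toReal, ?_⟩
    have := Real.rpow_logb two_pos (by norm_num) (ENNReal.toReal_pos hY hY')
    rw [← ENNReal.ofReal_ofNat, ENNReal.ofReal_rpow_of_pos two_pos, this, ENNReal.ofReal_toReal hY']
  -- The crossover scale, where 2^(-lγ) X = 2^(lη) Y. Away from l the minimum decays at least at the
  -- rate min γ η.
  set l := (x - y) / (γ + η)
  have hl : l * (γ + η) = x - y := div_mul_cancel₀ _ (by positivity)
  have hZ : ((2 : ℝ≥0∞) ^ x) ^ (η / (γ + η)) * ((2 : ℝ≥0∞) ^ y) ^ (γ / (γ + η))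
      = 2 ^ (x - l * γ) := by
    rw [← ENNReal.rpow_mul, ← ENNReal.rpow_mul, ENNReal.two_rpow_mul_two_rpow]
    congr 1
    simp only [l]
    field_simp
    ring
  rw [hZ]
  calc _ ≤ ∑' j : ℕ, (2 : ℝ≥0∞) ^ (x - l * γ) * (2 : ℝ≥0∞) ^ (-(κ * |j - l|)) := by
        gcongr with j
        simp_rw [ENNReal.two_rpow_mul_two_rpow]
        rcases le_total l j with h | h
        · refine (min_le_left _ _).trans (ENNReal.two_rpow_le_two_rpow ?_)
          rw [abs_of_nonneg (by linarith)]
          nlinarith [min_le_left γ η]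
        · refine (min_le_right _ _).trans (ENNReal.two_rpow_le_two_rpow ?_)
          rw [abs_of_nonpos (by linarith)]
          nlinarith [min_le_right γ η]
    _ = (2 : ℝ≥0∞) ^ (x - l * γ) * ∑' j : ℕ, (2 : ℝ≥0∞) ^ (-(κ * |j - l|)) :=
        ENNReal.tsum_mul_left
    _ ≤ (2 : ℝ≥0∞) ^ (x - l * γ) * C := by gcongr; exact hC l
    _ ≤ _ := by
        rw [mul_comm]
        gcongr
        exact_mod_cast (le_add_of_nonneg_right zero_le_one : C ≤ C + 1)

end Sums

/-! ### Integrals of the kernels |x - y|^(-(d + t)) -/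

section Kernel

lemma ENNReal.one_le_mul_inv_of_le {a b : ℝ≥0∞} (h : a ≤ b) (ha : a ≠ 0) (ha' : a ≠ ⊤) :
    1 ≤ b * a⁻¹ := by
  rw [← ENNReal.mul_inv_cancel ha ha']
  gcongr

variable {E : Type*} [NormedAddCommGroup E] [NormedSpace ℝ E] [FiniteDimensional ℝ E]
  [MeasurableSpace E] [BorelSpace E] (μ : Measure E) [μ.IsAddHaarMeasure]

open Module

lemma measure_edist_le_le (x : E) (r : ℝ≥0∞) :
    μ {y | edist x y ≤ r} ≤ r ^ (finrank ℝ E : ℝ) * μ (Metric.closedBall 0 1) ∨ r = ⊤ := by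
  rcases eq_or_ne r ⊤ with rfl | hr
  · exact Or.inr rfl
  lift r to ℝ≥0 using hr
  refine Or.inl (le_of_eq ?_)
  have : {y | edist x y ≤ r} = Metric.closedBall x r := by
    ext y
    rw [mem_ofPred_eq, Metric.mem_closedBall', edist_nndist, dist_nndist, ENNReal.coe_le_coe,
      NNReal.coe_le_coe]
  rw [this, Measure.addHaar_closedBall' μ x r.coe_nonneg, ENNReal.rpow_natCast,
    ENNReal.ofReal_pow r.coe_nonneg]
  simp

/-- The tail of the kernel `|x - y| ^ (-(d + t))`. -/
lemma lintegral_kernel_tail_le {t : ℝ} (ht : 0 < t) :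
    ∃ C : ℝ≥0, ∀ (x : E) (T : ℝ≥0∞),
      ∫⁻ y, (if T ≤ edist x y then (edist x y ^ (finrank ℝ E + t))⁻¹ else 0) ∂μ ≤
        C * (T ^ t)⁻¹ := by
  set d : ℝ := (finrank ℝ E : ℝ)
  have hd : 0 ≤ d := by positivity
  set V := μ (Metric.closedBall (0 : E) 1)
  have hVt : V ≠ ⊤ := measure_closedBall_lt_top.ne
  have hS := ENNReal.tsum_two_rpow_neg_mul_ne_top ht
  set S := ∑' k : ℕ, (2 : ℝ≥0∞) ^ (-(k * t))
  have hC : S * ((2 : ℝ≥0∞) ^ d * V) ≠ ⊤ :=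
    ENNReal.mul_ne_top hS (ENNReal.mul_ne_top (ENNReal.two_rpow_ne_top _) hVt)
  -- The added 1 keeps the constant away from zero, so that the right-hand side is infinite when T =
  -- 0.
  refine ⟨(S * ((2 : ℝ≥0∞) ^ d * V)).toNNReal + 1, fun x T ↦ ?_⟩
  rw [ENNReal.coe_add, ENNReal.coe_toNNReal hC]
  rcases eq_or_ne T 0 with rfl | hT0
  · rw [ENNReal.zero_rpow_of_pos ht, ENNReal.inv_zero, ENNReal.mul_top (by simp)]
    exact le_top
  rcases eq_or_ne T ⊤ with rfl | hT
  · simp [edist_ne_top]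
  -- Decomposition into the shells 2^k T ≤ |x - y| < 2^(k+1) T; each shell contributes about 2^(-kt)
  -- T^(-t).
  have hpt (y : E) : (if T ≤ edist x y then (edist x y ^ (d + t))⁻¹ else 0) ≤
      ∑' k : ℕ, {y | edist x y ≤ 2 ^ (k + 1) * T}.indicator
        (fun _ ↦ ((2 ^ k * T) ^ (d + t))⁻¹) y := by
    split_ifs with h
    · have hx : ∃ k : ℕ, edist x y < 2 ^ (k + 1) * T := by
        obtain ⟨k, hk⟩ := ENNReal.exists_nat_mul_gt hT0 (edist_ne_top x y)
        refine ⟨k, hk.trans_le ?_⟩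
        gcongr
        exact_mod_cast (Nat.lt_two_pow_self.le.trans (Nat.pow_le_pow_right (by norm_num) (by simp)))
      classical
      set k := Nat.find hx
      have hk : edist x y < 2 ^ (k + 1) * T := Nat.find_spec hx
      have hk' : 2 ^ k * T ≤ edist x y := by
        rcases Nat.eq_zero_or_pos k with h0 | h0
        · simpa [h0] using h
        · have := Nat.find_min hx (Nat.sub_lt h0 one_pos)
          rw [not_lt] at this
          have h1 : k - 1 + 1 = k := Nat.sub_add_cancel h0
          rwa [h1] at this
      refine le_trans ?_ (ENNReal.le_tsum k)
      rw [indicator_of_mem (show y ∈ {y | edist x y ≤ 2 ^ (k + 1) * T} from hk.le)]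
      gcongr
    · exact zero_le
  have hms (k : ℕ) : MeasurableSet {y | edist x y ≤ 2 ^ (k + 1) * T} :=
    measurableSet_le (by fun_prop) measurable_const
  calc _ ≤ ∫⁻ y, ∑' k : ℕ, {y | edist x y ≤ 2 ^ (k + 1) * T}.indicator
        (fun _ ↦ ((2 ^ k * T) ^ (d + t))⁻¹) y ∂μ := lintegral_mono hpt
    _ = ∑' k : ℕ, ((2 ^ k * T) ^ (d + t))⁻¹ * μ {y | edist x y ≤ 2 ^ (k + 1) * T} := by
        rw [lintegral_tsum fun k ↦ (measurable_const.indicator (hms k)).aemeasurable]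
        congr 1
        ext k
        rw [lintegral_indicator (hms k), setLIntegral_const]
    _ ≤ ∑' k : ℕ, (2 : ℝ≥0∞) ^ (-(k * t)) * ((2 : ℝ≥0∞) ^ d * V * (T ^ t)⁻¹) := by
        refine ENNReal.tsum_le_tsum fun k ↦ ?_
        have hne : 2 ^ (k + 1) * T ≠ ⊤ := ENNReal.mul_ne_top (by simp) hT
        calc _ ≤ ((2 ^ k * T) ^ (d + t))⁻¹ * ((2 ^ (k + 1) * T) ^ d * V) := by
              gcongr
              exact (measure_edist_le_le μ x _).resolve_right hne
          _ = _ := by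
              have e0 : (2 : ℝ≥0∞) ^ k = 2 ^ (k : ℝ) := (ENNReal.rpow_natCast _ _).symm
              have e1 : (2 : ℝ≥0∞) ^ (k + 1) = 2 ^ ((k : ℝ) + 1) := by
                rw [← ENNReal.rpow_natCast]; push_cast; rfl
              have hTd : T ^ d ≠ 0 := by simp [ENNReal.rpow_eq_zero_iff, hT0, hT]
              have hTd' : T ^ d ≠ ⊤ := by simp [ENNReal.rpow_eq_top_iff, hT0, hT]
              have hTt : T ^ t ≠ 0 := by simp [ENNReal.rpow_eq_zero_iff, hT0, hT]
              rw [e0, e1, ENNReal.mul_rpow_of_nonneg _ _ (by linarith),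
                ENNReal.mul_rpow_of_nonneg _ _ hd, ENNReal.rpow_add _ _ hT0 hT,
                ENNReal.mul_inv (Or.inl (by simp [ENNReal.rpow_eq_zero_iff]))
                  (Or.inl (by simp [ENNReal.rpow_eq_top_iff])),
                ENNReal.mul_inv (Or.inl hTd) (Or.inl hTd'), ← ENNReal.rpow_mul, ← ENNReal.rpow_mul,
                ENNReal.inv_two_rpow]
              calc _ = ((2 : ℝ≥0∞) ^ (-(k * (d + t))) * 2 ^ ((k + 1) * d)) * V * (T ^ t)⁻¹ *
                    ((T ^ d)⁻¹ * T ^ d) := by ring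
                _ = ((2 : ℝ≥0∞) ^ (-(k * t)) * 2 ^ d) * V * (T ^ t)⁻¹ := by
                  rw [ENNReal.inv_mul_cancel hTd hTd', mul_one, ENNReal.two_rpow_mul_two_rpow,
                    ENNReal.two_rpow_mul_two_rpow]
                  rw [show -((k : ℝ) * (d + t)) + (k + 1) * d = -(k * t) + d by ring]
                _ = _ := by ring
    _ = S * (2 ^ d * V) * (T ^ t)⁻¹ := by rw [ENNReal.tsum_mul_right]; ring
    _ ≤ _ := by gcongr; exact le_self_add

/-- Interpolation between kernels of different orders. -/
lemma lintegral_kernel_interpolate {r q : ℝ} (hr : 0 < r) (hrq : r < q) :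
    ∃ C : ℝ≥0, ∀ (x : E) (f : E → ℝ≥0∞), Measurable f → (∀ y, f y ≤ 1) →
      ∫⁻ y, f y / edist x y ^ (finrank ℝ E + r) ∂μ ≤
        C * (∫⁻ y, f y / edist x y ^ (finrank ℝ E + q) ∂μ) ^ (r / q) := by
  set d : ℝ := (finrank ℝ E : ℝ)
  have hd : 0 ≤ d := by positivity
  have hq : 0 < q := hr.trans hrq
  obtain ⟨C, hC⟩ := lintegral_kernel_tail_le μ hr
  refine ⟨1 + C, fun x f hf hf1 ↦ ?_⟩
  set Φ := ∫⁻ y, f y / edist x y ^ (d + q) ∂μ with hΦ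
  have hmeas (a : ℝ) : Measurable fun y ↦ f y / edist x y ^ a := by fun_prop
  rcases eq_or_ne Φ 0 with h0 | h0
  · have : ∀ᵐ y ∂μ, f y / edist x y ^ (d + r) = 0 := by
      filter_upwards [(lintegral_eq_zero_iff (hmeas _)).1 h0] with y hy
      simp only [Pi.zero_apply, ENNReal.div_eq_zero_iff] at hy ⊢
      rcases hy with hy | hy
      · exact Or.inl hy
      · rw [ENNReal.rpow_eq_top_iff_of_pos (by linarith)] at hy
        exact absurd hy (edist_ne_top _ _)
    rw [lintegral_congr_ae this]
    simp
  rcases eq_or_ne Φ ⊤ with ht | ht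
  · rw [ht, ENNReal.top_rpow_of_pos (by positivity), ENNReal.mul_top (by simp)]
    exact le_top
  -- The radius balancing the two regions: inside, the kernel of order d + r is at most T^(q-r)
  -- times that of order d + q; outside, f ≤ 1 and the tail estimate applies. Both give Φ^(r/q).
  set T := Φ ^ (-(1 / q))
  have hT0 : T ≠ 0 := by simp [T, ENNReal.rpow_eq_zero_iff, h0, ht]
  have hTt : T ≠ ⊤ := by simp [T, ENNReal.rpow_eq_top_iff, h0, ht]
  calc _ ≤ ∫⁻ y, (T ^ (q - r) * (f y / edist x y ^ (d + q)) +
        (if T ≤ edist x y then (edist x y ^ (d + r))⁻¹ else 0)) ∂μ := by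
        refine lintegral_mono fun y ↦ ?_
        split_ifs with h
        · refine le_trans ?_ le_add_self
          rw [div_eq_mul_inv]
          exact mul_le_of_le_one_left' (hf1 y)
        · rw [add_zero, div_eq_mul_inv, div_eq_mul_inv, mul_left_comm]
          gcongr
          rcases eq_or_ne (edist x y) 0 with h1 | h1
          · rw [h1, ENNReal.zero_rpow_of_pos (by linarith : 0 < d + q), ENNReal.inv_zero,
              ENNReal.mul_top]
            · exact le_top
            · simp [ENNReal.rpow_eq_zero_iff, hT0, hTt]
          · have h2 := edist_ne_top x y
            have : d + q = (d + r) + (q - r) := by ring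
            rw [this, ENNReal.rpow_add (d + r) _ h1 h2, ENNReal.mul_inv
              (Or.inl (by simp [ENNReal.rpow_eq_zero_iff, h1, h2]))
              (Or.inl (by simp [ENNReal.rpow_eq_top_iff, h1, h2])), mul_left_comm]
            refine le_mul_of_one_le_right' (ENNReal.one_le_mul_inv_of_le ?_ ?_ ?_)
            · exact ENNReal.rpow_le_rpow (not_le.1 h).le (by linarith)
            · simp [ENNReal.rpow_eq_zero_iff, h1, h2]
            · simp [ENNReal.rpow_eq_top_iff, h1, h2]
    _ = T ^ (q - r) * Φ + ∫⁻ y, (if T ≤ edist x y then (edist x y ^ (d + r))⁻¹ else 0) ∂μ := by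
        rw [lintegral_add_left ((hmeas _).const_mul _), lintegral_const_mul _ (hmeas _)]
    _ ≤ T ^ (q - r) * Φ + C * (T ^ r)⁻¹ := by gcongr; exact hC x T
    _ = (1 + C) * Φ ^ (r / q) := by
        have e1 : T ^ (q - r) * Φ = Φ ^ (r / q) := by
          conv_lhs => enter [2]; rw [← ENNReal.rpow_one Φ]
          rw [← ENNReal.rpow_mul, ← ENNReal.rpow_add _ _ h0 ht]
          congr 1
          field_simp
          ring
        have e2 : (T ^ r)⁻¹ = Φ ^ (r / q) := by
          rw [← ENNReal.rpow_mul, ← ENNReal.rpow_neg]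
          congr 1
          field_simp
        rw [e1, e2]
        ring
    _ = _ := by simp

/-- A Hölder estimate: the mean of `f` near `x` is controlled by its singular integral. -/
lemma setLIntegral_le_kernel {p q : ℝ} (hp : 1 < p) (hq : 0 < q) :
    ∃ C : ℝ≥0, ∀ (x : E) (f : E → ℝ≥0∞) (ρ : ℝ≥0∞) (S : Set E), ρ ≠ ⊤ → Measurable f → f x = 0 →
      S ⊆ {y | edist x y ≤ ρ} →
      ∫⁻ y in S, f y ∂μ ≤ C * (ρ ^ (finrank ℝ E + q / p) *
        (∫⁻ y in S, f y ^ p / edist x y ^ (finrank ℝ E + q) ∂μ) ^ (1 / p)) := by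
  set d : ℝ := (finrank ℝ E : ℝ)
  have hd : 0 ≤ d := by positivity
  have hpq := Real.HolderConjugate.conjExponent hp
  set p' := p.conjExponent
  have hp0 : 0 < p := by linarith
  set V := μ (Metric.closedBall (0 : E) 1)
  have hVt : V ^ (1 / p') ≠ ⊤ :=
    ENNReal.rpow_ne_top_of_nonneg (by simpa using hpq.symm.pos.le) measure_closedBall_lt_top.ne
  refine ⟨(V ^ (1 / p')).toNNReal, fun x f ρ S hρ hf hfx hS ↦ ?_⟩
  rw [ENNReal.coe_toNNReal hVt]
  have hSms : ∀ᵐ y ∂(μ.restrict S), edist x y ≤ ρ := by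
    refine ae_restrict_of_ae_restrict_of_subset hS (ae_restrict_mem ?_)
    exact measurableSet_le (f := fun y ↦ edist x y) (by fun_prop) measurable_const
  have h := ENNReal.lintegral_mul_le_Lp_mul_Lq (μ.restrict S) hpq
    (f := f) (g := fun _ ↦ 1) hf.aemeasurable aemeasurable_const
  simp only [Pi.mul_apply, mul_one, ENNReal.one_rpow, lintegral_const, one_mul,
    Measure.restrict_apply_univ] at h
  have h1 : ∫⁻ y in S, f y ^ p ∂μ ≤
      ρ ^ (d + q) * ∫⁻ y in S, f y ^ p / edist x y ^ (d + q) ∂μ := by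
    have hm : Measurable fun y ↦ f y ^ p / edist x y ^ (d + q) := by fun_prop
    rw [← lintegral_const_mul _ hm]
    refine lintegral_mono_ae ?_
    filter_upwards [hSms] with y hy
    rcases eq_or_ne (edist x y) 0 with h1 | h1
    · rw [edist_eq_zero] at h1
      simp [← h1, hfx, hp0]
    · rw [div_eq_mul_inv, mul_left_comm]
      have h2 := edist_ne_top x y
      refine le_mul_of_one_le_right' (ENNReal.one_le_mul_inv_of_le ?_ ?_ ?_)
      · exact ENNReal.rpow_le_rpow hy (by linarith)
      · simp [ENNReal.rpow_eq_zero_iff, h1, h2]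
      · simp [ENNReal.rpow_eq_top_iff, h1, h2]
  have h2 : μ S ≤ ρ ^ d * V :=
    (measure_mono hS).trans ((measure_edist_le_le μ x ρ).resolve_right hρ)
  have hpi : 0 ≤ 1 / p := by positivity
  have hpi' : 0 ≤ 1 / p' := by simpa using hpq.symm.pos.le
  calc _ ≤ _ := h
    _ ≤ (ρ ^ (d + q) * ∫⁻ y in S, f y ^ p / edist x y ^ (d + q) ∂μ) ^ (1 / p) *
        (ρ ^ d * V) ^ (1 / p') := by gcongr
    _ = _ := by
      rw [ENNReal.mul_rpow_of_nonneg _ _ hpi, ENNReal.mul_rpow_of_nonneg _ _ hpi',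
        ← ENNReal.rpow_mul, ← ENNReal.rpow_mul]
      have : ρ ^ (d + q / p) = ρ ^ ((d + q) * (1 / p)) * ρ ^ (d * (1 / p')) := by
        rw [← ENNReal.rpow_add_of_nonneg _ _ (by positivity) (by positivity)]
        congr 1
        have := hpq.inv_add_inv_eq_one
        rw [one_div, one_div]
        linear_combination (-d) * this
      rw [this]
      ring

end Kernel

/-! ### Small values and jumps -/

/-- The part below the threshold `1`. -/
def cutoff (a : ℝ≥0∞) : ℝ≥0∞ := if a < 1 then a else 0

lemma measurable_cutoff : Measurable cutoff :=
  Measurable.ite measurableSet_Iio measurable_id measurable_const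

lemma cutoff_le_one (a : ℝ≥0∞) : cutoff a ≤ 1 := by
  unfold cutoff; split_ifs with h
  · exact h.le
  · simp

@[simp] lemma cutoff_zero : cutoff 0 = 0 := by simp [cutoff]

/-- The part above a threshold in `[1 / 4, 1 / 2]`, with a weight in `[1, 2]`. As `j` increases
the threshold decreases and the weight increases. -/
def jumpPart (θ : ℝ) (j : ℕ) (a : ℝ≥0∞) : ℝ≥0∞ :=
  if ENNReal.ofReal ((1 + θ ^ j) / 4) ≤ a then ENNReal.ofReal (2 - θ ^ j) * a else 0

lemma measurable_jumpPart (θ : ℝ) (j : ℕ) : Measurable (jumpPart θ j) :=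
  Measurable.ite measurableSet_Ici (by fun_prop) measurable_const

@[simp] lemma jumpPart_zero (θ : ℝ) (j : ℕ) : jumpPart θ j 0 = 0 := by simp [jumpPart]

/-- The thresholds never go below 1/4 and the weights never exceed 2. Hence the jump parts of all
levels are dominated by one function, which makes dominated convergence possible after infinitely
many bisections. -/
lemma jumpPart_le {θ : ℝ} (hθ : 0 < θ) (j : ℕ) {a Λ : ℝ≥0∞} (ha : a ≤ Λ) :
    jumpPart θ j a ≤ if 1 / 4 ≤ a then 2 * Λ else 0 := by
  have h0 : 0 < θ ^ j := by positivity
  have h4 : (1 / 4 : ℝ≥0∞) = ENNReal.ofReal (1 / 4) := by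
    rw [ENNReal.ofReal_div_of_pos (by norm_num)]; simp
  unfold jumpPart
  split_ifs with h1 h2
  · gcongr
    rw [← ENNReal.ofReal_ofNat]
    exact ENNReal.ofReal_le_ofReal (by linarith)
  · refine absurd (le_trans ?_ h1) h2
    rw [h4]
    exact ENNReal.ofReal_le_ofReal (by linarith)
  · simp
  · simp

lemma le_half_add_jumpPart_zero (θ : ℝ) (a : ℝ≥0∞) : a ≤ 1 + jumpPart θ 0 a := by
  have : ENNReal.ofReal ((1 + 1) / 4) ≤ 1 := by
    rw [← ENNReal.ofReal_one]; exact ENNReal.ofReal_le_ofReal (by norm_num)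
  unfold jumpPart
  split_ifs with h
  · norm_num
  · rw [pow_zero] at h
    exact ((not_le.1 h).le.trans this).trans le_self_add

lemma self_le_jumpPart_zero (θ : ℝ) {a : ℝ≥0∞} (ha : 1 ≤ a) : a ≤ jumpPart θ 0 a := by
  have : ENNReal.ofReal ((1 + 1) / 4) ≤ 1 := by
    rw [← ENNReal.ofReal_one]; exact ENNReal.ofReal_le_ofReal (by norm_num)
  unfold jumpPart
  rw [pow_zero, if_pos (this.trans ha)]
  norm_num

/-- The splitting inequality. -/
lemma jumpPart_le_add {θ p : ℝ} (hθ : 0 < θ) (hθ1 : θ < 1) (hp : 0 < p) (j : ℕ) {D a b : ℝ≥0∞}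
    (h : D ≤ a + b) :
    jumpPart θ j D ≤ jumpPart θ (j + 1) a + jumpPart θ (j + 1) b +
      ENNReal.ofReal (2 * ((1 - θ) * θ ^ j / 8) ^ (-p)) * (cutoff a ^ p + cutoff b ^ p) := by
  have hj : 0 < θ ^ j := by positivity
  have hj1 : θ ^ j ≤ 1 := pow_le_one₀ hθ.le hθ1.le
  have hjs : θ ^ (j + 1) = θ ^ j * θ := pow_succ _ _
  -- From level j to level j + 1 the threshold drops by 2g and the weight grows by 8g.
  set g := (1 - θ) * θ ^ j / 8 with hg
  have hg0 : 0 < g := by have : 0 < 1 - θ := by linarith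
                         positivity
  set H := ENNReal.ofReal (2 * g ^ (-p))
  have hgj : θ ^ (j + 1) = θ ^ j - 8 * g := by rw [hjs, hg]; ring
  have hg1 : 8 * g ≤ θ ^ j := by rw [hg]; nlinarith
  -- A half that carries at least g either still counts as a jump or lies between g and 1. In the
  -- second case its weighted size is at most 2 = H g^p, which the small part pays.
  have claim1 (a : ℝ≥0∞) (ha : ENNReal.ofReal g ≤ a) :
      ENNReal.ofReal (2 - θ ^ j) * a ≤ jumpPart θ (j + 1) a + H * cutoff a ^ p := by
    unfold jumpPart
    split_ifs with h1
    · refine le_trans ?_ le_self_add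
      exact mul_le_mul' (ENNReal.ofReal_le_ofReal (by linarith)) le_rfl
    · have ha1 : a < 1 := by
        refine (not_le.1 h1).trans_le ?_
        rw [← ENNReal.ofReal_one]
        exact ENNReal.ofReal_le_ofReal (by linarith)
      rw [cutoff, if_pos ha1, zero_add]
      calc ENNReal.ofReal (2 - θ ^ j) * a ≤ ENNReal.ofReal 2 * 1 := by
            gcongr; linarith
        _ = H * ENNReal.ofReal g ^ p := by
            rw [ENNReal.ofReal_rpow_of_pos hg0, ← ENNReal.ofReal_mul (by positivity), mul_one,
              mul_assoc, ← Real.rpow_add hg0]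
            simp
        _ ≤ _ := by gcongr
  -- If one half carries less than g, the other one stays above the lowered threshold. The lost
  -- amount, at most g, is recovered from the growth 8g of the weight, because the remaining value
  -- is at least (1 + θ^(j+1)) / 4. Nothing is charged to the small part.
  have claim2 (a b : ℝ≥0∞) (ha : a < ENNReal.ofReal g) (hD : D ≤ a + b)
      (hc : ENNReal.ofReal ((1 + θ ^ j) / 4) ≤ D) :
      ENNReal.ofReal (2 - θ ^ j) * D ≤ jumpPart θ (j + 1) b := by
    have hb : ENNReal.ofReal ((1 + θ ^ (j + 1)) / 4) ≤ b := by
      have : ENNReal.ofReal g + ENNReal.ofReal ((1 + θ ^ (j + 1)) / 4) ≤ ENNReal.ofReal g + b := by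
        rw [← ENNReal.ofReal_add hg0.le (by positivity)]
        refine le_trans (ENNReal.ofReal_le_ofReal ?_) (hc.trans (hD.trans (by gcongr)))
        linarith
      exact (ENNReal.add_le_add_iff_left ENNReal.ofReal_ne_top).1 this
    rw [jumpPart, if_pos hb]
    calc _ ≤ ENNReal.ofReal (2 - θ ^ j) * (ENNReal.ofReal g + b) := by
          gcongr; exact hD.trans (by gcongr)
      _ = ENNReal.ofReal ((2 - θ ^ j) * g) + ENNReal.ofReal (2 - θ ^ j) * b := by
          rw [mul_add, ENNReal.ofReal_mul (by linarith)]
      _ ≤ ENNReal.ofReal (8 * g * ((1 + θ ^ (j + 1)) / 4)) + ENNReal.ofReal (2 - θ ^ j) * b := by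
          refine add_le_add (ENNReal.ofReal_le_ofReal ?_) le_rfl
          have : 0 < θ ^ (j + 1) := by positivity
          nlinarith
      _ ≤ ENNReal.ofReal (8 * g) * b + ENNReal.ofReal (2 - θ ^ j) * b := by
          rw [ENNReal.ofReal_mul (by positivity)]
          gcongr
      _ = ENNReal.ofReal (2 - θ ^ (j + 1)) * b := by
          rw [← add_mul, ← ENNReal.ofReal_add (by positivity) (by linarith), hgj]
          congr 2; ring
  rw [jumpPart]
  split_ifs with hc
  · rcases lt_or_ge a (ENNReal.ofReal g) with ha | ha
    · refine (claim2 a b ha h hc).trans (le_trans ?_ le_self_add)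
      exact le_add_self
    · rcases lt_or_ge b (ENNReal.ofReal g) with hb | hb
      · refine (claim2 b a hb (add_comm a b ▸ h) hc).trans (le_trans ?_ le_self_add)
        exact le_self_add
      · calc _ ≤ ENNReal.ofReal (2 - θ ^ j) * a + ENNReal.ofReal (2 - θ ^ j) * b := by
              rw [← mul_add]; gcongr
          _ ≤ _ := add_le_add (claim1 a ha) (claim1 b hb)
          _ = _ := by rw [mul_add]; abel
  · exact zero_le

/-- A measurable pseudo-distance. -/
structure IsMeasurablePseudoDist {E : Type*} [MeasurableSpace E] (W : E → E → ℝ≥0∞) : Prop where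
  self : ∀ x, W x x = 0
  comm : ∀ x y, W x y = W y x
  triangle : ∀ x y z, W x z ≤ W x y + W y z
  measurable : Measurable (Function.uncurry W)

/-! ### Subdivision of segments -/

section Segments

variable {E : Type*} [NormedAddCommGroup E] [NormedSpace ℝ E]

/-- The `i`-th point of the subdivision of a segment into `2 ^ n` equal pieces. -/
def segPoint (x y : E) (n i : ℕ) : E := x + ((i : ℝ) / 2 ^ n) • (y - x)

/-- The sum of a function `F` of the lengths of the pieces of a subdivided segment. -/
def segSum (W : E → E → ℝ≥0∞) (F : ℝ≥0∞ → ℝ≥0∞) (n : ℕ) (x y : E) : ℝ≥0∞ :=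
  ∑ i ∈ Finset.range (2 ^ n), F (W (segPoint x y n i) (segPoint x y n (i + 1)))

lemma segPoint_succ (x y : E) (n i : ℕ) : segPoint x y (n + 1) (2 * i) = segPoint x y n i := by
  unfold segPoint
  congr 2
  push_cast
  field_simp
  ring

lemma Finset.sum_range_two_mul {M : Type*} [AddCommMonoid M] (f : ℕ → M) (N : ℕ) :
    ∑ i ∈ Finset.range (2 * N), f i = ∑ i ∈ Finset.range N, (f (2 * i) + f (2 * i + 1)) := by
  induction N with
  | zero => simp
  | succ N ih => rw [mul_add, mul_one, Finset.sum_range_succ, Finset.sum_range_succ, ih,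
      Finset.sum_range_succ, add_assoc]

/-- Every piece is cut at its midpoint, which is a point of the next subdivision, so a rule for
halving one piece carries over to the whole sum. -/
lemma segSum_le_succ {W : E → E → ℝ≥0∞} (htri : ∀ x y z, W x z ≤ W x y + W y z)
    {F G : ℝ≥0∞ → ℝ≥0∞} (h : ∀ D a b, D ≤ a + b → F D ≤ G a + G b) (n : ℕ) (x y : E) :
    segSum W F n x y ≤ segSum W G (n + 1) x y := by
  unfold segSum
  rw [pow_succ, mul_comm (2 ^ n), Finset.sum_range_two_mul]
  refine Finset.sum_le_sum fun i _ ↦ ?_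
  rw [segPoint_succ, show 2 * i + 1 + 1 = 2 * (i + 1) by ring, segPoint_succ]
  exact h _ _ _ (htri _ _ _)

lemma segSum_add (W : E → E → ℝ≥0∞) (F G : ℝ≥0∞ → ℝ≥0∞) (n : ℕ) (x y : E) :
    segSum W (fun a ↦ F a + G a) n x y = segSum W F n x y + segSum W G n x y :=
  Finset.sum_add_distrib

lemma segSum_mono (W : E → E → ℝ≥0∞) {F G : ℝ≥0∞ → ℝ≥0∞} (h : ∀ a, F a ≤ G a) (n : ℕ) (x y : E) :
    segSum W F n x y ≤ segSum W G n x y :=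
  Finset.sum_le_sum fun _ _ ↦ h _

lemma segSum_zero (W : E → E → ℝ≥0∞) (F : ℝ≥0∞ → ℝ≥0∞) (x y : E) :
    segSum W F 0 x y = F (W x y) := by
  simp [segSum, segPoint]

lemma le_segSum {W : E → E → ℝ≥0∞} (htri : ∀ x y z, W x z ≤ W x y + W y z) (n : ℕ) (x y : E) :
    W x y ≤ segSum W id n x y := by
  induction n with
  | zero => rw [segSum_zero]; rfl
  | succ n ih => exact ih.trans (segSum_le_succ htri (fun D a b h ↦ h) n x y)

/-- The splitting inequality iterated n times from the subdivision of level k. The level of the jump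
part starts at 0 whatever k is; this decoupling is what later yields a gain in k. -/
lemma segSum_jumpPart_le {W : E → E → ℝ≥0∞} (htri : ∀ x y z, W x z ≤ W x y + W y z)
    {θ p : ℝ} (hθ : 0 < θ) (hθ1 : θ < 1) (hp : 0 < p) (k n : ℕ) (x y : E) :
    segSum W (jumpPart θ 0) k x y ≤ segSum W (jumpPart θ n) (k + n) x y +
      ∑ j ∈ Finset.range n, segSum W
        (fun a ↦ ENNReal.ofReal (2 * ((1 - θ) * θ ^ j / 8) ^ (-p)) * cutoff a ^ p) (k + j + 1) x y := by
  induction n with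
  | zero => simp
  | succ n ih =>
    refine ih.trans ?_
    rw [Finset.sum_range_succ, add_comm (∑ j ∈ Finset.range n, _), ← add_assoc]
    gcongr
    rw [← add_assoc, ← segSum_add]
    refine segSum_le_succ htri (fun D a b h ↦ ?_) _ x y
    refine (jumpPart_le_add hθ hθ1 hp n h).trans (le_of_eq ?_)
    ring

end Segments

/-! ### Averaging over all segments of a convex set -/

lemma setLIntegral_setLIntegral_eq {E : Type*} [MeasurableSpace E] {μ : Measure E} {Q : Set E} (hQ : MeasurableSet Q) (f : E → E → ℝ≥0∞) :
    ∫⁻ x in Q, ∫⁻ y in Q, f x y ∂μ ∂μ = ∫⁻ x, ∫⁻ y, (Q ×ˢ Q).indicator (Function.uncurry f) (x, y)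
      ∂μ ∂μ := by
  rw [← lintegral_indicator hQ]
  refine lintegral_congr fun x ↦ ?_
  by_cases hx : x ∈ Q
  · rw [indicator_of_mem hx, ← lintegral_indicator hQ]
    refine lintegral_congr fun y ↦ ?_
    by_cases hy : y ∈ Q <;> simp [hx, hy]
  · simp [hx]

section ChangeOfVariables

variable {E : Type*} [NormedAddCommGroup E] [NormedSpace ℝ E] [FiniteDimensional ℝ E]
  [MeasurableSpace E] [BorelSpace E] (μ : Measure E) [μ.IsAddHaarMeasure]

open Module

lemma lintegral_comp_smul_addHaar {f : E → ℝ≥0∞} (hf : Measurable f) {t : ℝ} (ht : 0 < t) :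
    ∫⁻ x, f (t • x) ∂μ = ENNReal.ofReal ((t ^ finrank ℝ E)⁻¹) * ∫⁻ x, f x ∂μ := by
  rw [← lintegral_map hf (measurable_const_smul t), Measure.map_addHaar_smul μ ht.ne',
    lintegral_smul_measure, abs_of_pos (by positivity)]
  rfl

/-- The map sending (x, y) to two points of the line through x and y whose parameters differ by t
has Jacobian t^d, wherever the first point is. With v = y - x it factors, under Tonelli, into
translations and a single dilation by t. -/
lemma lintegral_lintegral_segment {G : E × E → ℝ≥0∞} (hG : Measurable G) (a : ℝ) {t : ℝ}
    (ht : 0 < t) :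
    ∫⁻ x, ∫⁻ y, G (x + a • (y - x), x + (a + t) • (y - x)) ∂μ ∂μ =
      ENNReal.ofReal ((t ^ finrank ℝ E)⁻¹) * ∫⁻ z, ∫⁻ w, G (z, w) ∂μ ∂μ := by
  calc _ = ∫⁻ x, ∫⁻ v, G (x + a • v, x + (a + t) • v) ∂μ ∂μ := by
        refine lintegral_congr fun x ↦ ?_
        rw [← lintegral_add_left_eq_self _ x]
        simp only [add_sub_cancel_left]
    _ = ∫⁻ v, ∫⁻ x, G (x + a • v, x + (a + t) • v) ∂μ ∂μ := by
        refine lintegral_lintegral_swap (Measurable.aemeasurable ?_)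
        exact hG.comp (by fun_prop)
    _ = ∫⁻ v, ∫⁻ z, G (z, z + t • v) ∂μ ∂μ := by
        refine lintegral_congr fun v ↦ ?_
        rw [← lintegral_add_right_eq_self (fun z ↦ G (z, z + t • v)) (a • v)]
        simp only [add_smul, add_assoc]
    _ = ∫⁻ z, ∫⁻ v, G (z, z + t • v) ∂μ ∂μ := by
        refine lintegral_lintegral_swap (Measurable.aemeasurable ?_)
        exact hG.comp (by fun_prop)
    _ = ∫⁻ z, ENNReal.ofReal ((t ^ finrank ℝ E)⁻¹) * ∫⁻ w, G (z, w) ∂μ ∂μ := by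
        refine lintegral_congr fun z ↦ ?_
        rw [lintegral_comp_smul_addHaar μ (f := fun v ↦ G (z, z + v)) (hG.comp (by fun_prop)) ht,
          lintegral_add_left_eq_self (fun w ↦ G (z, w)) z]
    _ = _ := lintegral_const_mul' _ _ ENNReal.ofReal_ne_top

/-- Each of the 2^n pieces is a pair of points of Q, by convexity, at distance at most 2^(-n) ρ. The
change of variables costs 2^(nd) for each piece, hence 2^(n(d+1)) in total. -/
lemma setLIntegral_segSum_le {W : E → E → ℝ≥0∞} (hW : Measurable (Function.uncurry W))
    {F : ℝ≥0∞ → ℝ≥0∞} (hF : Measurable F) {Q : Set E} (hQ : MeasurableSet Q) (hQc : Convex ℝ Q)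
    {ρ : ℝ≥0∞} (hρ : ∀ x ∈ Q, ∀ y ∈ Q, edist x y ≤ ρ) (n : ℕ) :
    ∫⁻ x in Q, ∫⁻ y in Q, segSum W F n x y ∂μ ∂μ ≤
      (2 : ℝ≥0∞) ^ (n * (finrank ℝ E + 1 : ℝ)) *
        ∫⁻ x in Q, ∫⁻ y in Q, (if 2 ^ (n : ℝ) * edist x y ≤ ρ then F (W x y) else 0) ∂μ ∂μ := by
  set G : E × E → ℝ≥0∞ := (Q ×ˢ Q).indicator
    (Function.uncurry fun x y ↦ if 2 ^ (n : ℝ) * edist x y ≤ ρ then F (W x y) else 0)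
  have hG : Measurable G := by
    refine Measurable.indicator ?_ (hQ.prod hQ)
    refine Measurable.ite (measurableSet_le ?_ measurable_const) (hF.comp hW) measurable_const
    fun_prop
  have ht : (0 : ℝ) < 1 / 2 ^ n := by positivity
  have key (i : ℕ) (hi : i < 2 ^ n) :
      ∫⁻ x in Q, ∫⁻ y in Q, F (W (segPoint x y n i) (segPoint x y n (i + 1))) ∂μ ∂μ ≤
        (2 : ℝ≥0∞) ^ ((n : ℝ) * finrank ℝ E) * ∫⁻ z, ∫⁻ w, G (z, w) ∂μ ∂μ := by
    have hc : ENNReal.ofReal (((1 / 2 ^ n : ℝ) ^ finrank ℝ E)⁻¹) =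
        (2 : ℝ≥0∞) ^ ((n : ℝ) * finrank ℝ E) := by
      rw [one_div, inv_pow, inv_inv, ← pow_mul, ← Nat.cast_mul, ENNReal.rpow_natCast,
        ENNReal.ofReal_pow (by norm_num)]
      simp
    rw [← hc, ← lintegral_lintegral_segment μ hG (i / 2 ^ n : ℝ) ht,
      setLIntegral_setLIntegral_eq hQ]
    refine lintegral_mono fun x ↦ lintegral_mono fun y ↦ ?_
    by_cases hxy : (x, y) ∈ Q ×ˢ Q
    · have hi' : (i : ℝ) + 1 ≤ 2 ^ n := by exact_mod_cast hi
      have h1 : segPoint x y n i ∈ Q := hQc.add_smul_sub_mem hxy.1 hxy.2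
        ⟨by positivity, by rw [div_le_one (by positivity)]; linarith⟩
      have h2 : segPoint x y n (i + 1) ∈ Q := hQc.add_smul_sub_mem hxy.1 hxy.2
        ⟨by positivity, by rw [div_le_one (by positivity)]; push_cast; linarith⟩
      have e2 : x + ((i : ℝ) / 2 ^ n + 1 / 2 ^ n) • (y - x) = segPoint x y n (i + 1) := by
        rw [segPoint, ← add_div]; push_cast; rfl
      have e1 : x + ((i : ℝ) / 2 ^ n) • (y - x) = segPoint x y n i := rfl
      have h3 : 2 ^ (n : ℝ) * edist (segPoint x y n i) (segPoint x y n (i + 1)) ≤ ρ := by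
        refine le_trans (le_of_eq ?_) (hρ x hxy.1 y hxy.2)
        have h4 : segPoint x y n (i + 1) - segPoint x y n i = (1 / 2 ^ n : ℝ) • (y - x) := by
          rw [← e1, ← e2, add_smul]; abel
        rw [edist_comm, edist_eq_enorm_sub, h4, enorm_smul, edist_comm, edist_eq_enorm_sub,
          ENNReal.rpow_natCast, ← mul_assoc]
        have h5 : ‖(1 / 2 ^ n : ℝ)‖ₑ = ((2 : ℝ≥0∞) ^ n)⁻¹ := by
          rw [Real.enorm_eq_ofReal ht.le, one_div, ENNReal.ofReal_inv_of_pos (by positivity),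
            ENNReal.ofReal_pow (by norm_num)]
          simp
        rw [h5, ENNReal.mul_inv_cancel (by simp) (by simp), one_mul]
      rw [indicator_of_mem hxy, e1, e2]
      simp only [G]
      rw [indicator_of_mem (show (segPoint x y n i, segPoint x y n (i + 1)) ∈ Q ×ˢ Q from
        ⟨h1, h2⟩)]
      simp only [Function.uncurry, h3, if_true, le_refl]
    · rw [indicator_of_notMem hxy]
      exact zero_le
  have hmeas (i : ℕ) : Measurable (Function.uncurry fun x y ↦
      F (W (segPoint x y n i) (segPoint x y n (i + 1)))) := by
    refine hF.comp (hW.comp (f := fun z : E × E ↦ (_, _)) ?_)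
    fun_prop
  calc _ = ∑ i ∈ Finset.range (2 ^ n), ∫⁻ x in Q, ∫⁻ y in Q,
          F (W (segPoint x y n i) (segPoint x y n (i + 1))) ∂μ ∂μ := by
        unfold segSum
        rw [← lintegral_finsetSum _ fun i _ ↦ (hmeas i).lintegral_prod_right]
        refine lintegral_congr fun x ↦ ?_
        rw [← lintegral_finsetSum _ fun i _ ↦ (hmeas i).of_uncurry_left]
    _ ≤ ∑ i ∈ Finset.range (2 ^ n), (2 : ℝ≥0∞) ^ ((n : ℝ) * finrank ℝ E) *
          ∫⁻ z, ∫⁻ w, G (z, w) ∂μ ∂μ :=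
        Finset.sum_le_sum fun i hi ↦ key i (Finset.mem_range.1 hi)
    _ = _ := by
        have hpow : (2 : ℝ≥0∞) ^ (n * (finrank ℝ E + 1 : ℝ)) =
            2 ^ n * 2 ^ ((n : ℝ) * finrank ℝ E) := by
          rw [← ENNReal.rpow_natCast 2 n, ENNReal.two_rpow_mul_two_rpow]
          congr 1
          ring
        rw [setLIntegral_setLIntegral_eq hQ, Finset.sum_const, Finset.card_range, nsmul_eq_mul,
          ← mul_assoc, hpow]
        push_cast
        rfl

end ChangeOfVariables

/-! ### A Poincaré inequality for the large values -/

/-- A truncated geometric sum is comparable to its last term. It is read off the two-sided sum with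
decay rate 1: the truncation 2^l ≤ Z is majorized by the decreasing branch 2^(-l) Z^(b+1). -/
lemma ENNReal.tsum_two_rpow_le_of_le {b : ℝ} (hb : 0 < b) :
    ∃ C : ℝ≥0, ∀ Z : ℝ≥0∞,
      ∑' l : ℕ, (if (2 : ℝ≥0∞) ^ (l : ℝ) ≤ Z then (2 : ℝ≥0∞) ^ (l * b) else 0) ≤ C * Z ^ b := by
  obtain ⟨C, hC⟩ := ENNReal.tsum_min_two_rpow_le one_pos hb
  refine ⟨C, fun Z ↦ ?_⟩
  refine le_trans (ENNReal.tsum_le_tsum fun l ↦ ?_) ((hC (Z ^ (b + 1)) 1).trans (le_of_eq ?_))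
  · split_ifs with h
    · refine le_min ?_ (by rw [mul_one])
      calc (2 : ℝ≥0∞) ^ (l * b) = 2 ^ (-(l * 1 : ℝ)) * (2 ^ (l : ℝ)) ^ (b + 1) := by
            rw [← ENNReal.rpow_mul, ENNReal.two_rpow_mul_two_rpow]
            congr 1; ring
        _ ≤ _ := by gcongr
    · exact zero_le
  · rw [ENNReal.one_rpow, mul_one, ← ENNReal.rpow_mul]
    congr 2
    field_simp
    ring

lemma ENNReal.exists_two_rpow_near {Z : ℝ≥0∞} (h1 : 1 < Z) (ht : Z ≠ ⊤) :
    ∃ k : ℕ, (2 : ℝ≥0∞) ^ (k : ℝ) ≤ 2 * Z ∧ Z ≤ 2 ^ (k : ℝ) := by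
  have hx : ∃ k : ℕ, Z ≤ (2 : ℝ≥0∞) ^ k := by
    obtain ⟨k, hk⟩ := ENNReal.exists_nat_gt ht
    exact ⟨k, hk.le.trans (by exact_mod_cast Nat.lt_two_pow_self.le)⟩
  classical
  have hk := Nat.find_spec hx
  have hk0 : 0 < Nat.find hx := by
    refine Nat.pos_of_ne_zero fun h ↦ ?_
    rw [h, pow_zero] at hk
    exact absurd hk (not_le.2 h1)
  have hk' := Nat.find_min hx (Nat.sub_lt hk0 one_pos)
  refine ⟨Nat.find hx, ?_, by rwa [ENNReal.rpow_natCast]⟩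
  rw [ENNReal.rpow_natCast, ← Nat.sub_add_cancel hk0, pow_succ, mul_comm]
  gcongr
  exact (not_le.1 hk').le

section Poincare

variable {E : Type*} [NormedAddCommGroup E] [NormedSpace ℝ E] [FiniteDimensional ℝ E]
  [MeasurableSpace E] [BorelSpace E] (μ : Measure E) [μ.IsAddHaarMeasure]

open Module

lemma measurable_segSum {W : E → E → ℝ≥0∞} (hW : Measurable (Function.uncurry W))
    {F : ℝ≥0∞ → ℝ≥0∞} (hF : Measurable F) (n : ℕ) :
    Measurable (Function.uncurry (segSum W F n)) := by
  have : Function.uncurry (segSum W F n) = fun z ↦ ∑ i ∈ Finset.range (2 ^ n),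
      F (Function.uncurry W (segPoint z.1 z.2 n i, segPoint z.1 z.2 n (i + 1))) := by
    ext z; rfl
  rw [this]
  refine Finset.measurable_fun_sum _ fun i _ ↦ hF.comp (hW.comp ?_)
  have (i : ℕ) : Measurable fun z : E × E ↦ segPoint z.1 z.2 n i := by
    unfold segPoint; fun_prop
  exact (this i).prodMk (this (i + 1))

lemma lintegral_prod_segSum_le {W : E → E → ℝ≥0∞} (hW : Measurable (Function.uncurry W))
    {F : ℝ≥0∞ → ℝ≥0∞} (hF : Measurable F) {Q : Set E} (hQ : MeasurableSet Q) (hQc : Convex ℝ Q)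
    {ρ : ℝ≥0∞} (hρ : ∀ x ∈ Q, ∀ y ∈ Q, edist x y ≤ ρ) (n : ℕ) :
    ∫⁻ z, segSum W F n z.1 z.2 ∂((μ.restrict Q).prod (μ.restrict Q)) ≤
      (2 : ℝ≥0∞) ^ (n * (finrank ℝ E + 1 : ℝ)) *
        ∫⁻ z, (if 2 ^ (n : ℝ) * edist z.1 z.2 ≤ ρ then F (W z.1 z.2) else 0)
          ∂((μ.restrict Q).prod (μ.restrict Q)) := by
  rw [lintegral_prod (fun z : E × E ↦ segSum W F n z.1 z.2)
    (measurable_segSum hW hF n).aemeasurable, lintegral_prod]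
  · exact setLIntegral_segSum_le μ hW hF hQ hQc hρ n
  · refine Measurable.aemeasurable (Measurable.ite (measurableSet_le ?_ measurable_const)
      (hF.comp hW) measurable_const)
    fun_prop

/-- Bisection is continued forever from level k. The charge of step j, once averaged over segments,
has weight 2^(n(d+1)) 2^(j(r-1)) on pairs closer than 2^(-n) ρ, with n = k + j + 1. Summation over n
rebuilds the kernel of order d + r with the gain 2^(-k(r-1)). The bound Λ and the integral over the
set of jumps serve only to make the remainder vanish, and do not enter the constant. -/
lemma lintegral_segSum_jumpPart_le {p r : ℝ} (hp : 0 < p) (hr : 1 < r) :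
    ∃ (θ : ℝ) (C : ℝ≥0), ∀ {W : E → E → ℝ≥0∞}, IsMeasurablePseudoDist W → ∀ {Λ : ℝ≥0∞}, Λ ≠ ⊤ →
      (∀ x y, W x y ≤ Λ) → ∀ {Q : Set E}, MeasurableSet Q → Convex ℝ Q → ∀ {ρ : ℝ≥0∞}, ρ ≠ ⊤ →
      (∀ x ∈ Q, ∀ y ∈ Q, edist x y ≤ ρ) →
      ∫⁻ z, (if 1 / 4 ≤ W z.1 z.2 then (edist z.1 z.2 ^ (finrank ℝ E + 1 : ℝ))⁻¹ else 0)
        ∂((μ.restrict Q).prod (μ.restrict Q)) ≠ ⊤ → ∀ k : ℕ,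
      ∫⁻ z, segSum W (jumpPart θ 0) k z.1 z.2 ∂((μ.restrict Q).prod (μ.restrict Q)) ≤
        C * (2 ^ (-(k * (r - 1))) * (ρ ^ (finrank ℝ E + r) *
          ∫⁻ z, cutoff (W z.1 z.2) ^ p / edist z.1 z.2 ^ (finrank ℝ E + r)
            ∂((μ.restrict Q).prod (μ.restrict Q)))) := by
  set d : ℝ := (finrank ℝ E : ℝ)
  have hd : 0 ≤ d := by positivity
  -- Chosen so that θ^(-jp) = 2^(j(r-1)): the prices of successive bisections grow slowly enough for
  -- a kernel of order d + r to absorb them.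
  set θ : ℝ := 2 ^ (-((r - 1) / p))
  have hθ : 0 < θ := by positivity
  have hθ1 : θ < 1 := Real.rpow_lt_one_of_one_lt_of_neg one_lt_two
    (by have : 0 < (r - 1) / p := div_pos (by linarith) hp
        linarith)
  set H0 : ℝ := 2 * ((1 - θ) / 8) ^ (-p)
  have hH (j : ℕ) : ENNReal.ofReal (2 * ((1 - θ) * θ ^ j / 8) ^ (-p)) =
      ENNReal.ofReal H0 * 2 ^ (j * (r - 1)) := by
    have h1 : (θ ^ j) ^ (-p) = 2 ^ (j * (r - 1)) := by
      rw [← Real.rpow_natCast θ j, ← Real.rpow_mul two_pos.le, ← Real.rpow_mul two_pos.le]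
      congr 1
      field_simp
    have h2 : (1 - θ) * θ ^ j / 8 = (1 - θ) / 8 * θ ^ j := by ring
    rw [h2, Real.mul_rpow (by linarith) (by positivity), h1, ← mul_assoc,
      ENNReal.ofReal_mul (by have : 0 ≤ 1 - θ := by linarith
                             positivity), ← ENNReal.ofReal_rpow_of_pos two_pos,
      ENNReal.ofReal_ofNat]
  obtain ⟨C, hC⟩ := ENNReal.tsum_two_rpow_le_of_le (b := d + r) (by linarith)
  refine ⟨θ, (ENNReal.ofReal H0).toNNReal * C, fun {W} hW {Λ} hΛ hWΛ {Q} hQ hQc {ρ} hρ' hρ hX k ↦ ?_⟩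
  rw [ENNReal.coe_mul, ENNReal.coe_toNNReal ENNReal.ofReal_ne_top]
  set ν := (μ.restrict Q).prod (μ.restrict Q)
  have hWm : Measurable fun z : E × E ↦ W z.1 z.2 := hW.measurable
  have hem : Measurable fun z : E × E ↦ edist z.1 z.2 := by fun_prop
  have hle (n : ℕ) : MeasurableSet {z : E × E | 2 ^ (n : ℝ) * edist z.1 z.2 ≤ ρ} :=
    measurableSet_le (by fun_prop) measurable_const
  set Ψ := ∫⁻ z, cutoff (W z.1 z.2) ^ p / edist z.1 z.2 ^ (d + r) ∂ν
  have hdiv {z : E × E} (hz : z.1 ≠ z.2) {n : ℕ} (h : 2 ^ (n : ℝ) * edist z.1 z.2 ≤ ρ) :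
      (2 : ℝ≥0∞) ^ (n : ℝ) ≤ ρ / edist z.1 z.2 := by
    rwa [ENNReal.le_div_iff_mul_le (Or.inl (by simpa using hz)) (Or.inl (edist_ne_top _ _))]
  -- the refinement steps
  have hB (n : ℕ) : ∑ j ∈ Finset.range n, ∫⁻ z, segSum W
        (fun a ↦ ENNReal.ofReal (2 * ((1 - θ) * θ ^ j / 8) ^ (-p)) * cutoff a ^ p) (k + j + 1)
          z.1 z.2 ∂ν ≤
      ENNReal.ofReal H0 * C * (2 ^ (-(k * (r - 1))) * (ρ ^ (d + r) * Ψ)) := by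
    have hFm (j : ℕ) : Measurable fun a ↦
        ENNReal.ofReal (2 * ((1 - θ) * θ ^ j / 8) ^ (-p)) * cutoff a ^ p :=
      (measurable_cutoff.pow_const p).const_mul _
    calc _ ≤ ∑ j ∈ Finset.range n, (2 : ℝ≥0∞) ^ ((k + j + 1 : ℕ) * (d + 1)) *
          ∫⁻ z, (if 2 ^ ((k + j + 1 : ℕ) : ℝ) * edist z.1 z.2 ≤ ρ then
            ENNReal.ofReal (2 * ((1 - θ) * θ ^ j / 8) ^ (-p)) * cutoff (W z.1 z.2) ^ p else 0) ∂ν :=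
          Finset.sum_le_sum fun j _ ↦
            lintegral_prod_segSum_le μ hW.measurable (hFm j) hQ hQc hρ (k + j + 1)
      _ = ∫⁻ z, ∑ j ∈ Finset.range n, (2 : ℝ≥0∞) ^ ((k + j + 1 : ℕ) * (d + 1)) *
          (if 2 ^ ((k + j + 1 : ℕ) : ℝ) * edist z.1 z.2 ≤ ρ then
            ENNReal.ofReal (2 * ((1 - θ) * θ ^ j / 8) ^ (-p)) * cutoff (W z.1 z.2) ^ p else 0) ∂ν := by
          have (j : ℕ) : Measurable fun z : E × E ↦
            (if 2 ^ ((k + j + 1 : ℕ) : ℝ) * edist z.1 z.2 ≤ ρ then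
            ENNReal.ofReal (2 * ((1 - θ) * θ ^ j / 8) ^ (-p)) * cutoff (W z.1 z.2) ^ p else 0) :=
            Measurable.ite (hle _) ((hFm j).comp hWm) measurable_const
          rw [lintegral_finsetSum _ fun j _ ↦ (this j).const_mul _]
          exact Finset.sum_congr rfl fun j _ ↦ (lintegral_const_mul _ (this j)).symm
      _ ≤ ∫⁻ z, ENNReal.ofReal H0 * C * 2 ^ (-(k * (r - 1))) * ρ ^ (d + r) *
            (cutoff (W z.1 z.2) ^ p / edist z.1 z.2 ^ (d + r)) ∂ν := by
          refine lintegral_mono fun z ↦ ?_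
          by_cases hz : z.1 = z.2
          · simp [hz, hW.self, hp]
          set e := edist z.1 z.2
          set c := cutoff (W z.1 z.2) ^ p
          calc _ ≤ ∑ j ∈ Finset.range n, ENNReal.ofReal H0 * 2 ^ (-(k * (r - 1))) * c *
                (if (2 : ℝ≥0∞) ^ ((k + j + 1 : ℕ) : ℝ) ≤ ρ / e
                  then (2 : ℝ≥0∞) ^ ((k + j + 1 : ℕ) * (d + r)) else 0) := by
                refine Finset.sum_le_sum fun j _ ↦ ?_
                split_ifs with h1 h2
                · rw [hH j]
                  calc _ = ENNReal.ofReal H0 *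
                        (2 ^ ((k + j + 1 : ℕ) * (d + 1)) * 2 ^ (j * (r - 1))) * c := by ring
                    _ ≤ ENNReal.ofReal H0 * (2 ^ (-(k * (r - 1))) *
                        2 ^ ((k + j + 1 : ℕ) * (d + r))) * c := by
                      -- With n = k + j + 1, the exponent n(d + 1) + j(r - 1) equals n(d + r) - k(r
                      -- - 1) - (r - 1).
                      rw [ENNReal.two_rpow_mul_two_rpow, ENNReal.two_rpow_mul_two_rpow]
                      refine mul_le_mul' (mul_le_mul_right (ENNReal.two_rpow_le_two_rpow ?_) _)
                        le_rfl
                      push_cast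
                      nlinarith
                    _ = _ := by ring
                · exact absurd (hdiv hz h1) h2
                · simp
                · simp
            _ = ENNReal.ofReal H0 * 2 ^ (-(k * (r - 1))) * c * ∑ j ∈ Finset.range n,
                (if (2 : ℝ≥0∞) ^ ((k + j + 1 : ℕ) : ℝ) ≤ ρ / e
                  then (2 : ℝ≥0∞) ^ ((k + j + 1 : ℕ) * (d + r)) else 0) := by
                rw [Finset.mul_sum]
            _ ≤ ENNReal.ofReal H0 * 2 ^ (-(k * (r - 1))) * c * (C * (ρ / e) ^ (d + r)) := by
                gcongr
                refine le_trans ?_ (hC (ρ / e))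
                refine (ENNReal.sum_le_tsum _).trans ?_
                have hinj : Function.Injective fun j : ℕ ↦ k + j + 1 := fun a b h ↦ by
                  simpa using h
                exact ENNReal.tsum_comp_le_tsum_of_injective hinj
                  (fun l : ℕ ↦ (if (2 : ℝ≥0∞) ^ (l : ℝ) ≤ ρ / e then
                    (2 : ℝ≥0∞) ^ (l * (d + r)) else 0))
            _ = _ := by
                rw [ENNReal.div_rpow_of_nonneg _ _ (by linarith), div_eq_mul_inv, div_eq_mul_inv]
                ring
      _ = _ := by
          rw [lintegral_const_mul]
          · ring
          · exact ((measurable_cutoff.comp hWm).pow_const p).div (hem.pow_const _)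
  -- the remainder tends to zero
  set X : E × E → ℝ≥0∞ := fun z ↦
    if 1 / 4 ≤ W z.1 z.2 then (edist z.1 z.2 ^ (d + 1))⁻¹ else 0
  have hXm : Measurable X :=
    Measurable.ite (measurableSet_le measurable_const hWm) (hem.pow_const _).inv measurable_const
  have hA (n : ℕ) : ∫⁻ z, segSum W (jumpPart θ n) (k + n) z.1 z.2 ∂ν ≤
      2 * Λ * ρ ^ (d + 1) * ∫⁻ z, {z : E × E | 2 ^ ((k + n : ℕ) : ℝ) * edist z.1 z.2 ≤ ρ}.indicator X z ∂ν := by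
    refine (lintegral_prod_segSum_le μ hW.measurable (measurable_jumpPart θ n) hQ hQc hρ _).trans ?_
    rw [← lintegral_const_mul' _ _ (ENNReal.two_rpow_ne_top _),
      ← lintegral_const_mul _ (hXm.indicator (hle _))]
    refine lintegral_mono fun z ↦ ?_
    by_cases hz : z.1 = z.2
    · simp [hz, hW.self]
    by_cases h1 : 2 ^ ((k + n : ℕ) : ℝ) * edist z.1 z.2 ≤ ρ
    · rw [if_pos h1, indicator_of_mem (s := {z : E × E | 2 ^ ((k + n : ℕ) : ℝ) * edist z.1 z.2 ≤ ρ}) h1]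
      have h2 : (2 : ℝ≥0∞) ^ ((k + n : ℕ) * (d + 1)) ≤ ρ ^ (d + 1) * (edist z.1 z.2 ^ (d + 1))⁻¹ := by
        rw [← div_eq_mul_inv, ← ENNReal.div_rpow_of_nonneg _ _ (by linarith), ENNReal.rpow_mul]
        exact ENNReal.rpow_le_rpow (hdiv hz h1) (by linarith)
      calc _ ≤ (ρ ^ (d + 1) * (edist z.1 z.2 ^ (d + 1))⁻¹) *
            (if 1 / 4 ≤ W z.1 z.2 then 2 * Λ else 0) := by
            gcongr
            exact jumpPart_le hθ n (hWΛ _ _)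
        _ = _ := by
            simp only [X]
            split_ifs
            · ring
            · simp
    · rw [if_neg h1, mul_zero]
      exact zero_le
  have hlim : Filter.Tendsto (fun n : ℕ ↦ 2 * Λ * ρ ^ (d + 1) * ∫⁻ z,
      {z : E × E | 2 ^ ((k + n : ℕ) : ℝ) * edist z.1 z.2 ≤ ρ}.indicator X z ∂ν)
      Filter.atTop (𝓝 0) := by
    have h0 : Filter.Tendsto (fun n : ℕ ↦ ∫⁻ z,
      {z : E × E | 2 ^ ((k + n : ℕ) : ℝ) * edist z.1 z.2 ≤ ρ}.indicator X z ∂ν)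
      Filter.atTop (𝓝 (∫⁻ _, 0 ∂ν)) := by
      -- The integrable jumps dominate. Off the diagonal a fixed pair is eventually farther apart
      -- than 2^(-(k+n)) ρ, so the indicator vanishes; on the diagonal W = 0.
      refine tendsto_lintegral_of_dominated_convergence X (fun n ↦ hXm.indicator (hle _))
        (fun n ↦ Filter.Eventually.of_forall fun z ↦ indicator_le_self _ _ _) hX
        (Filter.Eventually.of_forall fun z ↦ ?_)
      by_cases hz : z.1 = z.2
      · simp only [indicator, X, hz, hW.self]
        simp
      · have he : edist z.1 z.2 ≠ 0 := by simpa using hz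
        obtain ⟨N, hN⟩ := ENNReal.exists_nat_mul_gt he hρ'
        refine tendsto_const_nhds.congr' ?_
        filter_upwards [Filter.eventually_ge_atTop N] with n hn
        rw [indicator_of_notMem]
        rw [mem_ofPred_eq, not_le]
        refine hN.trans_le ?_
        gcongr
        rw [ENNReal.rpow_natCast]
        exact_mod_cast (hn.trans ((Nat.le_add_left n k).trans Nat.lt_two_pow_self.le))
    have h1 := ENNReal.Tendsto.const_mul (a := 2 * Λ * ρ ^ (d + 1)) h0
      (Or.inr (ENNReal.mul_ne_top (ENNReal.mul_ne_top (by simp) hΛ)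
        (ENNReal.rpow_ne_top_of_nonneg (by linarith) hρ')))
    simpa using h1
  have hlim' := hlim.add_const
    (ENNReal.ofReal H0 * C * (2 ^ (-(k * (r - 1))) * (ρ ^ (d + r) * Ψ)))
  rw [zero_add] at hlim'
  refine ge_of_tendsto' hlim' fun n ↦ ?_
  have hm (F : ℝ≥0∞ → ℝ≥0∞) (hF : Measurable F) (n : ℕ) :
      Measurable fun z : E × E ↦ segSum W F n z.1 z.2 := measurable_segSum hW.measurable hF n
  calc _ ≤ ∫⁻ z, (segSum W (jumpPart θ n) (k + n) z.1 z.2 + ∑ j ∈ Finset.range n, segSum W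
        (fun a ↦ ENNReal.ofReal (2 * ((1 - θ) * θ ^ j / 8) ^ (-p)) * cutoff a ^ p) (k + j + 1)
          z.1 z.2) ∂ν :=
        lintegral_mono fun z ↦ segSum_jumpPart_le hW.triangle hθ hθ1 hp k n z.1 z.2
    _ = _ := by
        rw [lintegral_add_left (hm _ (measurable_jumpPart θ n) _), lintegral_finsetSum]
        exact fun j _ ↦ hm _ ((measurable_cutoff.pow_const p).const_mul _) _
    _ ≤ _ := add_le_add (hA n) (hB n)

/-- The Poincaré inequality for the large values of a pseudo-distance. -/
lemma lintegral_large_le {p r : ℝ} (hp : 0 < p) (hr : 1 < r) :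
    ∃ C : ℝ≥0, ∀ {W : E → E → ℝ≥0∞}, IsMeasurablePseudoDist W → ∀ {Λ : ℝ≥0∞}, Λ ≠ ⊤ →
      (∀ x y, W x y ≤ Λ) → ∀ {Q : Set E}, MeasurableSet Q → Convex ℝ Q → ∀ {ρ : ℝ≥0∞}, ρ ≠ 0 →
      ρ ≠ ⊤ → (∀ x ∈ Q, ∀ y ∈ Q, edist x y ≤ ρ) →
      ∫⁻ z, (if 1 / 4 ≤ W z.1 z.2 then (edist z.1 z.2 ^ (finrank ℝ E + 1 : ℝ))⁻¹ else 0)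
        ∂((μ.restrict Q).prod (μ.restrict Q)) ≠ ⊤ →
      ∫⁻ z, (if 1 ≤ W z.1 z.2 then W z.1 z.2 else 0) ∂((μ.restrict Q).prod (μ.restrict Q)) ≤
        C * (ρ ^ (2 * finrank ℝ E : ℝ) * (ρ ^ (r - finrank ℝ E) *
          ∫⁻ z, cutoff (W z.1 z.2) ^ p / edist z.1 z.2 ^ (finrank ℝ E + r)
            ∂((μ.restrict Q).prod (μ.restrict Q))) ^ (1 / r)) := by
  set d : ℝ := (finrank ℝ E : ℝ)
  have hd : 0 ≤ d := by positivity
  obtain ⟨θ, C, hC⟩ := lintegral_segSum_jumpPart_le μ hp hr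
  set V := μ (Metric.closedBall (0 : E) 1)
  have hVt : V ≠ ⊤ := measure_closedBall_lt_top.ne
  have hr0 : 0 < r := by linarith
  refine ⟨2 * (V * V).toNNReal + C + 1, fun {W} hW {Λ} hΛ hWΛ {Q} hQ hQc {ρ} hρ0 hρ' hρ hX ↦ ?_⟩
  have hVV : ((V * V).toNNReal : ℝ≥0∞) = V * V := ENNReal.coe_toNNReal (ENNReal.mul_ne_top hVt hVt)
  set ν := (μ.restrict Q).prod (μ.restrict Q)
  set Ψ := ∫⁻ z, cutoff (W z.1 z.2) ^ p / edist z.1 z.2 ^ (d + r) ∂ν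
  -- The dimensionless form of the singular integral; the factor ρ^(2d) split off is the order of
  -- the measure of Q × Q.
  set Y := ρ ^ (r - d) * Ψ
  have hY : ρ ^ (d + r) * Ψ = ρ ^ (2 * d) * Y := by
    rw [← mul_assoc, ← ENNReal.rpow_add _ _ hρ0 hρ']
    congr 2; ring
  have key := hC hW hΛ hWΛ hQ hQc hρ' hρ hX
  simp_rw [show ((finrank ℝ E : ℝ) + r) = d + r from rfl] at key
  change ∀ k : ℕ, _ ≤ C * (2 ^ (-(k * (r - 1))) * (ρ ^ (d + r) * Ψ)) at key
  rw [hY] at key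
  -- When Y ≤ 1 no initial subdivision is needed: values at least 1 lie above the first threshold
  -- 1/2, and Y ≤ Y^(1/r).
  rcases le_or_gt Y 1 with hY1 | hY1
  · calc _ ≤ ∫⁻ z, segSum W (jumpPart θ 0) 0 z.1 z.2 ∂ν := by
          refine lintegral_mono fun z ↦ ?_
          rw [segSum_zero]
          split_ifs with h
          · exact self_le_jumpPart_zero θ h
          · exact zero_le
      _ ≤ _ := key 0
      _ = C * (ρ ^ (2 * d) * Y) := by simp
      _ ≤ _ := by
          gcongr
          · rw [add_right_comm]
            exact le_add_self
          · conv_lhs => rw [← ENNReal.rpow_one Y]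
            exact ENNReal.rpow_le_rpow_of_exponent_ge hY1 (by rw [div_le_one hr0]; linarith)
  rcases eq_or_ne Y ⊤ with hYt | hYt
  · rw [hYt, ENNReal.top_rpow_of_pos (by positivity), ENNReal.mul_top, ENNReal.mul_top]
    · exact le_top
    · simp [ENNReal.rpow_eq_zero_iff, hρ0, hρ']
    · simp [hρ0, hρ']
  have hY0 : Y ≠ 0 := (zero_lt_one.trans hY1).ne'
  -- The initial level balances two terms: the 2^k pieces contribute at most 1 each below the
  -- threshold, and the jumps on them cost 2^(-k(r-1)) Y. Both have order Y^(1/r) when 2^k is about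
  -- Y^(1/r).
  obtain ⟨k, hk1, hk2⟩ : ∃ k : ℕ, (2 : ℝ≥0∞) ^ (k : ℝ) ≤ 2 * Y ^ (1 / r) ∧ Y ^ (1 / r) ≤ 2 ^ (k : ℝ) :=
    ENNReal.exists_two_rpow_near (ENNReal.one_lt_rpow hY1 (by positivity))
      (ENNReal.rpow_ne_top_of_nonneg (by positivity) hYt)
  have hQV : ν univ ≤ ρ ^ (2 * d) * (V * V) := by
    have hQ1 : μ Q ≤ ρ ^ d * V := by
      rcases Q.eq_empty_or_nonempty with rfl | ⟨x, hx⟩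
      · simp
      · exact (measure_mono (hρ x hx)).trans ((measure_edist_le_le μ x ρ).resolve_right hρ')
    calc ν univ = μ Q * μ Q := by
          rw [← univ_prod_univ, Measure.prod_prod, Measure.restrict_apply_univ]
      _ ≤ (ρ ^ d * V) * (ρ ^ d * V) := by gcongr
      _ = _ := by
        rw [two_mul, ENNReal.rpow_add _ _ hρ0 hρ']
        ring
  calc _ ≤ ∫⁻ z, (2 ^ (k : ℝ) + segSum W (jumpPart θ 0) k z.1 z.2) ∂ν := by
        refine lintegral_mono fun z ↦ ?_
        refine le_trans (b := W z.1 z.2) (by split_ifs <;> simp) ?_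
        refine (le_segSum hW.triangle k z.1 z.2).trans ?_
        refine (segSum_mono W (le_half_add_jumpPart_zero θ) k z.1 z.2).trans ?_
        rw [segSum_add]
        gcongr
        simp [segSum]
    _ = 2 ^ (k : ℝ) * ν univ + ∫⁻ z, segSum W (jumpPart θ 0) k z.1 z.2 ∂ν := by
        rw [lintegral_add_left measurable_const, lintegral_const]
    _ ≤ 2 * Y ^ (1 / r) * (ρ ^ (2 * d) * (V * V)) + C * (2 ^ (-(k * (r - 1))) * (ρ ^ (2 * d) * Y)) := by
        gcongr
        exact key k
    _ ≤ 2 * Y ^ (1 / r) * (ρ ^ (2 * d) * (V * V)) + C * (ρ ^ (2 * d) * Y ^ (1 / r)) := by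
        gcongr _ + _ * ?_
        rw [mul_left_comm]
        gcongr
        have : (2 : ℝ≥0∞) ^ (-(k * (r - 1))) ≤ Y ^ (-((r - 1) / r)) := by
          rw [← ENNReal.inv_two_rpow, ENNReal.rpow_neg]
          gcongr
          rw [ENNReal.rpow_mul]
          refine le_trans (le_of_eq ?_) (ENNReal.rpow_le_rpow hk2 (by linarith))
          rw [← ENNReal.rpow_mul]
          congr 1
          ring
        calc _ ≤ Y ^ (-((r - 1) / r)) * Y ^ (1 : ℝ) := by rw [ENNReal.rpow_one]; gcongr
          _ = _ := by
            rw [← ENNReal.rpow_add _ _ hY0 hYt]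
            congr 1
            field_simp
            ring
    _ = (2 * (V * V) + C) * (ρ ^ (2 * d) * Y ^ (1 / r)) := by ring
    _ ≤ _ := by
        rw [ENNReal.coe_add, ENNReal.coe_add, ENNReal.coe_mul, hVV]
        exact mul_le_mul' le_self_add le_rfl

end Poincare

/-! ### Small and large parts at the scale 2^(-k) -/

section LocalEstimate

variable {E : Type*} [NormedAddCommGroup E] [NormedSpace ℝ E]

/-- The part of `K` at distance at most `2 ^ (-k)` of `x`. -/
def nearSet (K : Set E) (k : ℕ) (x : E) : Set E := K ∩ {y | edist x y ≤ 2 ^ (-(k : ℝ))}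

lemma nearSet_eq (K : Set E) (k : ℕ) (x : E) :
    nearSet K k x = K ∩ Metric.closedBall x ((2 : ℝ)⁻¹ ^ k) := by
  have : (2 : ℝ≥0∞) ^ (-(k : ℝ)) = ENNReal.ofReal ((2 : ℝ)⁻¹ ^ k) := by
    rw [ENNReal.ofReal_pow (by norm_num), ENNReal.ofReal_inv_of_pos two_pos, ENNReal.rpow_neg,
      ENNReal.rpow_natCast, ENNReal.inv_pow]
    simp
  ext y
  simp only [nearSet, this, mem_inter_iff, mem_ofPred_eq, Metric.mem_closedBall',
    edist_le_ofReal (show (0 : ℝ) ≤ 2⁻¹ ^ k by positivity)]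

lemma nearSet_subset (K : Set E) (k : ℕ) (x : E) : nearSet K k x ⊆ K := inter_subset_left

lemma Convex.nearSet {K : Set E} (hK : Convex ℝ K) (k : ℕ) (x : E) : Convex ℝ (nearSet K k x) := by
  rw [nearSet_eq]; exact hK.inter (convex_closedBall _ _)

lemma edist_le_of_mem_nearSet {K : Set E} {k : ℕ} {x y z : E} (hy : y ∈ nearSet K k x)
    (hz : z ∈ nearSet K k x) : edist y z ≤ 2 * 2 ^ (-(k : ℝ)) :=
  (edist_triangle_left y z x).trans ((add_le_add hy.2 hz.2).trans_eq (two_mul _).symm)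

lemma nearSet_succ_subset (K : Set E) (k : ℕ) (x : E) : nearSet K (k + 1) x ⊆ nearSet K k x :=
  inter_subset_inter_right _ fun _ hy ↦ le_trans hy (ENNReal.two_rpow_le_two_rpow (by simp))

variable [MeasurableSpace E] [BorelSpace E]

lemma MeasurableSet.nearSet {K : Set E} (hK : MeasurableSet K) (k : ℕ) (x : E) :
    MeasurableSet (nearSet K k x) := by
  rw [nearSet_eq]; exact hK.inter Metric.isClosed_closedBall.measurableSet

variable [FiniteDimensional ℝ E] (μ : Measure E) [μ.IsAddHaarMeasure]

open Module

lemma measure_nearSet_le (K : Set E) (k : ℕ) (x : E) :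
    μ (nearSet K k x) ≤ 2 ^ (-(k * finrank ℝ E : ℝ)) * μ (Metric.closedBall 0 1) := by
  refine (measure_mono inter_subset_right).trans
    (((measure_edist_le_le μ x _).resolve_right (ENNReal.two_rpow_ne_top _)).trans_eq ?_)
  rw [← ENNReal.rpow_mul]
  congr 2
  ring

/-- The homothety of centre x and ratio 2^(-k) maps K into itself by convexity, and into the ball
because K has diameter at most 1. No regularity of the boundary of K is involved. -/
lemma le_measure_nearSet {K : Set E} (hK : Convex ℝ K) (hK1 : ∀ x ∈ K, ∀ y ∈ K, edist x y ≤ 1)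
    (k : ℕ) {x : E} (hx : x ∈ K) :
    2 ^ (-(k * finrank ℝ E : ℝ)) * μ K ≤ μ (nearSet K k x) := by
  have h := Measure.addHaar_image_homothety μ x ((2 : ℝ)⁻¹ ^ k) K
  have hc : ENNReal.ofReal |((2 : ℝ)⁻¹ ^ k) ^ finrank ℝ E| = 2 ^ (-(k * finrank ℝ E : ℝ)) := by
    rw [abs_of_pos (by positivity), ← pow_mul, ENNReal.ofReal_pow (by norm_num),
      ENNReal.ofReal_inv_of_pos two_pos, ENNReal.rpow_neg, ← Nat.cast_mul, ENNReal.rpow_natCast,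
      ENNReal.inv_pow]
    simp
  rw [← hc, ← h]
  refine measure_mono ?_
  rintro _ ⟨y, hy, rfl⟩
  have h1 : (2 : ℝ)⁻¹ ^ k ≤ 1 := pow_le_one₀ (by norm_num) (by norm_num)
  rw [nearSet_eq]
  constructor
  · rw [AffineMap.homothety_eq_lineMap, AffineMap.lineMap_apply, vadd_eq_add, vsub_eq_sub, add_comm]
    exact hK.add_smul_sub_mem hx hy ⟨by positivity, h1⟩
  · rw [Metric.mem_closedBall, dist_homothety_center]
    have : dist x y ≤ 1 := by
      have := hK1 x hx y hy
      rw [edist_dist, ← ENNReal.ofReal_one] at this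
      exact (ENNReal.ofReal_le_ofReal_iff zero_le_one).1 this
    rw [Real.norm_of_nonneg (by positivity)]
    exact mul_le_of_le_one_right (by positivity) this

lemma setLIntegral_nearSet_le {K : Set E} (hK : MeasurableSet K) (f : E → ℝ≥0∞) (k : ℕ) (x : E) :
    ∫⁻ y in nearSet K k x, f y ∂μ ≤
      2 ^ (-(k * finrank ℝ E : ℝ)) * dyadicMaximal μ (K.indicator f) x := by
  have h : (2 : ℝ≥0∞) ^ (k * finrank ℝ E) * ∫⁻ y in Metric.closedBall x ((2 : ℝ)⁻¹ ^ k),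
      K.indicator f y ∂μ ≤ dyadicMaximal μ (K.indicator f) x :=
    le_iSup (fun k : ℕ ↦ (2 : ℝ≥0∞) ^ (k * finrank ℝ E) * ∫⁻ y in Metric.closedBall x
      ((2 : ℝ)⁻¹ ^ k), K.indicator f y ∂μ) k
  rw [setLIntegral_indicator hK, ← nearSet_eq] at h
  calc _ = 2 ^ (-(k * finrank ℝ E : ℝ)) * (2 ^ (k * finrank ℝ E) *
        ∫⁻ y in nearSet K k x, f y ∂μ) := by
        rw [← mul_assoc, ← ENNReal.rpow_natCast, ENNReal.two_rpow_mul_two_rpow]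
        push_cast
        simp
    _ ≤ _ := by gcongr

/-- The singular integral of the part of `W` below the threshold. -/
def smallKernel (K : Set E) (W : E → E → ℝ≥0∞) (p a : ℝ) (x : E) : ℝ≥0∞ :=
  ∫⁻ y in K, cutoff (W x y) ^ p / edist x y ^ a ∂μ

variable {W : E → E → ℝ≥0∞}

lemma measurable_cutoff_div (hW : IsMeasurablePseudoDist W) (p a : ℝ) :
    Measurable fun z : E × E ↦ cutoff (W z.1 z.2) ^ p / edist z.1 z.2 ^ a :=
  ((measurable_cutoff.comp hW.measurable).pow_const p).div (by fun_prop)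

lemma measurable_smallKernel (K : Set E) (hW : IsMeasurablePseudoDist W) (p a : ℝ) :
    Measurable (smallKernel μ K W p a) :=
  (measurable_cutoff_div hW p a).lintegral_prod_right'

lemma setLIntegral_cutoff_le {p q : ℝ} (hp : 1 < p) (hq : 0 < q) :
    ∃ C : ℝ≥0, ∀ {W : E → E → ℝ≥0∞}, IsMeasurablePseudoDist W → ∀ {K : Set E} (k : ℕ) (x z : E),
      z ∈ nearSet K k x →
      ∫⁻ y in nearSet K k x, cutoff (W z y) ∂μ ≤
        C * (2 ^ (-(k * (finrank ℝ E + q / p))) *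
          smallKernel μ K W p (finrank ℝ E + q) z ^ (1 / p)) := by
  obtain ⟨C, hC⟩ := setLIntegral_le_kernel μ hp hq
  refine ⟨C * ((2 : ℝ≥0∞) ^ (finrank ℝ E + q / p)).toNNReal, fun {W} hW {K} k x z hz ↦ ?_⟩
  rw [ENNReal.coe_mul, ENNReal.coe_toNNReal (ENNReal.two_rpow_ne_top _)]
  refine (hC z (fun y ↦ cutoff (W z y)) (2 * 2 ^ (-(k : ℝ))) (nearSet K k x)
    (ENNReal.mul_ne_top (by simp) (ENNReal.two_rpow_ne_top _))
    (measurable_cutoff.comp (hW.measurable.of_uncurry_left)) (by simp [hW.self])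
    (fun y hy ↦ edist_le_of_mem_nearSet hz hy)).trans ?_
  have h0 : (0 : ℝ) ≤ finrank ℝ E + q / p := by positivity
  rw [ENNReal.mul_rpow_of_nonneg _ _ h0, ← ENNReal.rpow_mul, mul_assoc, mul_assoc, neg_mul]
  gcongr
  exact lintegral_mono_set (nearSet_subset _ _ _)

/-- Hölder's inequality bounds the mean of the small part around each z by 2^(-kq/p) Φ(z)^(1/p);
averaging over z produces the maximal function. -/
lemma lintegral_nearSet_cutoff_le {p q : ℝ} (hp : 1 < p) (hq : 0 < q) :
    ∃ C : ℝ≥0, ∀ {W : E → E → ℝ≥0∞}, IsMeasurablePseudoDist W → ∀ {K : Set E}, MeasurableSet K →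
      ∀ (k : ℕ) (x : E),
      ∫⁻ z in nearSet K k x, ∫⁻ y in nearSet K k x, cutoff (W z y) ∂μ ∂μ ≤
        C * (2 ^ (-(k * (2 * finrank ℝ E) : ℝ)) * (2 ^ (-(k * (q / p))) *
          dyadicMaximal μ (K.indicator fun z ↦
            smallKernel μ K W p (finrank ℝ E + q) z ^ (1 / p)) x)) := by
  obtain ⟨C, hC⟩ := setLIntegral_cutoff_le μ hp hq
  refine ⟨C, fun {W} hW {K} hK k x ↦ ?_⟩
  calc _ ≤ ∫⁻ z in nearSet K k x, C * (2 ^ (-(k * (finrank ℝ E + q / p))) *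
          smallKernel μ K W p (finrank ℝ E + q) z ^ (1 / p)) ∂μ :=
        setLIntegral_mono' (hK.nearSet k x) fun z hz ↦ hC hW k x z hz
    _ = C * (2 ^ (-(k * (finrank ℝ E + q / p))) * ∫⁻ z in nearSet K k x,
          smallKernel μ K W p (finrank ℝ E + q) z ^ (1 / p) ∂μ) := by
        rw [lintegral_const_mul' _ _ ENNReal.coe_ne_top,
          lintegral_const_mul' _ _ (ENNReal.two_rpow_ne_top _)]
    _ ≤ C * (2 ^ (-(k * (finrank ℝ E + q / p))) * (2 ^ (-(k * finrank ℝ E : ℝ)) *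
        dyadicMaximal μ (K.indicator fun z ↦
            smallKernel μ K W p (finrank ℝ E + q) z ^ (1 / p)) x)) := by
        gcongr
        exact setLIntegral_nearSet_le μ hK _ k x
    _ = _ := by
        rw [← mul_assoc (2 ^ _), ← mul_assoc (2 ^ _), ENNReal.two_rpow_mul_two_rpow,
          ENNReal.two_rpow_mul_two_rpow]
        congr 3
        ring_nf

/-- The Poincaré inequality of order r is followed by interpolation of kernels, which replaces the
inner integral of order d + r by Φ^(r/q). The integral of Φ^(r/q) over the piece is then estimated
by the maximal function, which is good at small scales, and by Hölder's inequality with the total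
energy, which is good at large scales. Keeping the better of the two for each k is what allows the
sum over scales to converge. -/
lemma lintegral_nearSet_large_le {p q r : ℝ} (hp : 1 < p) (hr : 1 < r) (hrq : r < q) :
    ∃ C : ℝ≥0, ∀ {W : E → E → ℝ≥0∞}, IsMeasurablePseudoDist W → ∀ {Λ : ℝ≥0∞}, Λ ≠ ⊤ →
      (∀ x y, W x y ≤ Λ) → ∀ {K : Set E}, MeasurableSet K → Convex ℝ K →
      ∫⁻ x in K, ∫⁻ y in K, (if 1 / 4 ≤ W x y then (edist x y ^ (finrank ℝ E + 1 : ℝ))⁻¹ else 0)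
        ∂μ ∂μ ≠ ⊤ →
      ∀ (k : ℕ) (x : E),
      ∫⁻ z in nearSet K k x, ∫⁻ y in nearSet K k x, (if 1 ≤ W z y then W z y else 0) ∂μ ∂μ ≤
        C * (2 ^ (-(k * (2 * finrank ℝ E) : ℝ)) *
          min (2 ^ (-(k : ℝ)) * dyadicMaximal μ (K.indicator fun z ↦
            smallKernel μ K W p (finrank ℝ E + q) z ^ (r / q)) x ^ (1 / r))
            (2 ^ (k * (finrank ℝ E / q - 1)) *
              (∫⁻ z in K, smallKernel μ K W p (finrank ℝ E + q) z ∂μ) ^ (1 / q))) := by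
  obtain ⟨C, hC⟩ := lintegral_large_le μ (zero_lt_one.trans hp) hr
  obtain ⟨C', hC'⟩ := lintegral_kernel_interpolate μ (zero_lt_one.trans hr) hrq
  set d : ℝ := (finrank ℝ E : ℝ)
  have hd : 0 ≤ d := by positivity
  have hr0 : 0 < r := by linarith
  have hq0 : 0 < q := by linarith
  have hr1 : 0 ≤ 1 / r := by positivity
  set V := μ (Metric.closedBall (0 : E) 1)
  have hVt : V ≠ ⊤ := measure_closedBall_lt_top.ne
  have hrq1 : 0 ≤ 1 - r / q := by
    rw [sub_nonneg, div_le_one hq0]; exact hrq.le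
  set D : ℝ≥0∞ := C * (2 ^ (2 * d) * ((2 ^ (r - d) * C') ^ (1 / r) * (1 + (V ^ (1 - r / q)) ^ (1 / r))))
  have hD : D ≠ ⊤ := by
    refine ENNReal.mul_ne_top ENNReal.coe_ne_top (ENNReal.mul_ne_top (ENNReal.two_rpow_ne_top _)
      (ENNReal.mul_ne_top (ENNReal.rpow_ne_top_of_nonneg hr1 (ENNReal.mul_ne_top
        (ENNReal.two_rpow_ne_top _) ENNReal.coe_ne_top)) (ENNReal.add_ne_top.2 ⟨by simp, ?_⟩)))
    exact ENNReal.rpow_ne_top_of_nonneg hr1 (ENNReal.rpow_ne_top_of_nonneg hrq1 hVt)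
  refine ⟨D.toNNReal, fun {W} hW {Λ} hΛ hWΛ {K} hK hKc hX k x ↦ ?_⟩
  rw [ENNReal.coe_toNNReal hD]
  set Q := nearSet K k x
  have hQ : MeasurableSet Q := hK.nearSet k x
  have hWm : Measurable fun z : E × E ↦ W z.1 z.2 := hW.measurable
  set Φ := smallKernel μ K W p (d + q)
  have hΦ : Measurable Φ := measurable_smallKernel μ K hW p (d + q)
  set ρ : ℝ≥0∞ := 2 * 2 ^ (-(k : ℝ))
  have hXm : Measurable fun z : E × E ↦
      (if 1 / 4 ≤ W z.1 z.2 then (edist z.1 z.2 ^ (d + 1))⁻¹ else 0) :=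
    Measurable.ite (measurableSet_le measurable_const hWm) (by fun_prop) measurable_const
  have h1 := hC hW hΛ hWΛ hQ (hKc.nearSet k x) (ρ := ρ)
    (mul_ne_zero (by simp) (ENNReal.two_rpow_ne_zero _))
    (ENNReal.mul_ne_top (by simp) (ENNReal.two_rpow_ne_top _))
    (fun y hy z hz ↦ edist_le_of_mem_nearSet hy hz) (by
      refine ne_top_of_le_ne_top hX ?_
      rw [lintegral_prod _ hXm.aemeasurable]
      exact (lintegral_mono_set (nearSet_subset _ _ _)).trans
        (lintegral_mono fun z ↦ lintegral_mono_set (nearSet_subset _ _ _)))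
  have hLm : Measurable fun z : E × E ↦ (if 1 ≤ W z.1 z.2 then W z.1 z.2 else 0) :=
    Measurable.ite (measurableSet_le measurable_const hWm) hWm measurable_const
  rw [lintegral_prod _ hLm.aemeasurable,
    lintegral_prod _ (measurable_cutoff_div hW p _).aemeasurable] at h1
  have hp0 : 0 ≤ p := by linarith
  -- interpolation
  have h2 : ∫⁻ z in Q, ∫⁻ y in Q, cutoff (W z y) ^ p / edist z y ^ (d + r) ∂μ ∂μ ≤
      C' * ∫⁻ z in Q, Φ z ^ (r / q) ∂μ := by
    rw [← lintegral_const_mul' _ _ ENNReal.coe_ne_top]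
    refine lintegral_mono fun z ↦ (lintegral_mono_set (nearSet_subset K k x)).trans ?_
    have hm : Measurable fun y ↦ cutoff (W z y) :=
      measurable_cutoff.comp hW.measurable.of_uncurry_left
    have h3 := hC' z (K.indicator fun y ↦ cutoff (W z y) ^ p) ((hm.pow_const p).indicator hK)
      (fun y ↦ (indicator_le_self _ _ _).trans (ENNReal.rpow_le_one (cutoff_le_one _) hp0))
    have h4 (a : ℝ) : ∫⁻ y, K.indicator (fun y ↦ cutoff (W z y) ^ p) y / edist z y ^ a ∂μ =
        ∫⁻ y in K, cutoff (W z y) ^ p / edist z y ^ a ∂μ := by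
      rw [← lintegral_indicator hK]
      refine lintegral_congr fun y ↦ ?_
      by_cases hy : y ∈ K <;> simp [hy]
    rw [h4, h4] at h3
    exact h3
  have hmax : ∫⁻ z in Q, Φ z ^ (r / q) ∂μ ≤ 2 ^ (-(k * d)) *
      dyadicMaximal μ (K.indicator fun z ↦ Φ z ^ (r / q)) x := setLIntegral_nearSet_le μ hK _ k x
  have hhol : ∫⁻ z in Q, Φ z ^ (r / q) ∂μ ≤ (∫⁻ z in K, Φ z ∂μ) ^ (r / q) *
      (2 ^ (-(k * d)) * V) ^ (1 - r / q) := by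
    have hpq : (q / r).HolderConjugate (q / (q - r)) := by
      rw [Real.holderConjugate_iff]
      constructor
      · rwa [lt_div_iff₀ hr0, one_mul]
      · have : q - r ≠ 0 := by linarith
        field_simp
        ring
    have h := ENNReal.lintegral_mul_le_Lp_mul_Lq (μ.restrict Q) hpq (f := fun z ↦ Φ z ^ (r / q))
      (g := fun _ ↦ 1) (hΦ.pow_const _).aemeasurable aemeasurable_const
    simp only [Pi.mul_apply, mul_one, ENNReal.one_rpow, lintegral_const, one_mul,
      Measure.restrict_apply_univ, ← ENNReal.rpow_mul] at h
    have e1 : r / q * (q / r) = 1 := by field_simp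
    have e2 : 1 / (q / r) = r / q := by rw [one_div_div]
    have e3 : 1 / (q / (q - r)) = 1 - r / q := by rw [one_div_div]; field_simp
    simp only [e1, ENNReal.rpow_one, e2, e3] at h
    refine h.trans ?_
    refine mul_le_mul' (ENNReal.rpow_le_rpow (lintegral_mono_set (nearSet_subset K k x))
      (by positivity)) (ENNReal.rpow_le_rpow (measure_nearSet_le μ K k x) hrq1)
  have hρ2 : ρ ^ (2 * d) = 2 ^ (2 * d) * 2 ^ (-(k * (2 * d))) := by
    rw [ENNReal.mul_rpow_of_nonneg _ _ (by positivity), ← ENNReal.rpow_mul, neg_mul]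
  have hρr : ρ ^ (r - d) = 2 ^ (r - d) * 2 ^ (-(k * (r - d))) := by
    rw [ENNReal.mul_rpow_of_ne_top (by simp) (ENNReal.two_rpow_ne_top _), ← ENNReal.rpow_mul,
      neg_mul]
  have hmain (S Z : ℝ≥0∞) (hS : ∫⁻ z in Q, Φ z ^ (r / q) ∂μ ≤ S)
      (hZ : (2 ^ (-(k * (r - d))) * S) ^ (1 / r) ≤ (1 + (V ^ (1 - r / q)) ^ (1 / r)) * Z) :
      ∫⁻ z in Q, ∫⁻ y in Q, (if 1 ≤ W z y then W z y else 0) ∂μ ∂μ ≤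
        D * (2 ^ (-(k * (2 * d))) * Z) := by
    calc _ ≤ C * (ρ ^ (2 * d) * (ρ ^ (r - d) * (C' * S)) ^ (1 / r)) := by
          refine h1.trans ?_
          gcongr
          exact h2.trans (by gcongr)
      _ = C * (2 ^ (2 * d) * 2 ^ (-(k * (2 * d))) * ((2 ^ (r - d) * C') ^ (1 / r) *
          (2 ^ (-(k * (r - d))) * S) ^ (1 / r))) := by
          rw [hρ2, hρr, ← ENNReal.mul_rpow_of_nonneg _ _ hr1]
          rw [show (2 : ℝ≥0∞) ^ (r - d) * 2 ^ (-(k * (r - d))) * (C' * S) =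
            2 ^ (r - d) * C' * (2 ^ (-(k * (r - d))) * S) by ring]
      _ ≤ C * (2 ^ (2 * d) * 2 ^ (-(k * (2 * d))) * ((2 ^ (r - d) * C') ^ (1 / r) *
          ((1 + (V ^ (1 - r / q)) ^ (1 / r)) * Z))) := by gcongr
      _ = _ := by simp only [D]; ring
  rw [mul_min, mul_min]
  refine le_min (hmain _ _ hmax ?_) (hmain _ _ hhol ?_)
  · rw [← mul_assoc, ENNReal.two_rpow_mul_two_rpow, ENNReal.mul_rpow_of_nonneg _ _ hr1,
      ← ENNReal.rpow_mul]
    have : (-(k * (r - d)) + -(k * d)) * (1 / r) = -(k : ℝ) := by field_simp; ring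
    rw [this]
    exact le_mul_of_one_le_left' le_self_add
  · rw [ENNReal.mul_rpow_of_nonneg _ _ hrq1, ENNReal.mul_rpow_of_nonneg _ _ hr1,
      ENNReal.mul_rpow_of_nonneg _ _ hr1, ENNReal.mul_rpow_of_nonneg _ _ hr1]
    simp only [← ENNReal.rpow_mul]
    have e1 : r / q * (1 / r) = 1 / q := by field_simp
    rw [e1]
    calc _ = (2 ^ (-(k * (r - d)) * (1 / r)) * 2 ^ (-(k * d) * (1 - r / q) * (1 / r))) *
          (V ^ ((1 - r / q) * (1 / r)) * (∫⁻ z in K, Φ z ∂μ) ^ (1 / q)) := by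
          rw [mul_assoc (-(k * d))]
          ring
      _ = V ^ ((1 - r / q) * (1 / r)) *
          (2 ^ (k * (d / q - 1)) * (∫⁻ z in K, Φ z ∂μ) ^ (1 / q)) := by
          rw [ENNReal.two_rpow_mul_two_rpow]
          have : -(k * (r - d)) * (1 / r) + -(k * d) * (1 - r / q) * (1 / r) = k * (d / q - 1) := by
            field_simp; ring
          rw [this]
          ring
      _ ≤ _ := by gcongr; exact le_add_self

end LocalEstimate

/-! ### Telescoping of local means -/

section MeanDist

open Module Filter

variable {E : Type*} [NormedAddCommGroup E] [NormedSpace ℝ E] [MeasurableSpace E] [BorelSpace E]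
  [FiniteDimensional ℝ E] (μ : Measure E) [μ.IsAddHaarMeasure] {W : E → E → ℝ≥0∞} {K : Set E}

/-- The mean of `W x` over the points of `K` at distance at most `2 ^ (-k)` of `x`. -/
def meanDist (K : Set E) (W : E → E → ℝ≥0∞) (k : ℕ) (x : E) : ℝ≥0∞ :=
  (μ (nearSet K k x))⁻¹ * ∫⁻ y in nearSet K k x, W x y ∂μ

lemma measure_nearSet_ne_top (k : ℕ) (x : E) : μ (nearSet K k x) ≠ ⊤ :=
  ne_top_of_le_ne_top (ENNReal.mul_ne_top (ENNReal.two_rpow_ne_top _)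
    measure_closedBall_lt_top.ne) (measure_nearSet_le μ K k x)

lemma inv_measure_nearSet_le (hK : Convex ℝ K) (hK1 : ∀ x ∈ K, ∀ y ∈ K, edist x y ≤ 1)
    (k : ℕ) {x : E} (hx : x ∈ K) :
    (μ (nearSet K k x))⁻¹ ≤ 2 ^ (k * finrank ℝ E : ℝ) * (μ K)⁻¹ := by
  refine (ENNReal.inv_le_inv.2 (le_measure_nearSet μ hK hK1 k hx)).trans_eq ?_
  rw [ENNReal.mul_inv (Or.inl (ENNReal.two_rpow_ne_zero _)) (Or.inl (ENNReal.two_rpow_ne_top _)),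
    ENNReal.inv_two_rpow, neg_neg]

lemma measure_nearSet_ne_zero (hK : Convex ℝ K) (hK1 : ∀ x ∈ K, ∀ y ∈ K, edist x y ≤ 1)
    (hK0 : μ K ≠ 0) (k : ℕ) {x : E} (hx : x ∈ K) : μ (nearSet K k x) ≠ 0 :=
  (lt_of_lt_of_le (ENNReal.mul_pos (ENNReal.two_rpow_ne_zero _) hK0)
    (le_measure_nearSet μ hK hK1 k hx)).ne'

/-- Integrate W(x, y) ≤ W(x, z) + W(z, y) with z in the smaller piece and y in the larger one. The
lower bounds on the two measures turn the double integral into a double mean. -/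
lemma meanDist_le_succ_add (hW : IsMeasurablePseudoDist W) (hK : Convex ℝ K)
    (hK1 : ∀ x ∈ K, ∀ y ∈ K, edist x y ≤ 1) (hK0 : μ K ≠ 0) (k : ℕ) {x : E} (hx : x ∈ K) :
    meanDist μ K W k x ≤ meanDist μ K W (k + 1) x + 2 ^ (finrank ℝ E : ℝ) * (μ K)⁻¹ ^ 2 *
      (2 ^ (k * (2 * finrank ℝ E) : ℝ) *
        ∫⁻ z in nearSet K k x, ∫⁻ y in nearSet K k x, W z y ∂μ ∂μ) := by
  set B := nearSet K k x
  set B' := nearSet K (k + 1) x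
  set J := ∫⁻ z in B, ∫⁻ y in B, W z y ∂μ ∂μ
  have hb0 : μ B ≠ 0 := measure_nearSet_ne_zero μ hK hK1 hK0 k hx
  have hb : μ B ≠ ⊤ := measure_nearSet_ne_top μ k x
  have hb0' : μ B' ≠ 0 := measure_nearSet_ne_zero μ hK hK1 hK0 (k + 1) hx
  have hb' : μ B' ≠ ⊤ := measure_nearSet_ne_top μ (k + 1) x
  have hWx : Measurable (W x) := hW.measurable.of_uncurry_left
  have h1 : μ B' * ∫⁻ y in B, W x y ∂μ ≤ μ B * ∫⁻ z in B', W x z ∂μ + J := by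
    calc _ = ∫⁻ _ in B', ∫⁻ y in B, W x y ∂μ ∂μ := by rw [setLIntegral_const, mul_comm]
      _ ≤ ∫⁻ z in B', (μ B * W x z + ∫⁻ y in B, W z y ∂μ) ∂μ := by
          refine lintegral_mono fun z ↦ ?_
          calc _ ≤ ∫⁻ y in B, (W x z + W z y) ∂μ := lintegral_mono fun y ↦ hW.triangle _ _ _
            _ = _ := by rw [lintegral_add_left measurable_const, setLIntegral_const, mul_comm]
      _ = μ B * (∫⁻ z in B', W x z ∂μ) + ∫⁻ z in B', ∫⁻ y in B, W z y ∂μ ∂μ := by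
          rw [lintegral_add_left (hWx.const_mul _), lintegral_const_mul _ hWx]
      _ ≤ _ := by gcongr; exact lintegral_mono_set (nearSet_succ_subset K k x)
  calc meanDist μ K W k x
      = (μ B')⁻¹ * (μ B)⁻¹ * (μ B' * ∫⁻ y in B, W x y ∂μ) := by
        rw [mul_assoc, mul_left_comm _ (μ B'), ← mul_assoc, ENNReal.inv_mul_cancel hb0' hb',
          one_mul]
        rfl
    _ ≤ (μ B')⁻¹ * (μ B)⁻¹ * (μ B * ∫⁻ z in B', W x z ∂μ + J) := by gcongr
    _ = (μ B)⁻¹ * μ B * meanDist μ K W (k + 1) x + (μ B')⁻¹ * (μ B)⁻¹ * J := by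
        simp only [meanDist, B']; ring
    _ ≤ meanDist μ K W (k + 1) x + (2 ^ ((k + 1 : ℕ) * finrank ℝ E : ℝ) * (μ K)⁻¹) *
          (2 ^ (k * finrank ℝ E : ℝ) * (μ K)⁻¹) * J := by
        rw [ENNReal.inv_mul_cancel hb0 hb, one_mul]
        gcongr
        · exact inv_measure_nearSet_le μ hK hK1 _ hx
        · exact inv_measure_nearSet_le μ hK hK1 _ hx
    _ = _ := by
        have : (2 : ℝ≥0∞) ^ ((k + 1 : ℕ) * finrank ℝ E : ℝ) * 2 ^ (k * finrank ℝ E : ℝ) =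
            2 ^ (finrank ℝ E : ℝ) * 2 ^ (k * (2 * finrank ℝ E) : ℝ) := by
          rw [ENNReal.two_rpow_mul_two_rpow, ENNReal.two_rpow_mul_two_rpow]
          push_cast
          ring_nf
        rw [mul_mul_mul_comm, this]
        ring

/-- A substitute for Lebesgue's differentiation theorem. By Hölder, the small part has mean of order
2^(-kq/p). The large part has mean of order 2^(-k), since W ≤ Λ and the kernel of the jumps is at
least 2^(k(d+1)) at distance at most 2^(-k). -/
lemma tendsto_meanDist_zero {p q : ℝ} (hp : 1 < p) (hq : 0 < q) (hW : IsMeasurablePseudoDist W)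
    {Λ : ℝ≥0∞} (hΛ : Λ ≠ ⊤) (hWΛ : ∀ x y, W x y ≤ Λ) (hKm : MeasurableSet K)
    (hK : Convex ℝ K) (hK1 : ∀ x ∈ K, ∀ y ∈ K, edist x y ≤ 1) (hK0 : μ K ≠ 0) {x : E} (hx : x ∈ K)
    (hΦ : smallKernel μ K W p (finrank ℝ E + q) x ≠ ⊤)
    (hX : ∫⁻ y in K, (if 1 / 4 ≤ W x y then (edist x y ^ (finrank ℝ E + 1 : ℝ))⁻¹ else 0) ∂μ ≠ ⊤) :
    Tendsto (fun k ↦ meanDist μ K W k x) atTop (𝓝 0) := by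
  obtain ⟨C, hC⟩ := setLIntegral_cutoff_le μ hp hq
  set S := smallKernel μ K W p (finrank ℝ E + q) x ^ (1 / p)
  set X := ∫⁻ y in K, (if 1 / 4 ≤ W x y then (edist x y ^ (finrank ℝ E + 1 : ℝ))⁻¹ else 0) ∂μ
  have hp0 : 0 < p := by linarith
  have hS : S ≠ ⊤ := ENNReal.rpow_ne_top_of_nonneg (by positivity) hΦ
  have hWx : Measurable (W x) := hW.measurable.of_uncurry_left
  have hbound (k : ℕ) : meanDist μ K W k x ≤
      (μ K)⁻¹ * (C * S) * 2 ^ (-(k * (q / p))) + (μ K)⁻¹ * (Λ * X) * 2 ^ (-(k * 1 : ℝ)) := by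
    have hsub : nearSet K k x ⊆ K := nearSet_subset K k x
    have hlarge : ∫⁻ y in nearSet K k x, (if 1 ≤ W x y then W x y else 0) ∂μ ≤
        2 ^ (-(k * (finrank ℝ E + 1) : ℝ)) * (Λ * X) := by
      calc _ ≤ ∫⁻ y in nearSet K k x, 2 ^ (-(k * (finrank ℝ E + 1) : ℝ)) *
            (Λ * (if 1 / 4 ≤ W x y then (edist x y ^ (finrank ℝ E + 1 : ℝ))⁻¹ else 0)) ∂μ := by
            refine setLIntegral_mono' (hKm.nearSet k x) fun y hy ↦ ?_
            split_ifs with h1 h2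
            · have h3 : (2 : ℝ≥0∞) ^ (k * (finrank ℝ E + 1) : ℝ) ≤
                  (edist x y ^ (finrank ℝ E + 1 : ℝ))⁻¹ := by
                rw [← neg_neg (k * (finrank ℝ E + 1) : ℝ), ← ENNReal.inv_two_rpow]
                refine ENNReal.inv_le_inv.2 ?_
                rw [← neg_mul, ENNReal.rpow_mul]
                exact ENNReal.rpow_le_rpow hy.2 (by positivity)
              calc W x y ≤ 2 ^ (-(k * (finrank ℝ E + 1) : ℝ)) *
                    (Λ * 2 ^ (k * (finrank ℝ E + 1) : ℝ)) := by
                    rw [mul_left_comm, ENNReal.two_rpow_mul_two_rpow]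
                    simpa using hWΛ x y
                _ ≤ _ := by gcongr
            · refine absurd (le_trans ?_ h1) h2
              rw [one_div]
              exact ENNReal.inv_le_one.2 (by norm_num)
            · exact zero_le
            · exact zero_le
        _ ≤ ∫⁻ y in K, 2 ^ (-(k * (finrank ℝ E + 1) : ℝ)) *
            (Λ * (if 1 / 4 ≤ W x y then (edist x y ^ (finrank ℝ E + 1 : ℝ))⁻¹ else 0)) ∂μ :=
            lintegral_mono_set hsub
        _ = _ := by
            rw [lintegral_const_mul' _ _ (ENNReal.two_rpow_ne_top _), lintegral_const_mul' _ _ hΛ]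
    have hsplit : ∫⁻ y in nearSet K k x, W x y ∂μ =
        ∫⁻ y in nearSet K k x, cutoff (W x y) ∂μ +
          ∫⁻ y in nearSet K k x, (if 1 ≤ W x y then W x y else 0) ∂μ := by
      have hc : Measurable fun y ↦ cutoff (W x y) := measurable_cutoff.comp hWx
      rw [← lintegral_add_left hc]
      refine lintegral_congr fun y ↦ ?_
      unfold cutoff
      split_ifs with h1 h2 h2
      · exact absurd h1 (not_lt.2 h2)
      · simp
      · simp
      · exact absurd (not_lt.1 h1) h2
    calc meanDist μ K W k x
        ≤ (2 ^ (k * finrank ℝ E : ℝ) * (μ K)⁻¹) * (C * (2 ^ (-(k * (finrank ℝ E + q / p))) * S) +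
          2 ^ (-(k * (finrank ℝ E + 1) : ℝ)) * (Λ * X)) := by
          rw [meanDist, hsplit]
          have hx' : x ∈ nearSet K k x := ⟨hx, by simp⟩
          exact mul_le_mul' (inv_measure_nearSet_le μ hK hK1 k hx)
            (add_le_add (hC hW k x x hx') hlarge)
      _ = (μ K)⁻¹ * (C * S) * (2 ^ (k * finrank ℝ E : ℝ) * 2 ^ (-(k * (finrank ℝ E + q / p)))) +
          (μ K)⁻¹ * (Λ * X) * (2 ^ (k * finrank ℝ E : ℝ) * 2 ^ (-(k * (finrank ℝ E + 1) : ℝ))) := by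
          ring
      _ = _ := by
          rw [ENNReal.two_rpow_mul_two_rpow, ENNReal.two_rpow_mul_two_rpow]
          ring_nf
  have hlim {a : ℝ} (ha : 0 < a) {D : ℝ≥0∞} (hD : D ≠ ⊤) :
      Tendsto (fun k : ℕ ↦ D * (2 : ℝ≥0∞) ^ (-(k * a))) atTop (𝓝 0) := by
    have h := ENNReal.tendsto_atTop_zero_of_tsum_ne_top (ENNReal.tsum_two_rpow_neg_mul_ne_top ha)
    simpa using ENNReal.Tendsto.const_mul h (Or.inr hD)
  have hinv : (μ K)⁻¹ ≠ ⊤ := ENNReal.inv_ne_top.2 hK0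
  have h := (hlim (a := q / p) (div_pos hq hp0)
    (ENNReal.mul_ne_top hinv (ENNReal.mul_ne_top (ENNReal.coe_ne_top (r := C)) hS))).add
    (hlim one_pos (ENNReal.mul_ne_top hinv (ENNReal.mul_ne_top hΛ hX)))
  rw [add_zero] at h
  exact tendsto_of_tendsto_of_tendsto_of_le_of_le tendsto_const_nhds h (fun _ ↦ zero_le) hbound

lemma meanDist_le_tsum {ν : ℕ → ℝ≥0∞} {x : E}
    (h : ∀ k, meanDist μ K W k x ≤ meanDist μ K W (k + 1) x + ν k)
    (h0 : Tendsto (fun k ↦ meanDist μ K W k x) atTop (𝓝 0)) (k : ℕ) :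
    meanDist μ K W k x ≤ ∑' i, ν (k + i) := by
  have h1 (n : ℕ) : meanDist μ K W k x ≤ meanDist μ K W (n + k) x + ∑ i ∈ Finset.range n, ν (k + i) := by
    induction n with
    | zero => simp
    | succ n ih =>
      refine ih.trans ?_
      rw [Finset.sum_range_succ, add_right_comm, add_comm (∑ _ ∈ _, _), ← add_assoc]
      refine add_le_add ?_ le_rfl
      rw [add_comm k n]
      exact h (n + k)
  refine le_of_tendsto_of_tendsto (b := atTop) tendsto_const_nhds ?_ (Eventually.of_forall fun n ↦
    (h1 n).trans (add_le_add_right (ENNReal.sum_le_tsum (Finset.range n)) _))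
  simpa using ((tendsto_add_atTop_iff_nat k).2 h0).add tendsto_const_nhds

/-- Average the triangle inequality through z over the piece of radius 2^(-(k+1)) around x. It lies
in the pieces of radius 2^(-k) around both x and y and has comparable measure. -/
lemma pseudoDist_le_meanDist (hK : Convex ℝ K)
    (hK1 : ∀ x ∈ K, ∀ y ∈ K, edist x y ≤ 1) (hK0 : μ K ≠ 0) :
    ∃ C : ℝ≥0, ∀ {W : E → E → ℝ≥0∞}, IsMeasurablePseudoDist W → ∀ (k : ℕ), ∀ x ∈ K, ∀ y ∈ K,
      edist x y ≤ 2 ^ (-(k + 1 : ℝ)) → W x y ≤ C * (meanDist μ K W k x + meanDist μ K W k y) := by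
  set d : ℝ := (finrank ℝ E : ℝ)
  set V := μ (Metric.closedBall (0 : E) 1)
  have hD : 2 ^ d * (μ K)⁻¹ * V ≠ ⊤ := ENNReal.mul_ne_top (ENNReal.mul_ne_top
    (ENNReal.two_rpow_ne_top _) (ENNReal.inv_ne_top.2 hK0)) measure_closedBall_lt_top.ne
  refine ⟨(2 ^ d * (μ K)⁻¹ * V).toNNReal, fun {W} hW k x hx y hy hxy ↦ ?_⟩
  rw [ENNReal.coe_toNNReal hD]
  have hhalf : (2 : ℝ≥0∞) ^ (-(k + 1 : ℝ)) + 2 ^ (-(k + 1 : ℝ)) = 2 ^ (-(k : ℝ)) := by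
    rw [← two_mul]
    nth_rewrite 1 [← ENNReal.rpow_one 2]
    rw [ENNReal.two_rpow_mul_two_rpow]
    ring_nf
  set B := nearSet K (k + 1) x
  have hBx : B ⊆ nearSet K k x := nearSet_succ_subset K k x
  have hBy : B ⊆ nearSet K k y := fun z hz ↦ ⟨hz.1, by
    refine (edist_triangle y x z).trans ?_
    rw [← hhalf, edist_comm y x]
    refine add_le_add hxy ?_
    have := hz.2
    simpa using this⟩
  have hb0 : μ B ≠ 0 := measure_nearSet_ne_zero μ hK hK1 hK0 (k + 1) hx
  have hb : μ B ≠ ⊤ := measure_nearSet_ne_top μ (k + 1) x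
  have hmean (w : E) (hw : w ∈ K) : ∫⁻ z in nearSet K k w, W w z ∂μ ≤
      2 ^ (-(k * d)) * V * meanDist μ K W k w := by
    have h0 := measure_nearSet_ne_zero μ hK hK1 hK0 k hw
    have h1 := measure_nearSet_ne_top μ (K := K) k w
    calc _ = μ (nearSet K k w) * meanDist μ K W k w := by
          rw [meanDist, ← mul_assoc, ENNReal.mul_inv_cancel h0 h1, one_mul]
      _ ≤ _ := mul_le_mul' (measure_nearSet_le μ K k w) le_rfl
  have hWx : Measurable (W x) := hW.measurable.of_uncurry_left
  calc W x y = (μ B)⁻¹ * ∫⁻ _ in B, W x y ∂μ := by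
        rw [setLIntegral_const, mul_left_comm, ENNReal.inv_mul_cancel hb0 hb, mul_one]
    _ ≤ (μ B)⁻¹ * ∫⁻ z in B, (W x z + W y z) ∂μ := by
        gcongr with z
        rw [hW.comm y z]
        exact hW.triangle _ _ _
    _ ≤ (μ B)⁻¹ * (∫⁻ z in nearSet K k x, W x z ∂μ + ∫⁻ z in nearSet K k y, W y z ∂μ) := by
        rw [lintegral_add_left hWx]
        refine mul_le_mul' le_rfl (add_le_add (lintegral_mono_set hBx) (lintegral_mono_set hBy))
    _ ≤ (2 ^ ((k + 1 : ℕ) * d) * (μ K)⁻¹) * (2 ^ (-(k * d)) * V * meanDist μ K W k x +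
          2 ^ (-(k * d)) * V * meanDist μ K W k y) :=
        mul_le_mul' (inv_measure_nearSet_le μ hK hK1 (k + 1) hx)
          (add_le_add (hmean x hx) (hmean y hy))
    _ = 2 ^ ((k + 1 : ℕ) * d) * 2 ^ (-(k * d)) * (μ K)⁻¹ * V *
          (meanDist μ K W k x + meanDist μ K W k y) := by ring
    _ = _ := by
        rw [ENNReal.two_rpow_mul_two_rpow]
        congr 4
        push_cast
        ring

end MeanDist

/-! ### The estimate on a small convex set -/

section LocalTheorem

open Module Filter

variable {E : Type*} [NormedAddCommGroup E] [NormedSpace ℝ E] [MeasurableSpace E] [BorelSpace E]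
  [FiniteDimensional ℝ E] (μ : Measure E) [μ.IsAddHaarMeasure] {K : Set E}

lemma exists_two_rpow_near_edist {x y : E} (h0 : x ≠ y) (h : edist x y ≤ 1 / 4) :
    ∃ k : ℕ, edist x y ≤ 2 ^ (-(k + 1 : ℝ)) ∧ 2 ^ (-(k + 2 : ℝ)) ≤ edist x y := by
  set e := edist x y
  have he0 : e ≠ 0 := by simpa [e] using h0
  have he : e ≠ ⊤ := edist_ne_top _ _
  have h4 : 4 ≤ e⁻¹ := by
    rw [ENNReal.le_inv_iff_le_inv]; simpa using h
  obtain ⟨k, hk1, hk2⟩ := ENNReal.exists_two_rpow_near (lt_of_lt_of_le (by norm_num) h4)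
    (ENNReal.inv_ne_top.2 he0)
  -- The bound 1/4 on the distance is used here: the index can be lowered by two and remain a
  -- natural number.
  have hk : 2 ≤ k := by
    by_contra! hk
    have : (4 : ℝ≥0∞) ≤ 2 ^ (1 : ℝ) := h4.trans (hk2.trans
      (ENNReal.two_rpow_le_two_rpow (by exact_mod_cast Nat.le_of_lt_succ hk)))
    norm_num at this
  obtain ⟨k, rfl⟩ := Nat.exists_eq_add_of_le' hk
  refine ⟨k, ?_, ?_⟩
  · rw [← ENNReal.inv_two_rpow, ENNReal.le_inv_iff_le_inv]
    rw [show ((k + 2 : ℕ) : ℝ) = 1 + (k + 1) by push_cast; ring, ← ENNReal.two_rpow_mul_two_rpow,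
      ENNReal.rpow_one] at hk1
    exact (ENNReal.mul_le_mul_iff_right (by simp) (by simp)).1 hk1
  · rw [← ENNReal.inv_two_rpow, ENNReal.inv_le_iff_inv_le]
    simpa using hk2

/-- The singular energy of a pseudo-distance is controlled by its means. -/
lemma lintegral_kernel_le_of_meanDist_le {p a : ℝ} (hp : 1 < p) (ha : 0 < a)
    (hKm : MeasurableSet K) (hK : Convex ℝ K) (hK4 : ∀ x ∈ K, ∀ y ∈ K, edist x y ≤ 1 / 4)
    (hK0 : μ K ≠ 0) :
    ∃ C : ℝ≥0, ∀ {W : E → E → ℝ≥0∞}, IsMeasurablePseudoDist W → ∀ ν : ℕ → E → ℝ≥0∞,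
      (∀ k, Measurable (ν k)) →
      (∀ᵐ x ∂μ.restrict K, ∀ k, meanDist μ K W k x ≤ ∑' i, ν (k + i) x) →
      ∫⁻ x in K, ∫⁻ y in K, W x y ^ p / edist x y ^ (finrank ℝ E + a) ∂μ ∂μ ≤
        C * ∫⁻ x in K, ∑' k : ℕ, 2 ^ (k * a) * ν k x ^ p ∂μ := by
  have h41 : (1 / 4 : ℝ≥0∞) ≤ 1 := by
    rw [one_div]; exact ENNReal.inv_le_one.2 (by norm_num)
  obtain ⟨C, hC⟩ := pseudoDist_le_meanDist μ hK (fun x hx y hy ↦ (hK4 x hx y hy).trans h41) hK0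
  obtain ⟨C', hC'⟩ := ENNReal.tsum_hardy hp ha
  set d : ℝ := (finrank ℝ E : ℝ)
  have hd : 0 ≤ d := by positivity
  have hp0 : 0 ≤ p := by linarith
  set V := μ (Metric.closedBall (0 : E) 1)
  set c : ℝ≥0∞ := 2 ^ (2 * (d + a)) * (C ^ p * 2 ^ (p - 1))
  have hc : c ≠ ⊤ := ENNReal.mul_ne_top (ENNReal.two_rpow_ne_top _) (ENNReal.mul_ne_top
    (ENNReal.rpow_ne_top_of_nonneg hp0 ENNReal.coe_ne_top) (ENNReal.two_rpow_ne_top _))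
  have hD : c * (2 * V) * C' ≠ ⊤ := ENNReal.mul_ne_top (ENNReal.mul_ne_top hc
    (ENNReal.mul_ne_top (by simp) measure_closedBall_lt_top.ne)) ENNReal.coe_ne_top
  refine ⟨(c * (2 * V) * C').toNNReal, fun {W} hW ν hν hT ↦ ?_⟩
  rw [ENNReal.coe_toNNReal hD]
  set G : ℕ → E → ℝ≥0∞ := fun k x ↦ ∑' i, ν (k + i) x
  have hG (k : ℕ) : Measurable (G k) := Measurable.tsum fun i ↦ hν _
  set F : ℕ → E → E → ℝ≥0∞ := fun k x y ↦
    if edist x y ≤ 2 ^ (-((k : ℝ) + 1)) then G k x ^ p else 0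
  have hF (k : ℕ) : Measurable (Function.uncurry (F k)) :=
    Measurable.ite (measurableSet_le (by fun_prop) measurable_const)
      (((hG k).comp measurable_fst).pow_const p) measurable_const
  have hFint (k : ℕ) : ∫⁻ x in K, ∫⁻ y in K, F k x y ∂μ ∂μ ≤
      2 ^ (-(k * d)) * V * ∫⁻ x in K, G k x ^ p ∂μ := by
    rw [← lintegral_const_mul _ ((hG k).pow_const p)]
    refine lintegral_mono fun x ↦ ?_
    have hset : MeasurableSet {y | edist x y ≤ 2 ^ (-((k : ℝ) + 1))} :=
      measurableSet_le (by fun_prop) measurable_const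
    calc ∫⁻ y in K, F k x y ∂μ
        = ∫⁻ y in K, {y | edist x y ≤ 2 ^ (-((k : ℝ) + 1))}.indicator (fun _ ↦ G k x ^ p) y ∂μ := by
          simp only [F, indicator_apply, mem_ofPred_eq]
      _ = G k x ^ p * μ ({y | edist x y ≤ 2 ^ (-((k : ℝ) + 1))} ∩ K) := by
          rw [lintegral_indicator_const hset, Measure.restrict_apply hset]
      _ ≤ G k x ^ p * μ (nearSet K k x) := by
          gcongr
          exact fun y hy ↦ ⟨hy.2, le_trans hy.1 (ENNReal.two_rpow_le_two_rpow (by linarith))⟩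
      _ ≤ G k x ^ p * (2 ^ (-(k * d)) * V) := by gcongr; exact measure_nearSet_le μ K k x
      _ = _ := mul_comm _ _
  -- A pair contributes at the one dyadic scale comparable to its distance, where W(x, y) is bounded
  -- by the means at x and at y; the full sum over k is only a convenient majorant.
  have hpt : ∀ᵐ x ∂μ.restrict K, ∀ᵐ y ∂μ.restrict K, W x y ^ p / edist x y ^ (d + a) ≤
      ∑' k : ℕ, c * 2 ^ (k * (d + a)) * (F k x y + F k y x) := by
    filter_upwards [hT, ae_restrict_mem hKm] with x hx hxK
    filter_upwards [hT, ae_restrict_mem hKm] with y hy hyK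
    rcases eq_or_ne x y with rfl | hxy
    · rw [hW.self, ENNReal.zero_rpow_of_pos (by linarith), ENNReal.zero_div]
      exact zero_le
    obtain ⟨k, hk1, hk2⟩ := exists_two_rpow_near_edist hxy (hK4 x hxK y hyK)
    refine le_trans ?_ (ENNReal.le_tsum k)
    have hF1 : F k x y = G k x ^ p := if_pos hk1
    have hF2 : F k y x = G k y ^ p := if_pos (by rwa [edist_comm])
    rw [hF1, hF2]
    have hda : 0 ≤ d + a := by positivity
    calc W x y ^ p / edist x y ^ (d + a)
        ≤ (C * (G k x + G k y)) ^ p / (2 ^ (-(k + 2 : ℝ))) ^ (d + a) := by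
          refine ENNReal.div_le_div (ENNReal.rpow_le_rpow ?_ hp0) (ENNReal.rpow_le_rpow hk2 hda)
          exact (hC hW k x hxK y hyK hk1).trans (mul_le_mul' le_rfl (add_le_add (hx k) (hy k)))
      _ = C ^ p * (G k x + G k y) ^ p * (2 ^ (2 * (d + a)) * 2 ^ (k * (d + a))) := by
          rw [ENNReal.mul_rpow_of_nonneg _ _ hp0, ← ENNReal.rpow_mul, div_eq_mul_inv,
            ENNReal.inv_two_rpow, ENNReal.two_rpow_mul_two_rpow]
          congr 2
          ring
      _ ≤ C ^ p * (2 ^ (p - 1) * (G k x ^ p + G k y ^ p)) *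
            (2 ^ (2 * (d + a)) * 2 ^ (k * (d + a))) := by
          gcongr
          exact ENNReal.rpow_add_le_mul_rpow_add_rpow _ _ hp.le
      _ = _ := by simp only [c]; ring
  have hFx (k : ℕ) : Measurable fun z : E × E ↦ F k z.1 z.2 := hF k
  have hFy (k : ℕ) : Measurable fun z : E × E ↦ F k z.2 z.1 := (hF k).comp measurable_swap
  calc ∫⁻ x in K, ∫⁻ y in K, W x y ^ p / edist x y ^ (d + a) ∂μ ∂μ
      ≤ ∫⁻ x in K, ∫⁻ y in K, ∑' k : ℕ, c * 2 ^ (k * (d + a)) * (F k x y + F k y x) ∂μ ∂μ :=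
        lintegral_mono_ae (hpt.mono fun x hx ↦ lintegral_mono_ae hx)
    _ = ∑' k : ℕ, c * 2 ^ (k * (d + a)) * (∫⁻ x in K, ∫⁻ y in K, F k x y ∂μ ∂μ +
          ∫⁻ x in K, ∫⁻ y in K, F k x y ∂μ ∂μ) := by
        have h1 (x : E) : ∫⁻ y in K, ∑' k : ℕ, c * 2 ^ (k * (d + a)) * (F k x y + F k y x) ∂μ =
            ∑' k : ℕ, c * 2 ^ (k * (d + a)) *
              (∫⁻ y in K, F k x y ∂μ + ∫⁻ y in K, F k y x ∂μ) := by
          have hx (k : ℕ) : Measurable fun y ↦ F k x y :=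
            (hFx k).comp (measurable_const.prodMk measurable_id)
          have hy (k : ℕ) : Measurable fun y ↦ F k y x :=
            (hFy k).comp (measurable_const.prodMk measurable_id)
          have hxy (k : ℕ) : Measurable fun y ↦ F k x y + F k y x := (hx k).add (hy k)
          rw [lintegral_tsum fun k ↦ ((hxy k).const_mul _).aemeasurable]
          refine tsum_congr fun k ↦ ?_
          rw [lintegral_const_mul _ (hxy k), lintegral_add_left (hx k)]
        simp only [h1]
        have hX (k : ℕ) : Measurable fun x ↦ ∫⁻ y in K, F k x y ∂μ := (hFx k).lintegral_prod_right'
        have hY (k : ℕ) : Measurable fun x ↦ ∫⁻ y in K, F k y x ∂μ := (hFy k).lintegral_prod_right'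
        have hXY (k : ℕ) : Measurable fun x ↦
            ∫⁻ y in K, F k x y ∂μ + ∫⁻ y in K, F k y x ∂μ := (hX k).add (hY k)
        rw [lintegral_tsum fun k ↦ ((hXY k).const_mul _).aemeasurable]
        refine tsum_congr fun k ↦ ?_
        rw [lintegral_const_mul _ (hXY k), lintegral_add_left (hX k)]
        congr 2
        exact lintegral_lintegral_swap (f := fun x y ↦ F k y x) (hFy k).aemeasurable
    _ ≤ ∑' k : ℕ, c * (2 * V) * (2 ^ (k * a) * ∫⁻ x in K, G k x ^ p ∂μ) := by
        refine ENNReal.tsum_le_tsum fun k ↦ ?_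
        calc _ ≤ c * 2 ^ (k * (d + a)) * (2 ^ (-(k * d)) * V * ∫⁻ x in K, G k x ^ p ∂μ +
              2 ^ (-(k * d)) * V * ∫⁻ x in K, G k x ^ p ∂μ) :=
              mul_le_mul' le_rfl (add_le_add (hFint k) (hFint k))
          _ = c * (2 * V) * ((2 ^ (k * (d + a)) * 2 ^ (-(k * d))) * ∫⁻ x in K, G k x ^ p ∂μ) := by
              ring
          _ = _ := by
              rw [ENNReal.two_rpow_mul_two_rpow, show (k : ℝ) * (d + a) + -(k * d) = k * a by ring]
    _ = c * (2 * V) * ∫⁻ x in K, ∑' k : ℕ, 2 ^ (k * a) * G k x ^ p ∂μ := by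
        rw [ENNReal.tsum_mul_left, lintegral_tsum fun k ↦
          (((hG k).pow_const p).const_mul _).aemeasurable]
        congr 1
        exact tsum_congr fun k ↦ (lintegral_const_mul _ ((hG k).pow_const p)).symm
    _ ≤ c * (2 * V) * ∫⁻ x in K, C' * ∑' k : ℕ, 2 ^ (k * a) * ν k x ^ p ∂μ := by
        gcongr with x
        exact hC' fun k ↦ ν k x
    _ = _ := by
        rw [lintegral_const_mul' _ _ ENNReal.coe_ne_top]
        ring

/-- Summation of the bounds of the increments of the means over the scales. -/
lemma tsum_level_rpow_le {p q d r : ℝ} (hp : 1 < p) (hq : 1 < q) (hqp : q < p) (hqd : q < d)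
    (hr : 0 < r) :
    ∃ C : ℝ≥0, ∀ M₁ M₂ A : ℝ≥0∞, ∑' k : ℕ, (2 : ℝ≥0∞) ^ (k * (p - p * d / q + d)) *
      (2 ^ (-(k * (q / p))) * M₁ +
        min (2 ^ (-(k : ℝ)) * M₂ ^ (1 / r)) (2 ^ (k * (d / q - 1)) * A ^ (1 / q))) ^ p ≤
      C * (M₁ ^ p + M₂ ^ (q / r) * A ^ (p / q - 1)) := by
  have hp0 : 0 < p := by linarith
  have hq0 : 0 < q := by linarith
  have hd0 : 0 < d := by linarith
  set a := p - p * d / q + d with ha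
  -- The difference q - a = (p - q)(d/q - 1) makes the terms with M₁ summable.
  have haq : 0 < q - a := by
    have : q - a = (p - q) * (d / q - 1) := by rw [ha]; field_simp; ring
    rw [this]
    exact mul_pos (by linarith) (by rw [sub_pos, one_lt_div hq0]; exact hqd)
  have hγ : 0 < d * (p / q - 1) :=
    mul_pos hd0 (by rw [sub_pos, one_lt_div hq0]; exact hqp)
  -- The two branches of the p-th power of the minimum, weighted by 2^(ka), have exponents a - p =
  -- -d(p/q - 1) < 0 and a + p(d/q - 1) = d > 0. The resulting power of M₂ is (p/r)(q/p) = q/r,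
  -- which is what the value of a was made for.
  obtain ⟨C, hC⟩ := ENNReal.tsum_min_two_rpow_le hγ hd0
  set S := ∑' k : ℕ, (2 : ℝ≥0∞) ^ (-(k * (q - a)))
  have hS : S ≠ ⊤ := ENNReal.tsum_two_rpow_neg_mul_ne_top haq
  have hD : 2 ^ (p - 1) * (S + C) ≠ ⊤ := ENNReal.mul_ne_top (ENNReal.two_rpow_ne_top _)
    (ENNReal.add_ne_top.2 ⟨hS, ENNReal.coe_ne_top⟩)
  refine ⟨(2 ^ (p - 1) * (S + C)).toNNReal, fun M₁ M₂ A ↦ ?_⟩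
  rw [ENNReal.coe_toNNReal hD]
  have hsum := hC (M₂ ^ (p / r)) (A ^ (p / q))
  have e1 : p / r * (d / (d * (p / q - 1) + d)) = q / r := by
    have : d * (p / q - 1) + d = d * p / q := by ring
    rw [this]; field_simp
  have e2 : p / q * (d * (p / q - 1) / (d * (p / q - 1) + d)) = p / q - 1 := by
    have : d * (p / q - 1) + d = d * p / q := by ring
    rw [this]; field_simp
  rw [← ENNReal.rpow_mul, ← ENNReal.rpow_mul, e1, e2] at hsum
  have hterm (k : ℕ) : (2 : ℝ≥0∞) ^ (k * a) * (2 ^ (-(k * (q / p))) * M₁ +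
        min (2 ^ (-(k : ℝ)) * M₂ ^ (1 / r)) (2 ^ (k * (d / q - 1)) * A ^ (1 / q))) ^ p ≤
      2 ^ (p - 1) * (2 ^ (-(k * (q - a))) * M₁ ^ p + min (2 ^ (-(k * (d * (p / q - 1)))) * M₂ ^ (p / r))
        (2 ^ (k * d) * A ^ (p / q))) := by
    have hmin (u v : ℝ≥0∞) : (min u v) ^ p = min (u ^ p) (v ^ p) :=
      (ENNReal.monotone_rpow_of_nonneg hp0.le).map_min
    calc _ ≤ (2 : ℝ≥0∞) ^ (k * a) * (2 ^ (p - 1) * ((2 ^ (-(k * (q / p))) * M₁) ^ p +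
          (min (2 ^ (-(k : ℝ)) * M₂ ^ (1 / r)) (2 ^ (k * (d / q - 1)) * A ^ (1 / q))) ^ p)) :=
          mul_le_mul' le_rfl (ENNReal.rpow_add_le_mul_rpow_add_rpow _ _ hp.le)
      _ = 2 ^ (p - 1) * (2 ^ (k * a) * (2 ^ (-(k * (q / p)) * p) * M₁ ^ p) +
          min (2 ^ (k * a) * (2 ^ (-(k : ℝ) * p) * M₂ ^ (1 / r * p)))
            (2 ^ (k * a) * (2 ^ (k * (d / q - 1) * p) * A ^ (1 / q * p)))) := by
          rw [hmin, ← mul_min]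
          simp only [ENNReal.mul_rpow_of_nonneg _ _ hp0.le, ← ENNReal.rpow_mul]
          ring
      _ = _ := by
          have f1 : k * a + -(k * (q / p)) * p = -(k * (q - a)) := by field_simp; ring
          have f2 : k * a + -(k : ℝ) * p = -(k * (d * (p / q - 1))) := by
            rw [ha]; field_simp; ring
          have f3 : k * a + k * (d / q - 1) * p = k * d := by rw [ha]; field_simp; ring
          simp only [← mul_assoc, ENNReal.two_rpow_mul_two_rpow, one_div_mul_eq_div, f1, f2, f3]
  calc _ ≤ ∑' k : ℕ, 2 ^ (p - 1) * (2 ^ (-(k * (q - a))) * M₁ ^ p +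
        min (2 ^ (-(k * (d * (p / q - 1)))) * M₂ ^ (p / r)) (2 ^ (k * d) * A ^ (p / q))) :=
        ENNReal.tsum_le_tsum hterm
    _ = 2 ^ (p - 1) * (S * M₁ ^ p + ∑' k : ℕ, min (2 ^ (-(k * (d * (p / q - 1)))) * M₂ ^ (p / r))
        (2 ^ (k * d) * A ^ (p / q))) := by
        rw [ENNReal.tsum_mul_left, ENNReal.tsum_add, ENNReal.tsum_mul_right]
    _ ≤ 2 ^ (p - 1) * (S * M₁ ^ p + C * (M₂ ^ (q / r) * A ^ (p / q - 1))) := by gcongr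
    _ ≤ 2 ^ (p - 1) * ((S + C) * M₁ ^ p + (S + C) * (M₂ ^ (q / r) * A ^ (p / q - 1))) := by
        gcongr
        · exact le_self_add
        · exact le_add_self
    _ = _ := by ring

end LocalTheorem

section LocalTheorem

open Module Filter

variable {E : Type*} [NormedAddCommGroup E] [NormedSpace ℝ E] [MeasurableSpace E] [BorelSpace E]
  [FiniteDimensional ℝ E] (μ : Measure E) [μ.IsAddHaarMeasure] {K : Set E}

lemma setLIntegral_dyadicMaximal_rpow_le {P : ℝ} (hP : 1 < P) :
    ∃ C : ℝ≥0, ∀ {K : Set E}, MeasurableSet K → ∀ f : E → ℝ≥0∞, Measurable f →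
      ∫⁻ x in K, dyadicMaximal μ (K.indicator f) x ^ P ∂μ ≤ C * ∫⁻ x in K, f x ^ P ∂μ := by
  obtain ⟨C, hC⟩ := lintegral_dyadicMaximal_rpow_le μ hP
  refine ⟨C, fun {K} hK f hf ↦ (setLIntegral_le_lintegral _ _).trans
    ((hC _ (hf.indicator hK)).trans_eq ?_)⟩
  rw [← lintegral_indicator hK]
  congr 2 with x
  by_cases hx : x ∈ K <;> simp [hx, ENNReal.zero_rpow_of_pos (zero_lt_one.trans hP)]

/-- The increments of the means are bounded by two maximal functions, and Hardy's inequality with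
the sum over scales leaves M₁^p + M₂^(q/r) A^(p/q-1). The powers p and q/r undo those of Φ inside M₁
and M₂, so both maximal functions integrate to a multiple of A. -/
lemma lintegral_kernel_le_of_bounded {p q : ℝ} (hq : 1 < q) (hqp : q < p)
    (hqd : q < finrank ℝ E) (ha : 0 < p - p * finrank ℝ E / q + finrank ℝ E)
    (hKm : MeasurableSet K) (hK : Convex ℝ K) (hK4 : ∀ x ∈ K, ∀ y ∈ K, edist x y ≤ 1 / 4)
    (hK0 : μ K ≠ 0) :
    ∃ C : ℝ≥0, ∀ {W : E → E → ℝ≥0∞}, IsMeasurablePseudoDist W → ∀ {Λ : ℝ≥0∞}, Λ ≠ ⊤ →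
      (∀ x y, W x y ≤ Λ) →
      ∫⁻ x in K, ∫⁻ y in K, (if 1 / 4 ≤ W x y then (edist x y ^ (finrank ℝ E + 1 : ℝ))⁻¹ else 0)
        ∂μ ∂μ ≠ ⊤ →
      ∫⁻ x in K, smallKernel μ K W p (finrank ℝ E + q) x ∂μ ≠ ⊤ →
      ∫⁻ x in K, ∫⁻ y in K,
        W x y ^ p / edist x y ^ (finrank ℝ E + (p - p * finrank ℝ E / q + finrank ℝ E)) ∂μ ∂μ ≤
      C * (∫⁻ x in K, smallKernel μ K W p (finrank ℝ E + q) x ∂μ +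
        (∫⁻ x in K, smallKernel μ K W p (finrank ℝ E + q) x ∂μ) ^ (p / q)) := by
  have hp : 1 < p := hq.trans hqp
  have hp0 : 0 < p := by linarith
  have hq0 : 0 < q := by linarith
  -- The Poincaré inequality needs r > 1; the maximal theorem in the exponent q/r needs r < q. This
  -- is where q = sp > 1 is essential.
  obtain ⟨r, hr, hrq⟩ := exists_between hq
  have hr0 : 0 < r := by linarith
  have hK1 : ∀ x ∈ K, ∀ y ∈ K, edist x y ≤ 1 := fun x hx y hy ↦ (hK4 x hx y hy).trans (by
    rw [one_div]; exact ENNReal.inv_le_one.2 (by norm_num))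
  obtain ⟨C₁, hC₁⟩ := lintegral_kernel_le_of_meanDist_le μ hp ha hKm hK hK4 hK0
  obtain ⟨C₂, hC₂⟩ := tsum_level_rpow_le hp hq hqp hqd hr0
  obtain ⟨C₃, hC₃⟩ := lintegral_nearSet_cutoff_le μ hp hq0
  obtain ⟨C₄, hC₄⟩ := lintegral_nearSet_large_le μ hp hr hrq
  obtain ⟨C₅, hC₅⟩ := setLIntegral_dyadicMaximal_rpow_le μ hp
  obtain ⟨C₆, hC₆⟩ := setLIntegral_dyadicMaximal_rpow_le μ ((one_lt_div hr0).2 hrq)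
  set d : ℝ := (finrank ℝ E : ℝ)
  set a : ℝ := p - p * d / q + d
  set D : ℝ≥0∞ := 2 ^ d * (μ K)⁻¹ ^ 2 * (C₃ + C₄)
  have hD : D ≠ ⊤ := ENNReal.mul_ne_top (ENNReal.mul_ne_top (ENNReal.two_rpow_ne_top _)
    (ENNReal.pow_ne_top (ENNReal.inv_ne_top.2 hK0)))
    (ENNReal.add_ne_top.2 ⟨ENNReal.coe_ne_top, ENNReal.coe_ne_top⟩)
  set C : ℝ≥0∞ := C₁ * (D ^ p * C₂ * (C₅ + C₆))
  have hC : C ≠ ⊤ := ENNReal.mul_ne_top ENNReal.coe_ne_top (ENNReal.mul_ne_top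
    (ENNReal.mul_ne_top (ENNReal.rpow_ne_top_of_nonneg hp0.le hD) ENNReal.coe_ne_top)
    (ENNReal.add_ne_top.2 ⟨ENNReal.coe_ne_top, ENNReal.coe_ne_top⟩))
  refine ⟨C.toNNReal, fun {W} hW {Λ} hΛ hWΛ hX hA ↦ ?_⟩
  rw [ENNReal.coe_toNNReal hC]
  set Φ := smallKernel μ K W p (d + q)
  have hΦ : Measurable Φ := measurable_smallKernel μ K hW p (d + q)
  set A := ∫⁻ x in K, Φ x ∂μ
  set M₁ := dyadicMaximal μ (K.indicator fun z ↦ Φ z ^ (1 / p))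
  set M₂ := dyadicMaximal μ (K.indicator fun z ↦ Φ z ^ (r / q))
  have hM₁ : Measurable M₁ := measurable_dyadicMaximal μ ((hΦ.pow_const _).indicator hKm)
  have hM₂ : Measurable M₂ := measurable_dyadicMaximal μ ((hΦ.pow_const _).indicator hKm)
  set ν₀ : ℕ → E → ℝ≥0∞ := fun k x ↦ 2 ^ (-(k * (q / p))) * M₁ x +
    min (2 ^ (-(k : ℝ)) * M₂ x ^ (1 / r)) (2 ^ (k * (d / q - 1)) * A ^ (1 / q))
  have hν₀ (k : ℕ) : Measurable (ν₀ k) := (hM₁.const_mul _).add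
    (((hM₂.pow_const _).const_mul _).min measurable_const)
  have hWm : Measurable fun z : E × E ↦ W z.1 z.2 := hW.measurable
  have hXm : Measurable fun x ↦
      ∫⁻ y in K, (if 1 / 4 ≤ W x y then (edist x y ^ (d + 1))⁻¹ else 0) ∂μ := by
    have : Measurable fun z : E × E ↦
        (if 1 / 4 ≤ W z.1 z.2 then (edist z.1 z.2 ^ (d + 1))⁻¹ else 0) :=
      Measurable.ite (measurableSet_le measurable_const hWm) (by fun_prop) measurable_const
    exact this.lintegral_prod_right'
  have hLm : Measurable fun z : E × E ↦ (if 1 ≤ W z.1 z.2 then W z.1 z.2 else 0) :=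
    Measurable.ite (measurableSet_le measurable_const hWm) hWm measurable_const
  have hCm : Measurable fun z : E × E ↦ cutoff (W z.1 z.2) := measurable_cutoff.comp hWm
  have hstep (k : ℕ) {x : E} (hx : x ∈ K) :
      meanDist μ K W k x ≤ meanDist μ K W (k + 1) x + D * ν₀ k x := by
    refine (meanDist_le_succ_add μ hW hK hK1 hK0 k hx).trans (add_le_add le_rfl ?_)
    have hsplit : ∫⁻ z in nearSet K k x, ∫⁻ y in nearSet K k x, W z y ∂μ ∂μ =
        ∫⁻ z in nearSet K k x, ∫⁻ y in nearSet K k x, cutoff (W z y) ∂μ ∂μ +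
        ∫⁻ z in nearSet K k x, ∫⁻ y in nearSet K k x, (if 1 ≤ W z y then W z y else 0) ∂μ ∂μ := by
      rw [← lintegral_add_left hCm.lintegral_prod_right']
      refine lintegral_congr fun z ↦ ?_
      have hc : Measurable fun y ↦ cutoff (W z y) :=
        measurable_cutoff.comp hW.measurable.of_uncurry_left
      rw [← lintegral_add_left hc]
      refine lintegral_congr fun y ↦ ?_
      unfold cutoff
      split_ifs with h1 h2 h2
      · exact absurd h1 (not_lt.2 h2)
      · simp
      · simp
      · exact absurd (not_lt.1 h1) h2
    rw [hsplit]
    have hν₀k : C₃ * (2 ^ (-(k * (q / p))) * M₁ x) + C₄ *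
        min (2 ^ (-(k : ℝ)) * M₂ x ^ (1 / r)) (2 ^ (k * (d / q - 1)) * A ^ (1 / q)) ≤
        (C₃ + C₄) * ν₀ k x := by
      rw [mul_add]
      gcongr
      · exact le_self_add
      · exact le_add_self
    calc _ ≤ 2 ^ d * (μ K)⁻¹ ^ 2 * (2 ^ (k * (2 * d)) *
          (C₃ * (2 ^ (-(k * (2 * d))) * (2 ^ (-(k * (q / p))) * M₁ x)) +
          C₄ * (2 ^ (-(k * (2 * d))) * min (2 ^ (-(k : ℝ)) * M₂ x ^ (1 / r))
            (2 ^ (k * (d / q - 1)) * A ^ (1 / q))))) :=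
          mul_le_mul' le_rfl (mul_le_mul' le_rfl
            (add_le_add (hC₃ hW hKm k x) (hC₄ hW hΛ hWΛ hKm hK hX k x)))
      _ = 2 ^ d * (μ K)⁻¹ ^ 2 * ((2 ^ (k * (2 * d)) * 2 ^ (-(k * (2 * d)))) *
          (C₃ * (2 ^ (-(k * (q / p))) * M₁ x) +
          C₄ * min (2 ^ (-(k : ℝ)) * M₂ x ^ (1 / r)) (2 ^ (k * (d / q - 1)) * A ^ (1 / q)))) := by
          ring
      _ ≤ 2 ^ d * (μ K)⁻¹ ^ 2 * ((C₃ + C₄) * ν₀ k x) := by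
          rw [ENNReal.two_rpow_mul_two_rpow, add_neg_cancel, ENNReal.rpow_zero, one_mul]
          gcongr
      _ = _ := (mul_assoc _ _ _).symm
  have hmean : ∀ᵐ x ∂μ.restrict K, ∀ k, meanDist μ K W k x ≤ ∑' i, D * ν₀ (k + i) x := by
    filter_upwards [ae_restrict_mem hKm, ae_lt_top hΦ hA, ae_lt_top hXm hX] with x hx h1 h2 k
    exact meanDist_le_tsum μ (ν := fun k ↦ D * ν₀ k x) (fun k ↦ hstep k hx)
      (tendsto_meanDist_zero μ hp hq0 hW hΛ hWΛ hKm hK hK1 hK0 hx h1.ne h2.ne) k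
  have e1 (x : E) : (Φ x ^ (1 / p)) ^ p = Φ x := by
    rw [← ENNReal.rpow_mul, one_div_mul_cancel hp0.ne', ENNReal.rpow_one]
  have e2 (x : E) : (Φ x ^ (r / q)) ^ (q / r) = Φ x := by
    rw [← ENNReal.rpow_mul, div_mul_div_cancel₀ hq0.ne', div_self hr0.ne', ENNReal.rpow_one]
  have hI₁ : ∫⁻ x in K, M₁ x ^ p ∂μ ≤ C₅ * A := by
    simpa only [e1] using hC₅ hKm _ (hΦ.pow_const (1 / p))
  have hI₂ : ∫⁻ x in K, M₂ x ^ (q / r) ∂μ ≤ C₆ * A := by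
    simpa only [e2] using hC₆ hKm _ (hΦ.pow_const (r / q))
  have hpq1 : 0 ≤ p / q - 1 := by rw [sub_nonneg, one_le_div hq0]; exact hqp.le
  have hApow : A * A ^ (p / q - 1) = A ^ (p / q) := by
    nth_rewrite 1 [← ENNReal.rpow_one A]
    rw [← ENNReal.rpow_add_of_nonneg _ _ zero_le_one hpq1]
    ring_nf
  calc _ ≤ C₁ * ∫⁻ x in K, ∑' k : ℕ, 2 ^ (k * a) * (D * ν₀ k x) ^ p ∂μ :=
        hC₁ hW (fun k x ↦ D * ν₀ k x) (fun k ↦ (hν₀ k).const_mul _) hmean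
    _ ≤ C₁ * ∫⁻ x in K, D ^ p * C₂ * (M₁ x ^ p + M₂ x ^ (q / r) * A ^ (p / q - 1)) ∂μ := by
        gcongr with x
        calc _ = D ^ p * ∑' k : ℕ, 2 ^ (k * a) * ν₀ k x ^ p := by
              rw [← ENNReal.tsum_mul_left]
              refine tsum_congr fun k ↦ ?_
              rw [ENNReal.mul_rpow_of_nonneg _ _ hp0.le, mul_left_comm]
          _ ≤ _ := by
              rw [mul_assoc]
              exact mul_le_mul' le_rfl (hC₂ _ _ _)
    _ = C₁ * (D ^ p * C₂ * (∫⁻ x in K, M₁ x ^ p ∂μ +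
          (∫⁻ x in K, M₂ x ^ (q / r) ∂μ) * A ^ (p / q - 1))) := by
        have hm : Measurable fun x ↦ M₁ x ^ p + M₂ x ^ (q / r) * A ^ (p / q - 1) :=
          (hM₁.pow_const _).add ((hM₂.pow_const _).mul_const _)
        rw [lintegral_const_mul _ hm, lintegral_add_left (hM₁.pow_const _), lintegral_mul_const _ (hM₂.pow_const _)]
    _ ≤ C₁ * (D ^ p * C₂ * (C₅ * A + (C₆ * A) * A ^ (p / q - 1))) := by gcongr
    _ ≤ C₁ * (D ^ p * C₂ * ((C₅ + C₆) * A + (C₅ + C₆) * A ^ (p / q))) := by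
        rw [mul_assoc (C₆ : ℝ≥0∞), hApow]
        gcongr
        · exact le_self_add
        · exact le_add_self
    _ = _ := by simp only [C]; ring

lemma iSup_min_natCast_succ (a : ℝ≥0∞) : ⨆ n : ℕ, min a ((n + 1 : ℕ) : ℝ≥0∞) = a := by
  refine le_antisymm (iSup_le fun n ↦ min_le_left _ _) ?_
  refine le_of_forall_lt fun b hb ↦ ?_
  obtain ⟨n, hn⟩ := ENNReal.exists_nat_gt (ne_top_of_lt hb)
  refine lt_of_lt_of_le (lt_min hb ?_) (le_iSup (fun n : ℕ ↦ min a ((n + 1 : ℕ) : ℝ≥0∞)) n)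
  exact hn.trans (by exact_mod_cast Nat.lt_succ_self n)

lemma IsMeasurablePseudoDist.min_const {W : E → E → ℝ≥0∞} (hW : IsMeasurablePseudoDist W)
    (c : ℝ≥0∞) : IsMeasurablePseudoDist fun x y ↦ min (W x y) c where
  self x := by simp [hW.self]
  comm x y := by rw [hW.comm]
  triangle x y z := by
    rcases le_total (W x y) c with h | h
    · rcases le_total (W y z) c with h' | h'
      · rw [min_eq_left h, min_eq_left h']
        exact (min_le_left _ _).trans (hW.triangle _ _ _)
      · rw [min_eq_right h']
        exact (min_le_right _ _).trans le_add_self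
    · rw [min_eq_right h]
      exact (min_le_right _ _).trans le_self_add
  measurable := hW.measurable.min measurable_const

/-- The main local estimate. -/
lemma lintegral_kernel_le {p q : ℝ} (hq : 1 < q) (hqp : q < p)
    (hqd : q < finrank ℝ E) (ha : 0 < p - p * finrank ℝ E / q + finrank ℝ E)
    (hKm : MeasurableSet K) (hK : Convex ℝ K) (hK4 : ∀ x ∈ K, ∀ y ∈ K, edist x y ≤ 1 / 4)
    (hK0 : μ K ≠ 0) :
    ∃ C : ℝ≥0, ∀ {W : E → E → ℝ≥0∞}, IsMeasurablePseudoDist W →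
      ∫⁻ x in K, ∫⁻ y in K, (if 1 ≤ W x y then (edist x y ^ (finrank ℝ E + 1 : ℝ))⁻¹ else 0)
        ∂μ ∂μ ≠ ⊤ →
      ∫⁻ x in K, ∫⁻ y in K,
        W x y ^ p / edist x y ^ (finrank ℝ E + (p - p * finrank ℝ E / q + finrank ℝ E)) ∂μ ∂μ ≤
      C * (∫⁻ x in K, smallKernel μ K W p (finrank ℝ E + q) x ∂μ +
        (∫⁻ x in K, smallKernel μ K W p (finrank ℝ E + q) x ∂μ) ^ (p / q)) := by
  obtain ⟨C, hC⟩ := lintegral_kernel_le_of_bounded μ hq hqp hqd ha hKm hK hK4 hK0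
  have hp0 : 0 < p := by linarith
  set d : ℝ := (finrank ℝ E : ℝ)
  set a : ℝ := p - p * d / q + d
  -- The added 1 makes the right-hand side infinite when A is.
  refine ⟨C + 1, fun {W} hW hX ↦ ?_⟩
  by_cases hA : ∫⁻ x in K, smallKernel μ K W p (d + q) x ∂μ = ⊤
  · rw [hA, top_add, ENNReal.mul_top (by simp)]
    exact le_top
  have hWm : Measurable fun z : E × E ↦ W z.1 z.2 := hW.measurable
  -- Truncating at heights at least 1 does not change the small part, so the estimate is uniform in
  -- n and passes to the limit by monotone convergence.
  set W' : ℕ → E → E → ℝ≥0∞ := fun n x y ↦ min (W x y) ((n + 1 : ℕ) : ℝ≥0∞)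
  have hW' (n : ℕ) : IsMeasurablePseudoDist (W' n) := hW.min_const _
  have hn1 (n : ℕ) : (1 : ℝ≥0∞) ≤ ((n + 1 : ℕ) : ℝ≥0∞) := by exact_mod_cast Nat.le_add_left 1 n
  have hcut (n : ℕ) (x y : E) : cutoff (W' n x y) = cutoff (W x y) := by
    simp only [cutoff, W']
    rcases le_total (W x y) ((n + 1 : ℕ) : ℝ≥0∞) with h | h
    · rw [min_eq_left h]
    · rw [min_eq_right h, if_neg (not_lt.2 (hn1 n)), if_neg (not_lt.2 ((hn1 n).trans h))]
  have hΦ (n : ℕ) : smallKernel μ K (W' n) p (d + q) = smallKernel μ K W p (d + q) := by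
    ext x; simp only [smallKernel, hcut]
  -- Lowering the jump threshold from 1 to 1/4 adds pairs with 1/4 ≤ W < 1. There 1 ≤ (4W)^p and |x
  -- - y| ≤ 1, and since 1 < q the small energy of order d + q pays for the kernel of order d + 1.
  have hX' (n : ℕ) : ∫⁻ x in K, ∫⁻ y in K,
      (if 1 / 4 ≤ W' n x y then (edist x y ^ (d + 1))⁻¹ else 0) ∂μ ∂μ ≠ ⊤ := by
    refine ne_top_of_le_ne_top (ENNReal.add_ne_top.2 ⟨hX,
      ENNReal.mul_ne_top (ENNReal.rpow_ne_top_of_nonneg hp0.le (by simp : (4 : ℝ≥0∞) ≠ ⊤)) hA⟩) ?_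
    have hm : Measurable fun z : E × E ↦
        (if 1 ≤ W z.1 z.2 then (edist z.1 z.2 ^ (d + 1))⁻¹ else 0) :=
      Measurable.ite (measurableSet_le measurable_const hWm) (by fun_prop) measurable_const
    rw [← lintegral_const_mul _ (measurable_smallKernel μ K hW p (d + q)),
      ← lintegral_add_left hm.lintegral_prod_right']
    refine setLIntegral_mono' hKm fun x hx ↦ ?_
    have hcm : Measurable fun y ↦ cutoff (W x y) ^ p / edist x y ^ (d + q) :=
      ((measurable_cutoff.comp hW.measurable.of_uncurry_left).pow_const p).div (by fun_prop)
    have hm' : Measurable fun y ↦ (if 1 ≤ W x y then (edist x y ^ (d + 1))⁻¹ else 0) :=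
      hm.comp (measurable_const.prodMk measurable_id)
    rw [smallKernel, ← lintegral_const_mul _ hcm, ← lintegral_add_left hm']
    refine setLIntegral_mono' hKm fun y hy ↦ ?_
    by_cases h1 : 1 ≤ W x y
    · rw [if_pos h1]
      refine le_trans ?_ le_self_add
      split_ifs
      · exact le_rfl
      · exact zero_le
    · split_ifs with h2
      · have hWlt : cutoff (W x y) = W x y := if_pos (not_le.1 h1)
        have h3 : 1 / 4 ≤ W x y := h2.trans (min_le_left _ _)
        have h4 : (1 : ℝ≥0∞) ≤ 4 * W x y := by
          calc (1 : ℝ≥0∞) = 4 * (1 / 4) := by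
                rw [one_div, ENNReal.mul_inv_cancel (by simp) (by simp)]
            _ ≤ _ := by gcongr
        have h5 : edist x y ≤ 1 := (hK4 x hx y hy).trans (by
          rw [one_div]; exact ENNReal.inv_le_one.2 (by norm_num))
        rw [zero_add, hWlt, ← mul_div_assoc, ← ENNReal.mul_rpow_of_nonneg _ _ hp0.le,
          div_eq_mul_inv]
        calc (edist x y ^ (d + 1))⁻¹ ≤ (edist x y ^ (d + q))⁻¹ :=
              ENNReal.inv_le_inv.2 (ENNReal.rpow_le_rpow_of_exponent_ge h5 (by linarith))
          _ ≤ _ := le_mul_of_one_le_left' (ENNReal.one_le_rpow h4 hp0)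
      · exact zero_le
  have hbound (n : ℕ) := hC (hW' n) (ENNReal.natCast_ne_top (n + 1)) (fun x y ↦ min_le_right _ _)
    (hX' n) (by rw [hΦ]; exact hA)
  simp only [hΦ] at hbound
  set R := ∫⁻ x in K, smallKernel μ K W p (d + q) x ∂μ +
    (∫⁻ x in K, smallKernel μ K W p (d + q) x ∂μ) ^ (p / q)
  have hm (n : ℕ) : Measurable fun z : E × E ↦ W' n z.1 z.2 ^ p / edist z.1 z.2 ^ (d + a) :=
    ((hW' n).measurable.pow_const p).div (by fun_prop)
  have hmW : Measurable fun z : E × E ↦ W z.1 z.2 ^ p / edist z.1 z.2 ^ (d + a) :=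
    (hWm.pow_const p).div (by fun_prop)
  rw [← lintegral_prod (fun z : E × E ↦ W z.1 z.2 ^ p / edist z.1 z.2 ^ (d + a)) hmW.aemeasurable]
  have hsup (z : E × E) : W z.1 z.2 ^ p / edist z.1 z.2 ^ (d + a) =
      ⨆ n, W' n z.1 z.2 ^ p / edist z.1 z.2 ^ (d + a) := by
    have h := (ENNReal.orderIsoRpow p hp0).map_iSup fun n ↦ W' n z.1 z.2
    simp only [ENNReal.orderIsoRpow_apply, W', iSup_min_natCast_succ] at h
    rw [← ENNReal.iSup_div, h]
  simp only [hsup]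
  rw [lintegral_iSup hm]
  · refine iSup_le fun n ↦ ?_
    rw [lintegral_prod _ (hm n).aemeasurable]
    exact (hbound n).trans (mul_le_mul' (by exact_mod_cast le_self_add) le_rfl)
  · intro n n' h z
    refine ENNReal.div_le_div (ENNReal.rpow_le_rpow (min_le_min_left _ ?_) hp0.le) le_rfl
    exact_mod_cast Nat.succ_le_succ h

end LocalTheorem

/-! ### Bi-Lipschitz charts of a Riemannian manifold -/

section ChartBounds

variable {E : Type*} [NormedAddCommGroup E] [NormedSpace ℝ E]
  {H : Type*} [TopologicalSpace H] (I : ModelWithCorners ℝ E H)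
  {M : Type*} [EMetricSpace M] [ChartedSpace H M]
  [RiemannianBundle (fun x : M ↦ TangentSpace I x)]
  [IsManifold I 1 M] [IsContinuousRiemannianBundle E (fun x : M ↦ TangentSpace I x)]

section

attribute [local instance] normedAddCommGroupTangentSpaceVectorSpace
attribute [local instance] normedSpaceTangentSpaceVectorSpace

lemma eventually_enorm_mfderiv_extChartAt_apply_le (x : M) :
    ∃ C : ℝ≥0, ∀ᶠ y in 𝓝 x, ∀ v : TangentSpace I y,
      ‖(show E from mfderiv I 𝓘(ℝ, E) (extChartAt I x) y v)‖ₑ ≤ C * ‖v‖ₑ := by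
  obtain ⟨C, -, hC⟩ := eventually_enorm_mfderiv_extChartAt_lt I x
  refine ⟨C, hC.mono fun y hy v ↦ ?_⟩
  exact (ContinuousLinearMap.le_opENorm _ _).trans (mul_le_mul' hy.le le_rfl)

lemma eventually_enorm_mfderivWithin_symm_extChartAt_apply_le (x : M) :
    ∃ C : ℝ≥0, ∀ᶠ y in 𝓝[range I] (extChartAt I x x), ∀ v : E,
      ‖mfderivWithin 𝓘(ℝ, E) I (extChartAt I x).symm (range I) y v‖ₑ ≤ C * ‖v‖ₑ := by
  obtain ⟨C, -, hC⟩ := eventually_enorm_mfderivWithin_symm_extChartAt_lt I x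
  refine ⟨C, hC.mono fun y hy v ↦ ?_⟩
  exact (ContinuousLinearMap.le_opENorm _ _).trans (mul_le_mul' hy.le le_rfl)

end

variable [IsRiemannianManifold I M]

/-- The extended chart at `x` is Lipschitz near `x`. -/
lemma exists_edist_extChartAt_le (x : M) :
    ∃ C : ℝ≥0, ∃ U ∈ 𝓝 x, ∀ y ∈ U, ∀ z ∈ U,
      edist (extChartAt I x y) (extChartAt I x z) ≤ C * edist y z := by
  obtain ⟨C, hC⟩ := eventually_enorm_mfderiv_extChartAt_apply_le I x
  obtain ⟨ε, hε, hU⟩ := Metric.nhds_basis_eball.mem_iff.1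
    (Filter.inter_mem hC (chart_source_mem_nhds H x))
  -- A curve of length less than 2ε/3 that starts in the ball of radius ε/3 stays in the ball of
  -- radius ε, where the derivative of the chart is controlled.
  have hε3 : ε / 3 ≠ 0 := (ENNReal.div_pos hε.ne' (by simp)).ne'
  have hε3s : ε / 3 + (ε / 3 + ε / 3) = ε := by
    rw [← add_assoc]; exact ENNReal.add_thirds ε
  refine ⟨C, Metric.eball x (ε / 3), Metric.eball_mem_nhds x (pos_iff_ne_zero.2 hε3),
    fun y hy z hz ↦ ?_⟩
  rw [Metric.mem_eball] at hy hz
  have hlt : edist y z < ε / 3 + ε / 3 :=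
    (edist_triangle_right y z x).trans_lt (ENNReal.add_lt_add hy hz)
  have hR : ∀ R ∈ Ioo (edist y z) (ε / 3 + ε / 3),
      edist (extChartAt I x y) (extChartAt I x z) ≤ C * R := by
    rintro R ⟨hR, hR'⟩
    rw [IsRiemannianManifold.out (I := I)] at hR
    obtain ⟨γ, hγy, hγz, hγ, hlen, -, -⟩ :=
      exists_lt_locally_constant_of_riemannianEDist_lt hR zero_lt_one
    have hmem : ∀ t ∈ Icc (0 : ℝ) 1, γ t ∈ Metric.eball x ε := by
      intro t ht
      have h1 : edist y (γ t) < ε / 3 + ε / 3 := by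
        rw [IsRiemannianManifold.out (I := I)]
        calc riemannianEDist I y (γ t) ≤ pathELength I γ 0 t :=
              riemannianEDist_le_pathELength hγ.contMDiffOn hγy rfl ht.1
          _ ≤ pathELength I γ 0 1 := pathELength_mono le_rfl ht.2
          _ < _ := hlen.trans hR'
      rw [Metric.mem_eball, edist_comm, ← hε3s]
      refine (edist_triangle x y (γ t)).trans_lt (ENNReal.add_lt_add ?_ h1)
      rwa [edist_comm]
    have hsrc : ∀ t ∈ Icc (0 : ℝ) 1, γ t ∈ (chartAt H x).source := fun t ht ↦ (hU (hmem t ht)).2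
    let γ' := extChartAt I x ∘ γ
    have hsm : CMDiff[Icc 0 1] 1 γ' :=
      contMDiffOn_extChartAt.comp (I' := I) (t := (chartAt H x).source) hγ.contMDiffOn hsrc
    calc edist (extChartAt I x y) (extChartAt I x z) = ‖γ' 1 - γ' 0‖ₑ := by
          rw [edist_comm, edist_eq_enorm_sub]; simp [γ', hγy, hγz]
      _ ≤ ∫⁻ t in Icc 0 1, ‖derivWithin γ' (Icc 0 1) t‖ₑ :=
          enorm_sub_le_lintegral_derivWithin_Icc_of_contDiffOn_Icc
            (contMDiffOn_iff_contDiffOn.1 hsm) zero_le_one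
      _ ≤ ∫⁻ t in Icc 0 1, C * ‖mfderiv[Icc 0 1] γ t 1‖ₑ := by
          refine setLIntegral_mono' measurableSet_Icc fun t ht ↦ ?_
          have hcomp : mfderiv[Icc 0 1] γ' t =
              (mfderiv% (extChartAt I x) (γ t)) ∘L (mfderiv[Icc 0 1] γ t) := by
            apply mfderiv_comp_mfderivWithin
            · exact mdifferentiableAt_extChartAt (hsrc t ht)
            · exact (hγ.mdifferentiable one_ne_zero).mdifferentiableOn _ ht
            · rw [uniqueMDiffWithinAt_iff_uniqueDiffWithinAt]
              exact uniqueDiffOn_Icc zero_lt_one _ ht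
          have h1 : derivWithin γ' (Icc 0 1) t =
              (mfderiv% (extChartAt I x) (γ t)) (mfderiv[Icc 0 1] γ t 1) := by
            rw [← fderivWithin_derivWithin, ← mfderivWithin_eq_fderivWithin]
            exact congr($hcomp 1)
          rw [h1]
          exact (hU (hmem t ht)).1 _
      _ = C * pathELength I γ 0 1 := by
          rw [lintegral_const_mul' _ _ ENNReal.coe_ne_top,
            pathELength_eq_lintegral_mfderivWithin_Icc]
      _ ≤ C * R := by gcongr
  have hne : (𝓝[>] edist y z).NeBot := nhdsGT_neBot_of_exists_gt ⟨_, hlt⟩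
  refine ge_of_tendsto (x := 𝓝[>] edist y z) (f := fun R : ℝ≥0∞ ↦ (C : ℝ≥0∞) * R)
    (tendsto_nhdsWithin_of_tendsto_nhds
      (ENNReal.Tendsto.const_mul Filter.tendsto_id (Or.inr ENNReal.coe_ne_top)))
    (Filter.eventually_of_mem (Ioo_mem_nhdsGT hlt) hR)

/-- The inverse of the extended chart at `x` is Lipschitz near the image of `x`. -/
lemma exists_edist_le_edist_extChartAt (x : M) :
    ∃ C : ℝ≥0, ∃ r₀ > 0, Metric.ball (extChartAt I x x) r₀ ∩ range I ⊆ (extChartAt I x).target ∧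
      ∀ a ∈ Metric.ball (extChartAt I x x) r₀ ∩ range I,
      ∀ b ∈ Metric.ball (extChartAt I x x) r₀ ∩ range I,
        edist ((extChartAt I x).symm a) ((extChartAt I x).symm b) ≤ C * edist a b := by
  obtain ⟨C, hC⟩ := eventually_enorm_mfderivWithin_symm_extChartAt_apply_le I x
  obtain ⟨r, hr0, hr⟩ := Metric.mem_nhdsWithin_iff.1
    (Filter.inter_mem (extChartAt_target_mem_nhdsWithin (I := I) x) hC)
  refine ⟨C, r, hr0, fun a ha ↦ (hr ha).1, fun a ha b hb ↦ ?_⟩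
  -- The image of a straight segment is an admissible curve; the segment stays in the range of the
  -- model because that range is convex, boundary points included.
  let η := ContinuousAffineMap.lineMap (R := ℝ) a b
  set γ := (extChartAt I x).symm ∘ η
  have hη : ∀ t ∈ Icc (0 : ℝ) 1, η t ∈ Metric.ball (extChartAt I x x) r ∩ range I := by
    have : η '' Icc 0 1 ⊆ Metric.ball (extChartAt I x x) r ∩ range I := by
      simp only [ContinuousAffineMap.coe_lineMap_eq, ← segment_eq_image_lineMap, η]
      exact ((convex_ball _ _).inter I.convex_range).segment_subset ha hb
    exact fun t ht ↦ this ⟨t, ht, rfl⟩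
  have hηt : Icc (0 : ℝ) 1 ⊆ η ⁻¹' (extChartAt I x).target := fun t ht ↦ (hr (hη t ht)).1
  have η_smooth : CMDiff[Icc 0 1] 1 η := by
    apply ContMDiff.contMDiffOn
    rw [contMDiff_iff_contDiff]
    exact ContinuousAffineMap.contDiff _
  rw [IsRiemannianManifold.out (I := I)]
  have hle : riemannianEDist I ((extChartAt I x).symm a) ((extChartAt I x).symm b) ≤
      pathELength I γ 0 1 := by
    apply riemannianEDist_le_pathELength _ _ _ zero_le_one
    · exact (contMDiffOn_extChartAt_symm x).comp η_smooth hηt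
    · simp [γ, η, ContinuousAffineMap.coe_lineMap_eq]
    · simp [γ, η, ContinuousAffineMap.coe_lineMap_eq]
  refine hle.trans ?_
  rw [← lintegral_fderiv_lineMap_eq_edist, pathELength_eq_lintegral_mfderivWithin_Icc,
    ← lintegral_const_mul' _ _ ENNReal.coe_ne_top]
  refine setLIntegral_mono' measurableSet_Icc fun t ht ↦ ?_
  have hcomp : mfderiv[Icc 0 1] γ t =
      (mfderiv[range I] (extChartAt I x).symm (η t)) ∘L (mfderiv[Icc 0 1] η t) := by
    apply mfderivWithin_comp
    · exact mdifferentiableWithinAt_extChartAt_symm (hηt ht)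
    · exact η_smooth.mdifferentiableOn one_ne_zero t ht
    · exact hηt.trans (preimage_mono (extChartAt_target_subset_range x))
    · rw [uniqueMDiffWithinAt_iff_uniqueDiffWithinAt]
      exact uniqueDiffOn_Icc zero_lt_one t ht
  have h1 : mfderiv[Icc 0 1] γ t 1 =
      (mfderiv[range I] (extChartAt I x).symm (η t)) (fderivWithin ℝ η (Icc 0 1) t 1) := by
    rw [← mfderivWithin_eq_fderivWithin]
    exact congr($hcomp 1)
  rw [h1]
  exact (hr (hη t ht)).2 _

end ChartBounds

/-- A bi-Lipschitz parametrization of the open set `U` of `M` by a small convex set `K` with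
comparable measures. -/
structure BilipschitzChart {M E : Type*} [EMetricSpace M] [MeasurableSpace M]
    [NormedAddCommGroup E] [NormedSpace ℝ E] [MeasurableSpace E]
    (ν : Measure M) (μ : Measure E) where
  U : Set M
  K : Set E
  toFun : M → E
  invFun : E → M
  C : ℝ≥0
  C_ne_zero : C ≠ 0
  isOpen_U : IsOpen U
  convex_K : Convex ℝ K
  measurableSet_K : MeasurableSet K
  edist_le_of_mem_K : ∀ a ∈ K, ∀ b ∈ K, edist a b ≤ 1 / 4
  measure_K_ne_zero : μ K ≠ 0
  measurable_toFun : Measurable toFun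
  measurable_invFun : Measurable invFun
  toFun_mem : ∀ x ∈ U, toFun x ∈ K
  invFun_mem : ∀ a ∈ K, invFun a ∈ U
  invFun_toFun : ∀ x ∈ U, invFun (toFun x) = x
  toFun_invFun : ∀ a ∈ K, toFun (invFun a) = a
  edist_toFun_le : ∀ x ∈ U, ∀ y ∈ U, edist (toFun x) (toFun y) ≤ C * edist x y
  edist_invFun_le : ∀ a ∈ K, ∀ b ∈ K, edist (invFun a) (invFun b) ≤ C * edist a b
  restrict_le : ν.restrict U ≤ (C : ℝ≥0∞) • (μ.restrict K).map invFun
  restrict_le' : μ.restrict K ≤ (C : ℝ≥0∞) • (ν.restrict U).map toFun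

lemma euclideanHausdorffMeasure_image_le {X Y : Type*} [EMetricSpace X] [MeasurableSpace X]
    [BorelSpace X] [EMetricSpace Y] [MeasurableSpace Y] [BorelSpace Y] {f : X → Y} {s : Set X}
    {C : ℝ≥0} (h : LipschitzOnWith C f s) (m : ℕ) :
    (μHE[m] : Measure Y) (f '' s) ≤ (C : ℝ≥0∞) ^ m * (μHE[m] : Measure X) s := by
  simp only [Measure.euclideanHausdorffMeasure_def, Measure.smul_apply]
  have h1 := h.hausdorffMeasure_image_le (d := m) (by positivity)
  rw [ENNReal.rpow_natCast] at h1
  calc _ ≤ _ := smul_le_smul_of_nonneg_left h1 zero_le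
    _ = _ := by simp only [ENNReal.smul_def, smul_eq_mul]; ring

open Classical in
/-- Every point has a neighborhood with a bi-Lipschitz parametrization. -/
lemma exists_bilipschitzChart {m : ℕ} {H : Type*} [TopologicalSpace H]
    (I : ModelWithCorners ℝ (EuclideanSpace ℝ (Fin m)) H)
    {M : Type*} [EMetricSpace M] [ChartedSpace H M]
    [RiemannianBundle (fun x : M ↦ TangentSpace I x)] [IsManifold I 1 M]
    [IsContinuousRiemannianBundle (EuclideanSpace ℝ (Fin m)) (fun x : M ↦ TangentSpace I x)]
    [IsRiemannianManifold I M] [MeasurableSpace M] [BorelSpace M] (x : M)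
    {V : Set M} (hV : V ∈ 𝓝 x) :
    ∃ c : BilipschitzChart (μHE[m] : Measure M) (volume : Measure (EuclideanSpace ℝ (Fin m))),
      x ∈ c.U ∧ c.U ⊆ V := by
  obtain ⟨C₁, U₁, hU₁, hC₁⟩ := exists_edist_extChartAt_le I x
  obtain ⟨C₂, r₂, hr₂, htarget, hC₂⟩ := exists_edist_le_edist_extChartAt I x
  set φ := extChartAt I x
  obtain ⟨r₁, hr₁, hball⟩ := Metric.mem_nhds_iff.1
    ((continuousAt_extChartAt_symm (I := I) x).preimage_mem_nhds
      (by simpa using ⟨hU₁, hV⟩ : U₁ ∩ V ∈ 𝓝 _))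
  -- Radius 1/8 ensures the diameter bound 1/4.
  set r := min (min r₁ r₂) (1 / 8)
  have hr : 0 < r := lt_min (lt_min hr₁ hr₂) (by norm_num)
  set K := Metric.ball (φ x) r ∩ range I
  have hK₂ : K ⊆ Metric.ball (φ x) r₂ ∩ range I := inter_subset_inter_left _
    (Metric.ball_subset_ball ((min_le_left _ _).trans (min_le_right _ _)))
  have hK₁ : K ⊆ Metric.ball (φ x) r₁ := inter_subset_left.trans
    (Metric.ball_subset_ball ((min_le_left _ _).trans (min_le_left _ _)))
  have hKt : K ⊆ φ.target := hK₂.trans htarget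
  set U := φ.source ∩ φ ⁻¹' Metric.ball (φ x) r
  have hUo : IsOpen U := (continuousOn_extChartAt x).isOpen_inter_preimage
    (isOpen_extChartAt_source x) Metric.isOpen_ball
  have hKm : MeasurableSet K := Metric.isOpen_ball.measurableSet.inter
    I.isClosed_range.measurableSet
  have hφU : ∀ y ∈ U, φ y ∈ K := fun y hy ↦
    ⟨hy.2, extChartAt_target_subset_range x (φ.map_source hy.1)⟩
  have hψK : ∀ a ∈ K, φ.symm a ∈ U := fun a ha ↦
    ⟨φ.map_target (hKt ha), by rw [mem_preimage, φ.right_inv (hKt ha)]; exact ha.1⟩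
  have hUU : U ⊆ U₁ ∩ V := fun y hy ↦ by
    have := hball (hK₁ (hφU y hy))
    rwa [mem_preimage, φ.left_inv hy.1] at this
  -- At a boundary point K is only part of a ball. Its measure is positive because the range of the
  -- model lies in the closure of its interior.
  have hK0 : (volume : Measure (EuclideanSpace ℝ (Fin m))) K ≠ 0 := by
    have hx : φ x ∈ closure (interior (range I)) := I.range_subset_closure_interior
      (extChartAt_target_subset_range x (φ.map_source (mem_extChartAt_source x)))
    obtain ⟨z, hz⟩ := mem_closure_iff_nhds.1 hx _ (Metric.ball_mem_nhds (φ x) hr)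
    refine (lt_of_lt_of_le ((Metric.isOpen_ball.inter isOpen_interior).measure_pos volume ⟨z, hz⟩)
      (measure_mono (inter_subset_inter_right _ interior_subset))).ne'
  set C : ℝ≥0 := C₁ + C₂ + C₁ ^ m + C₂ ^ m + 1
  have hC : C ≠ 0 := by positivity
  have hCC₁ : (C₁ : ℝ≥0∞) ≤ C := by
    have : C₁ ≤ C := by simp only [C, add_assoc]; exact le_self_add
    exact_mod_cast this
  have hCC₂ : (C₂ : ℝ≥0∞) ≤ C := by
    have : C₂ ≤ C := by
      simp only [C, add_assoc]; exact le_add_of_nonneg_of_le zero_le le_self_add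
    exact_mod_cast this
  have hCm₁ : (C₁ : ℝ≥0∞) ^ m ≤ C := by
    have : C₁ ^ m ≤ C := by
      simp only [C]; rw [add_assoc]
      exact (le_add_of_nonneg_left zero_le).trans le_self_add
    exact_mod_cast this
  have hCm₂ : (C₂ : ℝ≥0∞) ^ m ≤ C := by
    have : C₂ ^ m ≤ C := by
      simp only [C]
      exact (le_add_of_nonneg_left zero_le).trans le_self_add
    exact_mod_cast this
  have hL₁ : ∀ y ∈ U, ∀ z ∈ U, edist (φ y) (φ z) ≤ C₁ * edist y z :=
    fun y hy z hz ↦ hC₁ y (hUU hy).1 z (hUU hz).1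
  have hL₂ : ∀ a ∈ K, ∀ b ∈ K, edist (φ.symm a) (φ.symm b) ≤ C₂ * edist a b :=
    fun a ha b hb ↦ hC₂ a (hK₂ ha) b (hK₂ hb)
  set f : M → EuclideanSpace ℝ (Fin m) := U.piecewise φ fun _ ↦ 0
  set g : EuclideanSpace ℝ (Fin m) → M := K.piecewise φ.symm fun _ ↦ x
  have hf : ∀ y ∈ U, f y = φ y := fun y hy ↦ piecewise_eq_of_mem _ _ _ hy
  have hg : ∀ a ∈ K, g a = φ.symm a := fun a ha ↦ piecewise_eq_of_mem _ _ _ ha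
  have hfm : Measurable f := ContinuousOn.measurable_piecewise
    ((continuousOn_extChartAt x).mono inter_subset_left) continuousOn_const hUo.measurableSet
  have hgm : Measurable g := ContinuousOn.measurable_piecewise
    ((continuousOn_extChartAt_symm x).mono hKt) continuousOn_const hKm
  have hle (s : Set M) : (μHE[m] : Measure M) (s ∩ U) ≤ C * volume (g ⁻¹' s ∩ K) := by
    have himg : s ∩ U ⊆ φ.symm '' (g ⁻¹' s ∩ K) := fun y hy ↦
      ⟨φ y, ⟨by rw [mem_preimage, hg _ (hφU y hy.2), φ.left_inv hy.2.1]; exact hy.1, hφU y hy.2⟩,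
        φ.left_inv hy.2.1⟩
    have hlip : LipschitzOnWith C₂ φ.symm (g ⁻¹' s ∩ K) := fun a ha b hb ↦ hL₂ a ha.2 b hb.2
    calc _ ≤ _ := measure_mono himg
      _ ≤ _ := euclideanHausdorffMeasure_image_le hlip m
      _ ≤ _ := by
        rw [EuclideanSpace.euclideanHausdorffMeasure_eq_volume]
        exact mul_le_mul' hCm₂ le_rfl
  have hle' (s : Set (EuclideanSpace ℝ (Fin m))) :
      volume (s ∩ K) ≤ C * (μHE[m] : Measure M) (f ⁻¹' s ∩ U) := by
    have himg : s ∩ K ⊆ φ '' (f ⁻¹' s ∩ U) := fun a ha ↦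
      ⟨φ.symm a, ⟨by rw [mem_preimage, hf _ (hψK a ha.2), φ.right_inv (hKt ha.2)]; exact ha.1,
        hψK a ha.2⟩, φ.right_inv (hKt ha.2)⟩
    have hlip : LipschitzOnWith C₁ φ (f ⁻¹' s ∩ U) := fun a ha b hb ↦ hL₁ a ha.2 b hb.2
    rw [← EuclideanSpace.euclideanHausdorffMeasure_eq_volume]
    calc _ ≤ _ := measure_mono himg
      _ ≤ _ := euclideanHausdorffMeasure_image_le hlip m
      _ ≤ _ := mul_le_mul' hCm₁ le_rfl
  refine ⟨{ U := U, K := K, toFun := f, invFun := g, C := C, C_ne_zero := hC, isOpen_U := hUo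
            convex_K := (convex_ball _ _).inter I.convex_range
            measurableSet_K := hKm, edist_le_of_mem_K := fun a ha b hb ↦ ?_
            measure_K_ne_zero := hK0, measurable_toFun := hfm, measurable_invFun := hgm
            toFun_mem := fun y hy ↦ by rw [hf y hy]; exact hφU y hy
            invFun_mem := fun a ha ↦ by rw [hg a ha]; exact hψK a ha
            invFun_toFun := fun y hy ↦ by rw [hf y hy, hg _ (hφU y hy), φ.left_inv hy.1]
            toFun_invFun := fun a ha ↦ by rw [hg a ha, hf _ (hψK a ha), φ.right_inv (hKt ha)]
            edist_toFun_le := fun y hy z hz ↦ by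
              rw [hf y hy, hf z hz]; exact (hL₁ y hy z hz).trans (mul_le_mul' hCC₁ le_rfl)
            edist_invFun_le := fun a ha b hb ↦ by
              rw [hg a ha, hg b hb]; exact (hL₂ a ha b hb).trans (mul_le_mul' hCC₂ le_rfl)
            restrict_le := Measure.le_iff.2 fun s hs ↦ ?_
            restrict_le' := Measure.le_iff.2 fun s hs ↦ ?_ }, ?_⟩
  · have h1 : dist a b ≤ 1 / 4 := by
      have ha' := Metric.mem_ball.1 ha.1
      have hb' := Metric.mem_ball.1 hb.1
      have : r ≤ 1 / 8 := min_le_right _ _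
      have := dist_triangle_right a b (φ x)
      linarith
    rw [edist_dist]
    refine (ENNReal.ofReal_le_ofReal h1).trans_eq ?_
    rw [ENNReal.ofReal_div_of_pos (by norm_num)]
    simp
  · rw [Measure.restrict_apply hs, Measure.smul_apply, Measure.map_apply hgm hs,
      Measure.restrict_apply (hgm hs)]
    exact hle s
  · rw [Measure.restrict_apply hs, Measure.smul_apply, Measure.map_apply hfm hs,
      Measure.restrict_apply (hfm hs)]
    exact hle' s
  · exact ⟨⟨mem_extChartAt_source x, Metric.mem_ball_self hr⟩, hUU.trans inter_subset_right⟩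

/-! ### Transfer to chart domains -/

lemma lintegral_lintegral_le_of_le_map {X Y : Type*} [MeasurableSpace X] [MeasurableSpace Y]
    {ν : Measure X} {μ : Measure Y} [SFinite μ] {g : Y → X} (hg : Measurable g) {C : ℝ≥0∞}
    (h : ν ≤ C • μ.map g) {F : X → X → ℝ≥0∞} (hF : Measurable (Function.uncurry F)) :
    ∫⁻ x, ∫⁻ y, F x y ∂ν ∂ν ≤ C ^ 2 * ∫⁻ a, ∫⁻ b, F (g a) (g b) ∂μ ∂μ := by
  have key (f : X → ℝ≥0∞) (hf : Measurable f) : ∫⁻ x, f x ∂ν ≤ C * ∫⁻ a, f (g a) ∂μ := by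
    refine (lintegral_mono' h le_rfl).trans_eq ?_
    rw [lintegral_smul_measure, lintegral_map hf hg, smul_eq_mul]
  have hm : Measurable fun x ↦ ∫⁻ b, F x (g b) ∂μ := by
    have : Measurable fun z : X × Y ↦ F z.1 (g z.2) :=
      hF.comp (measurable_fst.prodMk (hg.comp measurable_snd))
    exact this.lintegral_prod_right'
  calc _ ≤ ∫⁻ x, C * ∫⁻ b, F x (g b) ∂μ ∂ν :=
        lintegral_mono fun x ↦ key _ hF.of_uncurry_left
    _ ≤ C * ∫⁻ a, C * ∫⁻ b, F (g a) (g b) ∂μ ∂μ := key _ (hm.const_mul C)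
    _ = _ := by
        have hm' : Measurable fun a ↦ ∫⁻ b, F (g a) (g b) ∂μ := hm.comp hg
        rw [lintegral_const_mul _ hm', sq, mul_assoc]

lemma ENNReal.div_rpow_le_of_le_mul {a b w C : ℝ≥0∞} {e : ℝ} (he : 0 ≤ e) (hC : C ≠ 0)
    (hC' : C ≠ ⊤) (h : a ≤ C * b) : w / b ^ e ≤ C ^ e * (w / a ^ e) := by
  have h0 : C ^ e ≠ 0 := by simp [ENNReal.rpow_eq_zero_iff, hC, hC']
  have h1 : C ^ e ≠ ⊤ := ENNReal.rpow_ne_top_of_nonneg he hC'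
  calc w / b ^ e = C ^ e * w / (C ^ e * b ^ e) := (ENNReal.mul_div_mul_left _ _ h0 h1).symm
    _ = C ^ e * (w / (C * b) ^ e) := by rw [ENNReal.mul_rpow_of_nonneg _ _ he, mul_div_assoc]
    _ ≤ _ := mul_le_mul' le_rfl (ENNReal.div_le_div_left (ENNReal.rpow_le_rpow h he) _)

section Transfer

open Module

variable {M : Type*} [EMetricSpace M] [MeasurableSpace M] [BorelSpace M]
  [SecondCountableTopology M] {ν : Measure M}
  {E : Type*} [NormedAddCommGroup E] [NormedSpace ℝ E] [MeasurableSpace E] [BorelSpace E]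
  [FiniteDimensional ℝ E] {μ : Measure E} [μ.IsAddHaarMeasure]

namespace BilipschitzChart

variable (c : BilipschitzChart ν μ)

lemma measure_U_ne_zero : ν c.U ≠ 0 := by
  intro h
  have h1 := c.restrict_le' univ
  rw [Measure.restrict_apply_univ, Measure.smul_apply,
    Measure.map_apply c.measurable_toFun MeasurableSet.univ, preimage_univ,
    Measure.restrict_apply_univ, h, smul_zero] at h1
  exact c.measure_K_ne_zero (le_zero_iff.1 h1)

lemma measure_K_ne_top : μ c.K ≠ ⊤ := by
  rcases c.K.eq_empty_or_nonempty with h | ⟨x, hx⟩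
  · simp [h]
  have : c.K ⊆ {y | edist x y ≤ 1 / 4} := fun y hy ↦ c.edist_le_of_mem_K x hx y hy
  have h4 : (1 / 4 : ℝ≥0∞) ≠ ⊤ := ENNReal.div_ne_top (by simp) (by simp)
  exact ne_top_of_le_ne_top (ENNReal.mul_ne_top (ENNReal.rpow_ne_top_of_nonneg (by positivity) h4)
    measure_closedBall_lt_top.ne)
    ((measure_mono this).trans ((measure_edist_le_le μ x _).resolve_right h4))

lemma measure_U_lt_top : ν c.U < ⊤ := by
  have h1 := c.restrict_le univ
  rw [Measure.restrict_apply_univ, Measure.smul_apply,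
    Measure.map_apply c.measurable_invFun MeasurableSet.univ, preimage_univ,
    Measure.restrict_apply_univ] at h1
  exact h1.trans_lt (ENNReal.mul_lt_top ENNReal.coe_lt_top c.measure_K_ne_top.lt_top)

lemma edist_le_of_mem_U {x y : M} (hx : x ∈ c.U) (hy : y ∈ c.U) : edist x y ≤ c.C := by
  have := c.edist_invFun_le _ (c.toFun_mem x hx) _ (c.toFun_mem y hy)
  rw [c.invFun_toFun x hx, c.invFun_toFun y hy] at this
  refine this.trans (mul_le_of_le_one_right' ((c.edist_le_of_mem_K _ (c.toFun_mem x hx) _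
    (c.toFun_mem y hy)).trans ?_))
  rw [one_div]
  exact ENNReal.inv_le_one.2 (by norm_num)

variable [SFinite ν]

lemma lintegral_kernel_le {F : M → M → ℝ≥0∞} (hF : Measurable (Function.uncurry F)) {e : ℝ}
    (he : 0 ≤ e) :
    ∫⁻ x in c.U, ∫⁻ y in c.U, F x y / edist x y ^ e ∂ν ∂ν ≤
      (c.C : ℝ≥0∞) ^ 2 * c.C ^ e *
        ∫⁻ a in c.K, ∫⁻ b in c.K, F (c.invFun a) (c.invFun b) / edist a b ^ e ∂μ ∂μ := by
  have hm : Measurable (Function.uncurry fun x y ↦ F x y / edist x y ^ e) := by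
    refine hF.div ?_
    fun_prop
  refine (lintegral_lintegral_le_of_le_map c.measurable_invFun c.restrict_le hm).trans ?_
  have hCe : (c.C : ℝ≥0∞) ^ e ≠ ⊤ := ENNReal.rpow_ne_top_of_nonneg he ENNReal.coe_ne_top
  rw [mul_assoc, ← lintegral_const_mul' _ _ hCe]
  refine mul_le_mul' le_rfl (setLIntegral_mono' c.measurableSet_K fun a ha ↦ ?_)
  rw [← lintegral_const_mul' _ _ hCe]
  refine setLIntegral_mono' c.measurableSet_K fun b hb ↦ ?_
  refine ENNReal.div_rpow_le_of_le_mul he (by simpa using c.C_ne_zero) ENNReal.coe_ne_top ?_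
  have := c.edist_toFun_le _ (c.invFun_mem a ha) _ (c.invFun_mem b hb)
  rwa [c.toFun_invFun a ha, c.toFun_invFun b hb] at this

lemma lintegral_kernel_invFun_le {F : M → M → ℝ≥0∞} (hF : Measurable (Function.uncurry F)) {e : ℝ}
    (he : 0 ≤ e) :
    ∫⁻ a in c.K, ∫⁻ b in c.K, F (c.invFun a) (c.invFun b) / edist a b ^ e ∂μ ∂μ ≤
      (c.C : ℝ≥0∞) ^ 2 * c.C ^ e * ∫⁻ x in c.U, ∫⁻ y in c.U, F x y / edist x y ^ e ∂ν ∂ν := by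
  have hm : Measurable (Function.uncurry fun a b : E ↦
      F (c.invFun a) (c.invFun b) / edist a b ^ e) := by
    refine Measurable.div (hF.comp ((c.measurable_invFun.comp measurable_fst).prodMk
      (c.measurable_invFun.comp measurable_snd))) ?_
    fun_prop
  refine (lintegral_lintegral_le_of_le_map c.measurable_toFun c.restrict_le' hm).trans ?_
  have hCe : (c.C : ℝ≥0∞) ^ e ≠ ⊤ := ENNReal.rpow_ne_top_of_nonneg he ENNReal.coe_ne_top
  rw [mul_assoc, ← lintegral_const_mul' _ _ hCe]
  have hUm := c.isOpen_U.measurableSet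
  refine mul_le_mul' le_rfl (setLIntegral_mono' hUm fun x hx ↦ ?_)
  rw [← lintegral_const_mul' _ _ hCe]
  refine setLIntegral_mono' hUm fun y hy ↦ ?_
  rw [c.invFun_toFun x hx, c.invFun_toFun y hy]
  refine ENNReal.div_rpow_le_of_le_mul he (by simpa using c.C_ne_zero) ENNReal.coe_ne_top ?_
  have := c.edist_invFun_le _ (c.toFun_mem x hx) _ (c.toFun_mem y hy)
  rwa [c.invFun_toFun x hx, c.invFun_toFun y hy] at this

/-- The local estimate in the domain of a chart. -/
lemma exists_lintegral_kernel_le {p q : ℝ} (hq : 1 < q) (hqp : q < p)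
    (hqd : q < finrank ℝ E) (ha : 0 < p - p * finrank ℝ E / q + finrank ℝ E) :
    ∃ C : ℝ≥0, ∀ {W : M → M → ℝ≥0∞}, IsMeasurablePseudoDist W →
      ∫⁻ x, ∫⁻ y, (if 1 ≤ W x y then 1 else 0) / edist x y ^ (finrank ℝ E + 1 : ℝ) ∂ν ∂ν ≠ ⊤ →
      ∫⁻ x in c.U, ∫⁻ y in c.U,
        W x y ^ p / edist x y ^ (finrank ℝ E + (p - p * finrank ℝ E / q + finrank ℝ E)) ∂ν ∂ν ≤
      C * (∫⁻ x, ∫⁻ y, cutoff (W x y) ^ p / edist x y ^ (finrank ℝ E + q) ∂ν ∂ν +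
        (∫⁻ x, ∫⁻ y, cutoff (W x y) ^ p / edist x y ^ (finrank ℝ E + q) ∂ν ∂ν) ^ (p / q)) := by
  obtain ⟨C, hC⟩ := _root_.lintegral_kernel_le μ hq hqp hqd ha c.measurableSet_K c.convex_K
    c.edist_le_of_mem_K c.measure_K_ne_zero
  set d : ℝ := (finrank ℝ E : ℝ)
  set e : ℝ := d + (p - p * d / q + d)
  have hd : 0 ≤ d := by positivity
  have he : 0 ≤ e := by positivity
  have hpq : 0 ≤ p / q := by have : 0 < p := by linarith
                             positivity
  have hD1 (e : ℝ) (he : 0 ≤ e) : (c.C : ℝ≥0∞) ^ 2 * c.C ^ e ≠ ⊤ := ENNReal.mul_ne_top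
    (ENNReal.pow_ne_top ENNReal.coe_ne_top) (ENNReal.rpow_ne_top_of_nonneg he ENNReal.coe_ne_top)
  set D := (c.C : ℝ≥0∞) ^ 2 * c.C ^ e
  set D' := (c.C : ℝ≥0∞) ^ 2 * c.C ^ (d + q)
  have hD' : D' ≠ ⊤ := hD1 _ (by positivity)
  have hB : D * (C * (D' + D' ^ (p / q))) ≠ ⊤ := ENNReal.mul_ne_top (hD1 e he)
    (ENNReal.mul_ne_top ENNReal.coe_ne_top (ENNReal.add_ne_top.2
      ⟨hD', ENNReal.rpow_ne_top_of_nonneg hpq hD'⟩))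
  refine ⟨(D * (C * (D' + D' ^ (p / q)))).toNNReal, fun {W} hW hX ↦ ?_⟩
  rw [ENNReal.coe_toNNReal hB]
  have hWm : Measurable fun z : M × M ↦ W z.1 z.2 := hW.measurable
  set W' : E → E → ℝ≥0∞ := fun a b ↦ W (c.invFun a) (c.invFun b)
  have hW' : IsMeasurablePseudoDist W' :=
    ⟨fun _ ↦ hW.self _, fun _ _ ↦ hW.comm _ _, fun _ _ _ ↦ hW.triangle _ _ _,
      hW.measurable.comp ((c.measurable_invFun.comp measurable_fst).prodMk
        (c.measurable_invFun.comp measurable_snd))⟩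
  have hsub (F : M → M → ℝ≥0∞) : ∫⁻ x in c.U, ∫⁻ y in c.U, F x y ∂ν ∂ν ≤ ∫⁻ x, ∫⁻ y, F x y ∂ν ∂ν :=
    (setLIntegral_le_lintegral _ _).trans (lintegral_mono fun x ↦ setLIntegral_le_lintegral _ _)
  have hX' : ∫⁻ a in c.K, ∫⁻ b in c.K,
      (if 1 ≤ W' a b then (edist a b ^ (d + 1))⁻¹ else 0) ∂μ ∂μ ≠ ⊤ := by
    have hm : Measurable (Function.uncurry fun x y ↦ (if 1 ≤ W x y then (1 : ℝ≥0∞) else 0)) :=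
      Measurable.ite (measurableSet_le measurable_const hWm) measurable_const measurable_const
    have h := (c.lintegral_kernel_invFun_le hm (e := d + 1) (by positivity)).trans
      (mul_le_mul' le_rfl (hsub _))
    refine ne_top_of_le_ne_top (ENNReal.mul_ne_top (hD1 _ (by positivity)) hX) (le_trans ?_ h)
    refine le_of_eq (lintegral_congr fun a ↦ lintegral_congr fun b ↦ ?_)
    simp only [W']
    split_ifs <;> simp
  have hcm : Measurable (Function.uncurry fun x y ↦ cutoff (W x y) ^ p) :=
    (measurable_cutoff.comp hWm).pow_const p
  set A := ∫⁻ x, ∫⁻ y, cutoff (W x y) ^ p / edist x y ^ (d + q) ∂ν ∂ν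
  have hA : ∫⁻ a in c.K, smallKernel μ c.K W' p (d + q) a ∂μ ≤ D' * A :=
    (c.lintegral_kernel_invFun_le hcm (by positivity)).trans (mul_le_mul' le_rfl (hsub _))
  have hpm : Measurable (Function.uncurry fun x y ↦ W x y ^ p) := hWm.pow_const p
  calc _ ≤ D * ∫⁻ a in c.K, ∫⁻ b in c.K, W' a b ^ p / edist a b ^ e ∂μ ∂μ :=
        c.lintegral_kernel_le hpm he
    _ ≤ D * (C * (D' * A + (D' * A) ^ (p / q))) := by
        refine mul_le_mul' le_rfl ((hC hW' hX').trans (mul_le_mul' le_rfl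
          (add_le_add hA (ENNReal.rpow_le_rpow hA hpq))))
    _ = D * (C * (D' * A + D' ^ (p / q) * A ^ (p / q))) := by
        rw [ENNReal.mul_rpow_of_nonneg _ _ hpq]
    _ ≤ D * (C * ((D' + D' ^ (p / q)) * A + (D' + D' ^ (p / q)) * A ^ (p / q))) := by
        gcongr
        · exact le_self_add
        · exact le_add_self
    _ = _ := by ring

end BilipschitzChart

end Transfer

/-! ### From charts to the compact manifold -/

section Global

open Module Relation

variable {M : Type*} [EMetricSpace M] [MeasurableSpace M] [BorelSpace M]
  [SecondCountableTopology M] {ν : Measure M} [SFinite ν]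

/-- The inequality W(x, y)^p ≤ 2^(p-1) (W(x, z)^p + W(z, y)^p), integrated over an intermediate
point z in O. It compares the oscillation between two sets with oscillations through a third one. -/
lemma measure_mul_lintegral_rpow_le {p : ℝ} (hp : 1 < p) {W : M → M → ℝ≥0∞}
    (hW : IsMeasurablePseudoDist W) (A B O : Set M) :
    ν O * ∫⁻ x in A, ∫⁻ y in B, W x y ^ p ∂ν ∂ν ≤
      2 ^ (p - 1) * (ν B * (∫⁻ x in A, ∫⁻ y in O, W x y ^ p ∂ν ∂ν) +
        ν A * ∫⁻ x in O, ∫⁻ y in B, W x y ^ p ∂ν ∂ν) := by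
  have hm : Measurable fun z : M × M ↦ W z.1 z.2 ^ p := hW.measurable.pow_const p
  have hmx (x : M) : Measurable fun y ↦ W x y ^ p := hm.comp (measurable_const.prodMk measurable_id)
  have hmy (y : M) : Measurable fun x ↦ W x y ^ p := hm.comp (measurable_id.prodMk measurable_const)
  have hmB : Measurable fun x ↦ ∫⁻ y in B, W x y ^ p ∂ν := hm.lintegral_prod_right'
  have hmO : Measurable fun x ↦ ∫⁻ z in O, W x z ^ p ∂ν := hm.lintegral_prod_right'
  have hmO' : Measurable fun y ↦ ∫⁻ z in O, W z y ^ p ∂ν :=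
    (hm.comp measurable_swap).lintegral_prod_right'
  have h1 (x y : M) : ν O * W x y ^ p ≤
      2 ^ (p - 1) * (∫⁻ z in O, W x z ^ p ∂ν + ∫⁻ z in O, W z y ^ p ∂ν) := by
    rw [← lintegral_add_left (hmx x), ← lintegral_const_mul' _ _ (ENNReal.two_rpow_ne_top _),
      mul_comm, ← setLIntegral_const]
    refine lintegral_mono fun z ↦ ?_
    exact (ENNReal.rpow_le_rpow (hW.triangle x z y) (by linarith)).trans
      (ENNReal.rpow_add_le_mul_rpow_add_rpow _ _ hp.le)
  have h2 (x : M) : ν O * ∫⁻ y in B, W x y ^ p ∂ν ≤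
      2 ^ (p - 1) * (ν B * ∫⁻ z in O, W x z ^ p ∂ν + ∫⁻ z in O, ∫⁻ y in B, W z y ^ p ∂ν ∂ν) := by
    rw [← lintegral_const_mul _ (hmx x), mul_comm (ν B), ← setLIntegral_const,
      lintegral_lintegral_swap (μ := ν.restrict O) (f := fun z y ↦ W z y ^ p) hm.aemeasurable,
      ← lintegral_add_left measurable_const,
      ← lintegral_const_mul' _ _ (ENNReal.two_rpow_ne_top _)]
    exact lintegral_mono fun y ↦ h1 x y
  rw [← lintegral_const_mul _ hmB]
  refine (lintegral_mono h2).trans_eq ?_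
  rw [lintegral_const_mul' _ _ (ENNReal.two_rpow_ne_top _),
    lintegral_add_left (hmO.const_mul _), lintegral_const_mul _ hmO, setLIntegral_const,
    mul_comm (ν A)]

lemma ENNReal.le_inv_mul_of_mul_le {a b c : ℝ≥0∞} (h0 : a ≠ 0) (ht : a ≠ ⊤) (h : a * b ≤ c) :
    b ≤ a⁻¹ * c := by
  calc b = a⁻¹ * (a * b) := by rw [← mul_assoc, ENNReal.inv_mul_cancel h0 ht, one_mul]
    _ ≤ _ := by gcongr

/-- The `L ^ p` oscillation between two sets of a chain is controlled by the oscillations on the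
sets of the chain. -/
lemma exists_lintegral_rpow_le_sum {ι : Type*} [Fintype ι] {U : ι → Set M}
    (hU : ∀ i, IsOpen (U i)) (hUt : ∀ i, ν (U i) ≠ ⊤)
    (hν : ∀ O : Set M, IsOpen O → O.Nonempty → ν O ≠ 0) {p : ℝ} (hp : 1 < p) {i j : ι}
    (hij : ReflTransGen (fun i j ↦ (U i ∩ U j).Nonempty) i j) :
    ∃ C : ℝ≥0, ∀ W : M → M → ℝ≥0∞, IsMeasurablePseudoDist W →
      ∫⁻ x in U i, ∫⁻ y in U j, W x y ^ p ∂ν ∂ν ≤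
        C * ∑ l, ∫⁻ x in U l, ∫⁻ y in U l, W x y ^ p ∂ν ∂ν := by
  induction hij with
  | refl =>
    refine ⟨1, fun W hW ↦ ?_⟩
    rw [ENNReal.coe_one, one_mul]
    exact Finset.single_le_sum (f := fun l ↦ ∫⁻ x in U l, ∫⁻ y in U l, W x y ^ p ∂ν ∂ν)
      (fun _ _ ↦ zero_le) (Finset.mem_univ i)
  | @tail j k _ hjk ih =>
    obtain ⟨C, hC⟩ := ih
    set O := U j ∩ U k
    have hO : IsOpen O := (hU j).inter (hU k)
    have hO0 := hν O hO hjk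
    have hOt : ν O ≠ ⊤ := ne_top_of_le_ne_top (hUt j) (measure_mono inter_subset_left)
    have hj0 := hν (U j) (hU j) (hjk.mono inter_subset_left)
    set D : ℝ≥0∞ := (ν O)⁻¹ * (2 ^ (p - 1) * (ν (U k) + ν (U j)))
    set D' : ℝ≥0∞ := (ν (U j))⁻¹ * (2 ^ (p - 1) * (ν (U k) * C + ν (U i) * D))
    have hD : D ≠ ⊤ := ENNReal.mul_ne_top (ENNReal.inv_ne_top.2 hO0) (ENNReal.mul_ne_top
      (ENNReal.two_rpow_ne_top _) (ENNReal.add_ne_top.2 ⟨hUt k, hUt j⟩))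
    have hD' : D' ≠ ⊤ := ENNReal.mul_ne_top (ENNReal.inv_ne_top.2 hj0) (ENNReal.mul_ne_top
      (ENNReal.two_rpow_ne_top _) (ENNReal.add_ne_top.2
        ⟨ENNReal.mul_ne_top (hUt k) ENNReal.coe_ne_top, ENNReal.mul_ne_top (hUt i) hD⟩))
    refine ⟨D'.toNNReal, fun W hW ↦ ?_⟩
    rw [ENNReal.coe_toNNReal hD']
    set V := ∑ l, ∫⁻ x in U l, ∫⁻ y in U l, W x y ^ p ∂ν ∂ν
    have hV (l : ι) : ∫⁻ x in U l, ∫⁻ y in U l, W x y ^ p ∂ν ∂ν ≤ V :=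
      Finset.single_le_sum (f := fun l ↦ ∫⁻ x in U l, ∫⁻ y in U l, W x y ^ p ∂ν ∂ν)
        (fun _ _ ↦ zero_le) (Finset.mem_univ l)
    -- Passage from one set of the chain to the next through their overlap, which has positive
    -- measure.
    have hjk' : ∫⁻ x in U j, ∫⁻ y in U k, W x y ^ p ∂ν ∂ν ≤ D * V := by
      have h1 : ∫⁻ x in U j, ∫⁻ y in O, W x y ^ p ∂ν ∂ν ≤ V :=
        (lintegral_mono fun x ↦ lintegral_mono_set inter_subset_left).trans (hV j)
      have h2 : ∫⁻ x in O, ∫⁻ y in U k, W x y ^ p ∂ν ∂ν ≤ V :=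
        (lintegral_mono_set inter_subset_right).trans (hV k)
      have h := ENNReal.le_inv_mul_of_mul_le hO0 hOt
        (measure_mul_lintegral_rpow_le (ν := ν) hp hW (U j) (U k) O)
      calc _ ≤ _ := h
        _ ≤ (ν O)⁻¹ * (2 ^ (p - 1) * (ν (U k) * V + ν (U j) * V)) := by gcongr
        _ = _ := by simp only [D]; ring
    -- Passage from the first set to the new one through the previous set of the chain.
    have h := ENNReal.le_inv_mul_of_mul_le hj0 (hUt j)
      (measure_mul_lintegral_rpow_le (ν := ν) hp hW (U i) (U k) (U j))
    calc _ ≤ _ := h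
      _ ≤ (ν (U j))⁻¹ * (2 ^ (p - 1) * (ν (U k) * (C * V) + ν (U i) * (D * V))) := by
          gcongr
          exact hC W hW
      _ = _ := by simp only [D']; ring

/-- The union of the sets reachable from i is clopen: its complement is the union of the unreachable
ones, since an unreachable set cannot meet a reachable one. -/
lemma exists_reflTransGen_of_mem_connectedComponent {X ι : Type*} [TopologicalSpace X]
    {U : ι → Set X} (hU : ∀ i, IsOpen (U i)) (hcover : ⋃ i, U i = univ) {x y : X}
    (hxy : y ∈ connectedComponent x) :
    ∃ i j, x ∈ U i ∧ y ∈ U j ∧ ReflTransGen (fun i j ↦ (U i ∩ U j).Nonempty) i j := by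
  have hmem (z : X) : ∃ i, z ∈ U i := by
    have : z ∈ ⋃ i, U i := hcover ▸ mem_univ z
    simpa using this
  obtain ⟨i, hi⟩ := hmem x
  set R := ReflTransGen (fun i j ↦ (U i ∩ U j).Nonempty) i
  set A := ⋃ (j : ι) (_ : R j), U j
  have hA : IsOpen A := isOpen_iUnion fun j ↦ isOpen_iUnion fun _ ↦ hU j
  have hAc : Aᶜ = ⋃ (j : ι) (_ : ¬ R j), U j := by
    ext z
    simp only [A, mem_compl_iff, mem_iUnion, exists_prop, not_exists, not_and]
    constructor
    · intro h
      obtain ⟨j, hj⟩ := hmem z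
      exact ⟨j, fun hR ↦ h j hR hj, hj⟩
    · rintro ⟨j, hj, hz⟩ k hk hzk
      exact hj (hk.tail ⟨z, hzk, hz⟩)
  have hclopen : IsClopen A := ⟨⟨by
    rw [hAc]; exact isOpen_iUnion fun j ↦ isOpen_iUnion fun _ ↦ hU j⟩, hA⟩
  have hxA : x ∈ A := mem_iUnion₂.2 ⟨i, ReflTransGen.refl, hi⟩
  obtain ⟨j, hj, hy⟩ := mem_iUnion₂.1 (hclopen.connectedComponent_subset hxA hxy)
  exact ⟨i, j, hi, hy, hj⟩

variable [CompactSpace M]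
  {E : Type*} [NormedAddCommGroup E] [NormedSpace ℝ E] [MeasurableSpace E] [BorelSpace E]
  [FiniteDimensional ℝ E] {μ : Measure E} [μ.IsAddHaarMeasure]

open Classical in
/-- The global estimate for pseudo-distances on a compact space with bi-Lipschitz charts. -/
lemma exists_lintegral_kernel_le_of_charts
    (hchart : ∀ (x : M), ∀ V ∈ 𝓝 x, ∃ c : BilipschitzChart ν μ, x ∈ c.U ∧ c.U ⊆ V)
    (hconn : ∀ x y : M, edist x y ≠ ⊤ → y ∈ connectedComponent x)
    {p q : ℝ} (hq : 1 < q) (hqp : q < p)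
    (hqd : q < finrank ℝ E) (ha : 0 < p - p * finrank ℝ E / q + finrank ℝ E) :
    ∃ C : ℝ≥0, ∀ {W : M → M → ℝ≥0∞}, IsMeasurablePseudoDist W →
      ∫⁻ x, ∫⁻ y, (if 1 ≤ W x y then 1 else 0) / edist x y ^ (finrank ℝ E + 1 : ℝ) ∂ν ∂ν ≠ ⊤ →
      ∫⁻ x, ∫⁻ y,
        W x y ^ p / edist x y ^ (finrank ℝ E + (p - p * finrank ℝ E / q + finrank ℝ E)) ∂ν ∂ν ≤
      C * (∫⁻ x, ∫⁻ y, cutoff (W x y) ^ p / edist x y ^ (finrank ℝ E + q) ∂ν ∂ν +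
        (∫⁻ x, ∫⁻ y, cutoff (W x y) ^ p / edist x y ^ (finrank ℝ E + q) ∂ν ∂ν) ^ (p / q)) := by
  have hp : 1 < p := hq.trans hqp
  have hp0 : 0 < p := by linarith
  choose c hcx _ using fun x ↦ hchart x univ Filter.univ_mem
  obtain ⟨t, ht⟩ := isCompact_univ.elim_finite_subcover (fun x ↦ (c x).U)
    (fun x ↦ (c x).isOpen_U) (fun x _ ↦ mem_iUnion.2 ⟨x, hcx x⟩)
  set U : t → Set M := fun i ↦ (c i).U
  have hU (i : t) : IsOpen (U i) := (c i).isOpen_U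
  have hUm (i : t) : MeasurableSet (U i) := (hU i).measurableSet
  have hcover : ⋃ i, U i = univ := by
    refine univ_subset_iff.1 (ht.trans ?_)
    simp [U, iUnion_subtype]
  have hν : ∀ O : Set M, IsOpen O → O.Nonempty → ν O ≠ 0 := by
    rintro O hO ⟨x, hx⟩ h
    obtain ⟨c', -, hc'⟩ := hchart x O (hO.mem_nhds hx)
    exact c'.measure_U_ne_zero (measure_mono_null hc' h)
  -- Points closer than the Lebesgue number share a chart; beyond it the kernel is bounded, so only
  -- the plain L^p oscillation matters.
  obtain ⟨δ, hδ, hleb⟩ := lebesgue_number_lemma_of_emetric isCompact_univ hU hcover.ge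
  set R : t → t → Prop := ReflTransGen (fun i j ↦ (U i ∩ U j).Nonempty)
  have hR : ∀ ij : {ij : t × t // R ij.1 ij.2}, ∃ C : ℝ≥0, ∀ W : M → M → ℝ≥0∞,
      IsMeasurablePseudoDist W → ∫⁻ x in U ij.1.1, ∫⁻ y in U ij.1.2, W x y ^ p ∂ν ∂ν ≤
        C * ∑ l, ∫⁻ x in U l, ∫⁻ y in U l, W x y ^ p ∂ν ∂ν := fun ij ↦
    exists_lintegral_rpow_le_sum hU (fun i ↦ (c i).measure_U_lt_top.ne) hν hp ij.2
  choose C₁ hC₁ using hR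
  choose C₂ hC₂ using fun i : t ↦ (c i).exists_lintegral_kernel_le (ν := ν) (μ := μ) hq hqp hqd ha
  set d : ℝ := (finrank ℝ E : ℝ)
  set e : ℝ := d + (p - p * d / q + d)
  have hd : 0 ≤ d := by positivity
  have he : 0 < e := by positivity
  set D₁ : ℝ≥0∞ := ∑ i, (C₂ i : ℝ≥0∞)
  set D₂ : ℝ≥0∞ := ∑ i : t, ((c i).C : ℝ≥0∞) ^ e * C₂ i
  set D₃ : ℝ≥0∞ := ∑ ij, (C₁ ij : ℝ≥0∞)
  have hD₁ : D₁ ≠ ⊤ := by simp [D₁]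
  have hD₂ : D₂ ≠ ⊤ := by
    refine (ENNReal.sum_lt_top.2 fun i _ ↦ ?_).ne
    exact ENNReal.mul_lt_top (ENNReal.rpow_lt_top_of_nonneg he.le ENNReal.coe_ne_top)
      ENNReal.coe_lt_top
  have hD₃ : D₃ ≠ ⊤ := by simp [D₃]
  set δ' : ℝ≥0∞ := (δ ^ e)⁻¹
  have hδ' : δ' ≠ ⊤ := by
    refine ENNReal.inv_ne_top.2 ?_
    simp [ENNReal.rpow_eq_zero_iff, hδ.ne', he.le]
  have hD : D₁ + δ' * (D₃ * D₂) ≠ ⊤ := ENNReal.add_ne_top.2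
    ⟨hD₁, ENNReal.mul_ne_top hδ' (ENNReal.mul_ne_top hD₃ hD₂)⟩
  refine ⟨(D₁ + δ' * (D₃ * D₂)).toNNReal, fun {W} hW hX ↦ ?_⟩
  rw [ENNReal.coe_toNNReal hD]
  set T := ∫⁻ x, ∫⁻ y, cutoff (W x y) ^ p / edist x y ^ (d + q) ∂ν ∂ν +
    (∫⁻ x, ∫⁻ y, cutoff (W x y) ^ p / edist x y ^ (d + q) ∂ν ∂ν) ^ (p / q)
  have hWm : Measurable fun z : M × M ↦ W z.1 z.2 := hW.measurable
  set F : M × M → ℝ≥0∞ := fun z ↦ W z.1 z.2 ^ p / edist z.1 z.2 ^ e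
  have hF : Measurable F := (hWm.pow_const p).div (by fun_prop)
  have hpm : Measurable fun z : M × M ↦ W z.1 z.2 ^ p := hWm.pow_const p
  have hL (i : t) : ∫⁻ x in U i, ∫⁻ y in U i, W x y ^ p / edist x y ^ e ∂ν ∂ν ≤ C₂ i * T :=
    hC₂ i hW hX
  -- Distances in a chart are bounded, so its local singular energy controls its L^p oscillation.
  have hS (i : t) : ∫⁻ x in U i, ∫⁻ y in U i, W x y ^ p ∂ν ∂ν ≤
      ((c i).C : ℝ≥0∞) ^ e * C₂ i * T := by
    have hCe : ((c i).C : ℝ≥0∞) ^ e ≠ ⊤ :=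
      ENNReal.rpow_ne_top_of_nonneg he.le ENNReal.coe_ne_top
    rw [mul_assoc]
    refine le_trans ?_ (mul_le_mul' le_rfl (hL i))
    rw [← lintegral_const_mul' _ _ hCe]
    refine setLIntegral_mono' (hUm i) fun x hx ↦ ?_
    rw [← lintegral_const_mul' _ _ hCe]
    refine setLIntegral_mono' (hUm i) fun y hy ↦ ?_
    have hle := (c i).edist_le_of_mem_U hx hy
    rcases eq_or_ne x y with rfl | hxy
    · rw [hW.self, ENNReal.zero_rpow_of_pos hp0]; exact zero_le
    have h0 : edist x y ^ e ≠ 0 := by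
      simp [ENNReal.rpow_eq_zero_iff, hxy, he.le]
    have h1 : edist x y ^ e ≠ ⊤ := ENNReal.rpow_ne_top_of_nonneg he.le
      (ne_top_of_le_ne_top ENNReal.coe_ne_top hle)
    calc W x y ^ p = edist x y ^ e * (W x y ^ p / edist x y ^ e) :=
          (ENNReal.mul_div_cancel h0 h1).symm
      _ ≤ _ := mul_le_mul' (ENNReal.rpow_le_rpow hle he.le) le_rfl
  have hV : ∑ l, ∫⁻ x in U l, ∫⁻ y in U l, W x y ^ p ∂ν ∂ν ≤ D₂ * T := by
    rw [Finset.sum_mul]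
    exact Finset.sum_le_sum fun i _ ↦ hS i
  set far : {ij : t × t // R ij.1 ij.2} → Set (M × M) :=
    fun ij ↦ U ij.1.1 ×ˢ U ij.1.2 ∩ {z | δ ≤ edist z.1 z.2}
  set infin : Set (M × M) := {z | edist z.1 z.2 = ⊤}
  have hinfin : MeasurableSet infin := measurableSet_eq_fun (by fun_prop) measurable_const
  -- Three kinds of pairs: those in a common chart, those at finite distance at least δ (joined by a
  -- chain of charts), and those at infinite distance, where the quotient is 0.
  have hcov : (⋃ i : t, U i ×ˢ U i) ∪ ((⋃ ij, far ij) ∪ infin) = univ := by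
    refine eq_univ_of_forall fun ⟨x, y⟩ ↦ ?_
    rcases lt_or_ge (edist x y) δ with h | h
    · obtain ⟨i, hi⟩ := hleb x (mem_univ x)
      refine Or.inl (mem_iUnion.2 ⟨i, hi (Metric.mem_eball_self hδ), hi ?_⟩)
      rwa [Metric.mem_eball, edist_comm]
    · by_cases h' : edist x y = ⊤
      · exact Or.inr (Or.inr h')
      · obtain ⟨i, j, hx, hy, hij⟩ :=
          exists_reflTransGen_of_mem_connectedComponent hU hcover (hconn x y h')
        exact Or.inr (Or.inl (mem_iUnion.2 ⟨⟨(i, j), hij⟩, ⟨hx, hy⟩, h⟩))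
  have hprod (i j : t) (G : M × M → ℝ≥0∞) (hG : Measurable G) :
      ∫⁻ z in U i ×ˢ U j, G z ∂ν.prod ν = ∫⁻ x in U i, ∫⁻ y in U j, G (x, y) ∂ν ∂ν := by
    rw [← Measure.prod_restrict, lintegral_prod _ hG.aemeasurable]
  have hfar (ij : {ij : t × t // R ij.1 ij.2}) :
      ∫⁻ z in far ij, F z ∂ν.prod ν ≤ δ' * (C₁ ij * (D₂ * T)) := by
    calc _ ≤ ∫⁻ z in far ij, δ' * W z.1 z.2 ^ p ∂ν.prod ν := by
          refine setLIntegral_mono' (((hUm _).prod (hUm _)).inter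
            (measurableSet_le measurable_const (by fun_prop))) fun z hz ↦ ?_
          rw [mul_comm]
          exact ENNReal.div_le_div_left (ENNReal.rpow_le_rpow hz.2 he.le) _
      _ ≤ ∫⁻ z in U ij.1.1 ×ˢ U ij.1.2, δ' * W z.1 z.2 ^ p ∂ν.prod ν :=
          lintegral_mono_set inter_subset_left
      _ = δ' * ∫⁻ x in U ij.1.1, ∫⁻ y in U ij.1.2, W x y ^ p ∂ν ∂ν := by
          rw [lintegral_const_mul' _ _ hδ', hprod _ _ (fun z ↦ W z.1 z.2 ^ p) hpm]
      _ ≤ _ := mul_le_mul' le_rfl ((hC₁ ij W hW).trans (mul_le_mul' le_rfl hV))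
  calc ∫⁻ x, ∫⁻ y, W x y ^ p / edist x y ^ e ∂ν ∂ν = ∫⁻ z, F z ∂ν.prod ν :=
        (lintegral_prod F hF.aemeasurable).symm
    _ ≤ (∫⁻ z in ⋃ i : t, U i ×ˢ U i, F z ∂ν.prod ν) +
        (∫⁻ z in ⋃ ij, far ij, F z ∂ν.prod ν + ∫⁻ z in infin, F z ∂ν.prod ν) := by
        rw [← setLIntegral_univ, ← hcov]
        exact (lintegral_union_le _ _ _).trans (add_le_add le_rfl (lintegral_union_le _ _ _))
    _ ≤ ∑ i, C₂ i * T + (∑ ij, δ' * (C₁ ij * (D₂ * T)) + 0) := by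
        refine add_le_add ?_ (add_le_add ?_ (le_of_eq ?_))
        · refine (lintegral_iUnion_le _ _).trans ?_
          rw [tsum_fintype]
          refine Finset.sum_le_sum fun i _ ↦ ?_
          rw [hprod i i F hF]
          exact hL i
        · refine (lintegral_iUnion_le _ _).trans ?_
          rw [tsum_fintype]
          exact Finset.sum_le_sum fun ij _ ↦ hfar ij
        · refine (setLIntegral_congr_fun hinfin fun z hz ↦ ?_).trans lintegral_zero
          have hz : edist z.1 z.2 = ⊤ := hz
          simp only [F, hz, ENNReal.top_rpow_of_pos he, ENNReal.div_top]
    _ = _ := by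
        rw [← Finset.sum_mul, ← Finset.mul_sum, ← Finset.sum_mul, add_zero]
        ring

end Global

/-! ### Riemannian coverings below the injectivity radius -/

/-- Two paths with the same endpoints in a set that is parametrized by a convex set are
homotopic. -/
lemma homotopicRel_of_convex {X V : Type*} [TopologicalSpace X] [NormedAddCommGroup V]
    [NormedSpace ℝ V] {e : V → X} {g : X → V} {S : Set V} {B : Set X} (hS : Convex ℝ S)
    (he : ContinuousOn e S) (hg : ContinuousOn g B) (hgB : MapsTo g B S) (heg : ∀ y ∈ B, e (g y) = y)
    {γ₀ γ₁ : C(unitInterval, X)} (h₀ : ∀ t, γ₀ t ∈ B) (h₁ : ∀ t, γ₁ t ∈ B) (hz : γ₀ 0 = γ₁ 0)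
    (ho : γ₀ 1 = γ₁ 1) : γ₀.HomotopicRel γ₁ {0, 1} := by
  have hc₀ : Continuous fun t ↦ g (γ₀ t) := hg.comp_continuous γ₀.continuous h₀
  have hc₁ : Continuous fun t ↦ g (γ₁ t) := hg.comp_continuous γ₁.continuous h₁
  have hmem (z : unitInterval × unitInterval) :
      (1 - (z.1 : ℝ)) • g (γ₀ z.2) + (z.1 : ℝ) • g (γ₁ z.2) ∈ S :=
    hS (hgB (h₀ _)) (hgB (h₁ _)) (sub_nonneg.2 z.1.2.2) z.1.2.1 (by ring)
  have hc : Continuous fun z : unitInterval × unitInterval ↦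
      e ((1 - (z.1 : ℝ)) • g (γ₀ z.2) + (z.1 : ℝ) • g (γ₁ z.2)) := by
    refine he.comp_continuous ?_ hmem
    exact ((continuous_const.sub (continuous_subtype_val.comp continuous_fst)).smul
      (hc₀.comp continuous_snd)).add ((continuous_subtype_val.comp continuous_fst).smul
      (hc₁.comp continuous_snd))
  refine ⟨{ toFun := _, continuous_toFun := hc, map_zero_left := fun t ↦ ?_
            map_one_left := fun t ↦ ?_, prop' := fun t s hs ↦ ?_ }⟩
  · simp [heg _ (h₀ t)]
  · simp [heg _ (h₁ t)]
  · have h : γ₀ s = γ₁ s := by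
      rcases hs with rfl | hs
      · exact hz
      · rw [mem_singleton_iff.1 hs]; exact ho
    change e ((1 - (t : ℝ)) • g (γ₀ s) + (t : ℝ) • g (γ₁ s)) = γ₀ s
    rw [← h, ← add_smul, sub_add_cancel, one_smul, heg _ (h₀ s)]

section Lift

variable {n : ℕ} {X Y : Type*}
  [TopologicalSpace X] [ChartedSpace (EuclideanSpace ℝ (Fin n)) X] [IsManifold (𝓡 n) ∞ X]
  [TopologicalSpace Y] [ChartedSpace (EuclideanSpace ℝ (Fin n)) Y] [IsManifold (𝓡 n) ∞ Y]

/-- A continuous lift of a `C^1` curve by a local diffeomorphism is `C^1`. -/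
lemma ContMDiffWithinAt.of_comp_of_injective_mfderiv {f : X → Y} {γ : ℝ → X} {S : Set ℝ} {t : ℝ}
    (hf : ContMDiffAt (𝓡 n) (𝓡 n) 1 f (γ t))
    (hinj : Function.Injective (mfderiv (𝓡 n) (𝓡 n) f (γ t))) (hγ : ContinuousWithinAt γ S t)
    (h : ContMDiffWithinAt 𝓘(ℝ, ℝ) (𝓡 n) 1 (f ∘ γ) S t) :
    ContMDiffWithinAt 𝓘(ℝ, ℝ) (𝓡 n) 1 γ S t := by
  set x := γ t
  set φ := extChartAt (𝓡 n) x
  set ψ := extChartAt (𝓡 n) (f x)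
  set F : EuclideanSpace ℝ (Fin n) → EuclideanSpace ℝ (Fin n) := ψ ∘ f ∘ φ.symm
  have hF : ContDiffAt ℝ 1 F (φ x) := by
    have := (contMDiffAt_iff.1 hf).2
    rwa [ModelWithCorners.range_eq_univ, contDiffWithinAt_univ] at this
  have hfd : mfderiv (𝓡 n) (𝓡 n) f x = fderiv ℝ F (φ x) := by
    rw [(hf.mdifferentiableAt one_ne_zero).mfderiv]
    rw [ModelWithCorners.range_eq_univ, fderivWithin_univ]
    rfl
  rw [hfd] at hinj
  let L : EuclideanSpace ℝ (Fin n) ≃L[ℝ] EuclideanSpace ℝ (Fin n) :=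
    (LinearEquiv.ofInjectiveEndo (fderiv ℝ F (φ x) : _ →ₗ[ℝ] _) hinj).toContinuousLinearEquiv
  have hL : HasFDerivAt F (L : EuclideanSpace ℝ (Fin n) →L[ℝ] EuclideanSpace ℝ (Fin n)) (φ x) := by
    have h1 := (hF.differentiableAt one_ne_zero).hasFDerivAt
    have h2 : (L : EuclideanSpace ℝ (Fin n) →L[ℝ] EuclideanSpace ℝ (Fin n)) = fderiv ℝ F (φ x) := by
      ext v : 1
      rfl
    rwa [h2]
  -- The injective differential is invertible because both dimensions are n, so in coordinates the
  -- curve is locally G applied to its smooth projection.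
  set G := hF.localInverse hL one_ne_zero
  have hG : ContDiffAt ℝ 1 G (F (φ x)) := hF.to_localInverse hL one_ne_zero
  have hGF : ∀ᶠ a in 𝓝 (φ x), G (F a) = a :=
    (hF.hasStrictFDerivAt' hL one_ne_zero).eventually_left_inverse
  have hFφ : ∀ y ∈ φ.source, F (φ y) = ψ (f y) := fun y hy ↦ by simp [F, φ.left_inv hy]
  have hsrc : ∀ᶠ τ in 𝓝[S] t, γ τ ∈ φ.source := hγ (extChartAt_source_mem_nhds x)
  have hφγ : ContinuousWithinAt (φ ∘ γ) S t := (continuousAt_extChartAt x).comp_continuousWithinAt hγ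
  have heq : φ ∘ γ =ᶠ[𝓝[S] t] G ∘ (ψ ∘ f ∘ γ) := by
    filter_upwards [hsrc, hφγ hGF] with τ h1 h2
    have h2 : G (F (φ (γ τ))) = φ (γ τ) := h2
    rw [hFφ _ h1] at h2
    exact h2.symm
  have hx : x ∈ φ.source := mem_extChartAt_source x
  have hψ : ContDiffWithinAt ℝ 1 (ψ ∘ f ∘ γ) S t := by
    have := (contMDiffWithinAt_iff_target.1 h).2
    rwa [contMDiffWithinAt_iff_contDiffWithinAt] at this
  rw [contMDiffWithinAt_iff_target]
  refine ⟨hγ, ?_⟩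
  rw [contMDiffWithinAt_iff_contDiffWithinAt]
  refine ContDiffWithinAt.congr_of_eventuallyEq (f := G ∘ (ψ ∘ f ∘ γ)) ?_ heq ?_
  · refine ContDiffAt.comp_contDiffWithinAt t ?_ hψ
    rw [hFφ x hx] at hG
    exact hG
  · have : G (F (φ x)) = φ x := hF.localInverse_apply_image hL one_ne_zero
    rw [hFφ x hx] at this
    exact this.symm

end Lift

section Covering


variable {n : ℕ} {N' N : Type*}
  [EMetricSpace N'] [ChartedSpace (EuclideanSpace ℝ (Fin n)) N'] [IsManifold (𝓡 n) ∞ N']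
  [RiemannianBundle (fun x : N' ↦ TangentSpace (𝓡 n) x)] [IsRiemannianManifold (𝓡 n) N']
  [EMetricSpace N] [ChartedSpace (EuclideanSpace ℝ (Fin n)) N] [IsManifold (𝓡 n) ∞ N]
  [RiemannianBundle (fun x : N ↦ TangentSpace (𝓡 n) x)] [IsRiemannianManifold (𝓡 n) N]
  {q : N' → N}

/-- Riemannian coverings preserve the length of curves. -/
lemma IsRiemannianCovering.pathELength_comp (hq : IsRiemannianCovering (n := n) q) {γ : ℝ → N'}
    {a b : ℝ} (hab : a < b) (hγ : ContMDiffOn 𝓘(ℝ, ℝ) (𝓡 n) 1 γ (Icc a b)) :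
    pathELength (𝓡 n) (q ∘ γ) a b = pathELength (𝓡 n) γ a b := by
  rw [pathELength_eq_lintegral_mfderivWithin_Icc, pathELength_eq_lintegral_mfderivWithin_Icc]
  refine setLIntegral_congr_fun measurableSet_Icc fun t ht ↦ ?_
  have hcomp : mfderivWithin 𝓘(ℝ, ℝ) (𝓡 n) (q ∘ γ) (Icc a b) t =
      (mfderiv (𝓡 n) (𝓡 n) q (γ t)) ∘L (mfderivWithin 𝓘(ℝ, ℝ) (𝓡 n) γ (Icc a b) t) := by
    apply mfderiv_comp_mfderivWithin
    · exact hq.contMDiff.mdifferentiable (by simp) _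
    · exact hγ.mdifferentiableOn one_ne_zero t ht
    · rw [uniqueMDiffWithinAt_iff_uniqueDiffWithinAt]
      exact uniqueDiffOn_Icc hab t ht
  have h1 : mfderivWithin 𝓘(ℝ, ℝ) (𝓡 n) (q ∘ γ) (Icc a b) t 1 =
      mfderiv (𝓡 n) (𝓡 n) q (γ t) (mfderivWithin 𝓘(ℝ, ℝ) (𝓡 n) γ (Icc a b) t 1) := congr($hcomp 1)
  have h2 := hq.norm_mfderiv (γ t) (mfderivWithin 𝓘(ℝ, ℝ) (𝓡 n) γ (Icc a b) t 1)
  rw [h1]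
  simp only [enorm, nnnorm]
  congr 1
  exact Subtype.ext h2

lemma IsRiemannianCovering.injective_mfderiv (hq : IsRiemannianCovering (n := n) q) (x : N') :
    Function.Injective (mfderiv (𝓡 n) (𝓡 n) q x) := by
  rw [injective_iff_map_eq_zero]
  intro v hv
  have := hq.norm_mfderiv x v
  rw [hv] at this
  simpa using this.symm

lemma edist_le_pathELength {γ : ℝ → N} (hγ : ContMDiffOn 𝓘(ℝ, ℝ) (𝓡 n) 1 γ (Icc 0 1)) {t : ℝ} (ht : t ∈ Icc (0 : ℝ) 1) :
    edist (γ 0) (γ t) ≤ pathELength (𝓡 n) γ 0 1 := by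
  rw [IsRiemannianManifold.out (I := 𝓡 n)]
  exact (riemannianEDist_le_pathELength (hγ.mono (Icc_subset_Icc le_rfl ht.2)) rfl rfl ht.1).trans
    (pathELength_mono le_rfl ht.2)

lemma IsNormalBall.exists_continuousOn {x : N} {r : ℝ≥0} {e : TangentSpace (𝓡 n) x → N}
    (he : IsNormalBall x r e) : ∃ g : N → TangentSpace (𝓡 n) x,
      ContinuousOn e (Metric.ball 0 r) ∧ ContinuousOn g (Metric.eball x r) ∧
      MapsTo g (Metric.eball x r) (Metric.ball 0 r) ∧ ∀ y ∈ Metric.eball x r, e (g y) = y := by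
  obtain ⟨g, hg, hge⟩ := he.smooth_inverse
  refine ⟨g, he.smooth.continuousOn, hg.continuousOn, fun y hy ↦ ?_, fun y hy ↦ ?_⟩
  · obtain ⟨v, hv, rfl⟩ := he.bijOn.surjOn hy
    rwa [hge v hv]
  · obtain ⟨v, hv, rfl⟩ := he.bijOn.surjOn hy
    rw [hge v hv]

/-- Below the injectivity radius, a Riemannian covering does not decrease distances. -/
lemma IsRiemannianCovering.edist_le (hq : IsRiemannianCovering (n := n) q) {r : ℝ≥0}
    (hr : ∀ x : N, ∃ e : TangentSpace (𝓡 n) x → N, IsNormalBall x r e) {x y : N'}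
    (hxy : edist x y < r) : edist x y ≤ edist (q x) (q y) := by
  obtain ⟨e, he⟩ := hr (q x)
  obtain ⟨g, hec, hgc, hgB, heg⟩ := he.exists_continuousOn
  have hxy' := hxy
  rw [IsRiemannianManifold.out (I := 𝓡 n)] at hxy'
  -- A short curve β from x to y upstairs; its projection has the same length, hence stays in the
  -- normal ball around q x.
  obtain ⟨β, hβ0, hβ1, hβ, hβlen⟩ := exists_lt_of_riemannianEDist_lt hxy'
  have hq1 : ContMDiff (𝓡 n) (𝓡 n) 1 q := hq.contMDiff.of_le (by simp)
  have hqβ : ContMDiffOn 𝓘(ℝ, ℝ) (𝓡 n) 1 (q ∘ β) (Icc 0 1) := hq1.comp_contMDiffOn hβ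
  have hqβmem : ∀ t ∈ Icc (0 : ℝ) 1, q (β t) ∈ Metric.eball (q x) r := fun t ht ↦ by
    have h := edist_le_pathELength hqβ ht
    rw [hq.pathELength_comp zero_lt_one hβ] at h
    rw [Metric.mem_eball, edist_comm, ← hβ0]
    exact h.trans_lt hβlen
  have hqxy : edist (q x) (q y) < r := by
    have := hqβmem 1 (right_mem_Icc.2 zero_le_one)
    rwa [hβ1, Metric.mem_eball, edist_comm] at this
  have hR : ∀ R ∈ Ioo (edist (q x) (q y)) r, edist x y ≤ R := by
    rintro R ⟨hR, hRr⟩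
    rw [IsRiemannianManifold.out (I := 𝓡 n)] at hR
    -- An almost shortest curve downstairs. It also stays in the normal ball, so it is homotopic
    -- with fixed endpoints to the projection of β.
    obtain ⟨γ, hγ0, hγ1, hγ, hγlen⟩ := exists_lt_of_riemannianEDist_lt hR
    have hγmem : ∀ t ∈ Icc (0 : ℝ) 1, γ t ∈ Metric.eball (q x) r := fun t ht ↦ by
      have h := edist_le_pathELength hγ ht
      rw [Metric.mem_eball, edist_comm, ← hγ0]
      exact h.trans_lt (hγlen.trans hRr)
    let γc : C(unitInterval, N) := ⟨fun t ↦ γ t, hγ.continuousOn.comp_continuous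
      continuous_subtype_val fun t ↦ t.2⟩
    let βc : C(unitInterval, N') := ⟨fun t ↦ β t, hβ.continuousOn.comp_continuous
      continuous_subtype_val fun t ↦ t.2⟩
    let qβc : C(unitInterval, N) := ⟨fun t ↦ q (β t), hq1.continuous.comp βc.continuous⟩
    have hγz : γc 0 = q x := hγ0
    have hβz : qβc 0 = q x := by simp [qβc, hβ0]
    have hγo : γc 1 = q y := hγ1
    have hβo : qβc 1 = q y := by simp [qβc, hβ1]
    have hhom : γc.HomotopicRel qβc {0, 1} := homotopicRel_of_convex (convex_ball _ _) hec hgc hgB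
      heg (fun t ↦ hγmem t t.2) (fun t ↦ hqβmem t t.2) (hγz.trans hβz.symm) (hγo.trans hβo.symm)
    set Γ := hq.isCoveringMap.liftPath γc x hγz
    have hΓ0 : Γ 0 = x := hq.isCoveringMap.liftPath_zero γc x hγz
    have hΓq : q ∘ Γ = γc := hq.isCoveringMap.liftPath_lifts γc x hγz
    have hβlift : βc = hq.isCoveringMap.liftPath qβc x hβz :=
      (hq.isCoveringMap.eq_liftPath_iff' hβz).2 ⟨rfl, hβ0⟩
    -- Homotopic curves have lifts with the same endpoint. The lift of γ therefore joins x to y, and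
    -- its length is that of γ.
    have hΓ1 : Γ 1 = y := by
      have h := hq.isCoveringMap.liftPath_apply_one_eq_of_homotopicRel hhom x hγz hβz
      rw [← hβlift] at h
      exact h.trans hβ1
    set Γ' : ℝ → N' := fun t ↦ Γ (projIcc 0 1 zero_le_one t)
    have hΓ'c : Continuous Γ' := Γ.continuous.comp continuous_projIcc
    have hΓ'q : EqOn (q ∘ Γ') γ (Icc 0 1) := fun t ht ↦ by
      have := congr_fun hΓq (projIcc 0 1 zero_le_one t)
      rw [projIcc_of_mem _ ht] at this
      change q (Γ (projIcc 0 1 zero_le_one t)) = γ t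
      rw [projIcc_of_mem _ ht]
      exact this
    have hΓ' : ContMDiffOn 𝓘(ℝ, ℝ) (𝓡 n) 1 Γ' (Icc 0 1) := fun t ht ↦
      ContMDiffWithinAt.of_comp_of_injective_mfderiv hq1.contMDiffAt (hq.injective_mfderiv _)
        hΓ'c.continuousWithinAt ((hγ t ht).congr hΓ'q (hΓ'q ht))
    have h0 : Γ' 0 = x := by simp [Γ', hΓ0]
    have h1 : Γ' 1 = y := by simp [Γ', hΓ1]
    calc edist x y = edist (Γ' 0) (Γ' 1) := by rw [h0, h1]
      _ ≤ pathELength (𝓡 n) Γ' 0 1 := edist_le_pathELength hΓ' (right_mem_Icc.2 zero_le_one)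
      _ = pathELength (𝓡 n) (q ∘ Γ') 0 1 := (hq.pathELength_comp zero_lt_one hΓ').symm
      _ = pathELength (𝓡 n) γ 0 1 := pathELength_congr hΓ'q
      _ ≤ R := hγlen.le
  exact le_of_forall_gt_imp_ge_of_dense fun R h ↦ by
    rcases lt_or_ge R r with h' | h'
    · exact hR R ⟨h, h'⟩
    · exact hxy.le.trans h'

end Covering

/-! ### The estimate for liftings -/

lemma gagliardoEnergy_congr {X E : Type*} [EMetricSpace X] [MeasurableSpace X] [EMetricSpace E]
    {m : ℕ} {μ : Measure X} {s p : ℝ} {u v : X → E} (h : u =ᵐ[μ] v) :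
    gagliardoEnergy m μ s p u = gagliardoEnergy m μ s p v := by
  refine lintegral_congr_ae (h.mono fun x hx ↦ lintegral_congr_ae (h.mono fun y hy ↦ ?_))
  simp only [hx, hy]

section

open Module

variable {M : Type*} [EMetricSpace M] [MeasurableSpace M] [BorelSpace M]
  [SecondCountableTopology M] {ν : Measure M}

variable [CompactSpace M]
  {E : Type*} [NormedAddCommGroup E] [NormedSpace ℝ E] [MeasurableSpace E] [BorelSpace E]
  [FiniteDimensional ℝ E] {μ : Measure E} [μ.IsAddHaarMeasure]

lemma isFiniteMeasure_of_charts
    (hchart : ∀ (x : M), ∀ V ∈ 𝓝 x, ∃ c : BilipschitzChart ν μ, x ∈ c.U ∧ c.U ⊆ V) :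
    IsFiniteMeasure ν := by
  refine ⟨isCompact_univ.measure_lt_top_of_nhdsWithin fun x _ ↦ ?_⟩
  obtain ⟨c, hx, -⟩ := hchart x univ Filter.univ_mem
  exact ⟨c.U, mem_nhdsWithin_of_mem_nhds (c.isOpen_U.mem_nhds hx), c.measure_U_lt_top⟩

/-- The abstract form of the estimate for liftings: a map `q` that does not decrease the distances
smaller than `ρ`. -/
lemma exists_gagliardoEnergy_le_of_charts
    (hchart : ∀ (x : M), ∀ V ∈ 𝓝 x, ∃ c : BilipschitzChart ν μ, x ∈ c.U ∧ c.U ⊆ V)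
    (hconn : ∀ x y : M, edist x y ≠ ⊤ → y ∈ connectedComponent x)
    {N' N : Type*} [EMetricSpace N'] [SecondCountableTopology N'] [MeasurableSpace N']
    [BorelSpace N'] [EMetricSpace N] {q : N' → N} {ρ : ℝ≥0∞} (hρ : ρ ≠ 0)
    (hq : ∀ x y, edist x y < ρ → edist x y ≤ edist (q x) (q y))
    {m : ℕ} {s p : ℝ} (hm : finrank ℝ E = m) (hs₀ : 0 < s) (hs₁ : s < 1) (hp : 1 < p)
    (hsp : 1 < s * p) (hm₁ : 1 - s < s * p / m) (hm₂ : s * p / m < 1) :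
    ∃ C : ℝ≥0, ∀ u : M → N', Measurable u →
      ∫⁻ x, ∫⁻ y in {y | ρ / 2 ≤ edist (u x) (u y)}, 1 / edist x y ^ ((m : ℝ) + 1) ∂ν ∂ν < ⊤ →
      gagliardoEnergy m ν s p (q ∘ u) < ⊤ →
      gagliardoEnergy m ν (sFlat m s p) p u ≤
        C * (gagliardoEnergy m ν s p (q ∘ u) + gagliardoEnergy m ν s p (q ∘ u) ^ (1 / s)) := by
  have hfin := isFiniteMeasure_of_charts hchart
  have hp0 : 0 < p := by linarith
  have hm0 : (0 : ℝ) < m := by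
    rcases Nat.eq_zero_or_pos m with h | h
    · subst h; simp at hm₁; linarith
    · exact_mod_cast h
  have hsm : s * p < m := (div_lt_one hm0).1 hm₂
  have hsp0 : 0 < s * p := by positivity
  have hqp : s * p < p := by nlinarith
  have hflat : p - p * m / (s * p) + m = sFlat m s p * p := by
    rw [sFlat]; field_simp; ring
  have ha : 0 < p - p * m / (s * p) + m := by
    rw [lt_div_iff₀ hm0] at hm₁
    have : p - p * m / (s * p) + m = (s * p - (1 - s) * m) / s := by field_simp; ring
    rw [this]
    exact div_pos (by linarith) hs₀
  obtain ⟨C, hC⟩ := exists_lintegral_kernel_le_of_charts hchart hconn hsp hqp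
    (by rw [hm]; exact hsm) (by rw [hm]; exact ha)
  simp only [hm, hflat] at hC
  have hps : p / (s * p) = 1 / s := by field_simp
  rw [hps] at hC
  -- Distances below δ are not decreased by q. The minimum with 1 keeps δ finite when ρ is infinite.
  set δ : ℝ≥0∞ := min (ρ / 2) 1
  have hδ0 : δ ≠ 0 := (lt_min (ENNReal.half_pos hρ) one_pos).ne'
  have hδt : δ ≠ ⊤ := ne_top_of_le_ne_top ENNReal.one_ne_top (min_le_right _ _)
  have hδρ : δ ≤ ρ / 2 := min_le_left _ _
  set κ : ℝ≥0∞ := (δ ^ p)⁻¹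
  have hδp0 : δ ^ p ≠ 0 := by simp [ENNReal.rpow_eq_zero_iff, hδ0, hδt]
  have hδpt : δ ^ p ≠ ⊤ := ENNReal.rpow_ne_top_of_nonneg hp0.le hδt
  have hκ : κ ≠ ⊤ := ENNReal.inv_ne_top.2 hδp0
  have hs1 : 0 ≤ 1 / s := by positivity
  have hD : δ ^ p * (C * (κ + κ ^ (1 / s))) ≠ ⊤ := ENNReal.mul_ne_top hδpt
    (ENNReal.mul_ne_top ENNReal.coe_ne_top (ENNReal.add_ne_top.2
      ⟨hκ, ENNReal.rpow_ne_top_of_nonneg hs1 hκ⟩))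
  refine ⟨(δ ^ p * (C * (κ + κ ^ (1 / s)))).toNNReal, fun u hu hX hE ↦ ?_⟩
  rw [ENNReal.coe_toNNReal hD]
  set W : M → M → ℝ≥0∞ := fun x y ↦ edist (u x) (u y) / δ
  have hum : Measurable fun z : M × M ↦ edist (u z.1) (u z.2) :=
    measurable_edist.comp ((hu.comp measurable_fst).prodMk (hu.comp measurable_snd))
  have hW : IsMeasurablePseudoDist W :=
    ⟨fun x ↦ by simp [W], fun x y ↦ by simp only [W]; rw [edist_comm], fun x y z ↦ by
      simp only [W]; rw [← ENNReal.add_div]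
      exact ENNReal.div_le_div_right (edist_triangle _ _ _) _, hum.div_const δ⟩
  set G := gagliardoEnergy m ν s p (q ∘ u)
  have hGdef : G = ∫⁻ x, ∫⁻ y, edist (q (u x)) (q (u y)) ^ p / edist x y ^ ((m : ℝ) + s * p) ∂ν ∂ν := by
    refine lintegral_congr fun x ↦ lintegral_congr fun y ↦ ?_
    rw [edist_comm y x, edist_comm ((q ∘ u) y)]
    rfl
  -- the jumps are admissible
  have hXW : ∫⁻ x, ∫⁻ y, (if 1 ≤ W x y then 1 else 0) / edist x y ^ ((m : ℝ) + 1) ∂ν ∂ν ≠ ⊤ := by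
    set F : M × M → ℝ≥0∞ := fun z ↦
      (if ρ / 2 ≤ edist (u z.1) (u z.2) then 1 else 0) / edist z.1 z.2 ^ ((m : ℝ) + 1)
    have hF : Measurable F := (Measurable.ite (measurableSet_le measurable_const hum)
      measurable_const measurable_const).div (by fun_prop)
    -- Only jumps of size between δ and ρ / 2 are not covered by the assumption. If x and y are at
    -- distance at least 1 the kernel is bounded and the measure finite. Otherwise q does not shrink
    -- the jump, and 1 < sp lets the energy of the projection pay for it.
    have hpt (x y : M) : (if 1 ≤ W x y then (1 : ℝ≥0∞) else 0) / edist x y ^ ((m : ℝ) + 1) ≤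
        F (x, y) + (1 + κ * (edist (q (u x)) (q (u y)) ^ p / edist x y ^ ((m : ℝ) + s * p))) := by
      split_ifs with h
      · by_cases h' : ρ / 2 ≤ edist (u x) (u y)
        · refine le_trans (le_of_eq ?_) le_self_add
          simp only [F, if_pos h']
        · refine le_trans ?_ le_add_self
          rcases le_total 1 (edist x y) with h1 | h1
          · refine le_trans ?_ le_self_add
            rw [one_div]
            exact ENNReal.inv_le_one.2 (ENNReal.one_le_rpow h1 (by positivity))
          · refine le_trans ?_ le_add_self
            have h2 : edist (u x) (u y) ≤ edist (q (u x)) (q (u y)) :=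
              hq _ _ ((not_le.1 h').trans_le ENNReal.half_le_self)
            have h3 : δ ≤ edist (u x) (u y) := by
              have := (ENNReal.le_div_iff_mul_le (Or.inl hδ0) (Or.inl hδt)).1 h
              rwa [one_mul] at this
            rw [← mul_div_assoc]
            refine ENNReal.div_le_div ?_ (ENNReal.rpow_le_rpow_of_exponent_ge h1 (by linarith))
            calc (1 : ℝ≥0∞) = κ * δ ^ p := (ENNReal.inv_mul_cancel hδp0 hδpt).symm
              _ ≤ _ := mul_le_mul' le_rfl (ENNReal.rpow_le_rpow (h3.trans h2) hp0.le)
      · simp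
    have hle : ∫⁻ x, ∫⁻ y, (if 1 ≤ W x y then 1 else 0) / edist x y ^ ((m : ℝ) + 1) ∂ν ∂ν ≤
        (∫⁻ x, ∫⁻ y, F (x, y) ∂ν ∂ν) + (ν univ * ν univ + κ * G) := by
      refine (lintegral_mono fun x ↦ lintegral_mono fun y ↦ hpt x y).trans_eq ?_
      have h1 (x : M) : ∫⁻ y, F (x, y) + (1 + κ * (edist (q (u x)) (q (u y)) ^ p /
          edist x y ^ ((m : ℝ) + s * p))) ∂ν = ∫⁻ y, F (x, y) ∂ν + (ν univ +
          κ * ∫⁻ y, edist (q (u x)) (q (u y)) ^ p / edist x y ^ ((m : ℝ) + s * p) ∂ν) := by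
        have hFx : Measurable fun y ↦ F (x, y) := hF.comp (measurable_const.prodMk measurable_id)
        rw [lintegral_add_left hFx, lintegral_add_left measurable_const, lintegral_const, one_mul,
          lintegral_const_mul' _ _ hκ]
      simp only [h1]
      have hFm : Measurable fun x ↦ ∫⁻ y, F (x, y) ∂ν := hF.lintegral_prod_right'
      rw [lintegral_add_left hFm, lintegral_add_left measurable_const, lintegral_const,
        lintegral_const_mul' _ _ hκ, hGdef]
    refine ne_top_of_le_ne_top (ENNReal.add_ne_top.2 ⟨?_, ENNReal.add_ne_top.2
      ⟨ENNReal.mul_ne_top (measure_ne_top _ _) (measure_ne_top _ _),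
        ENNReal.mul_ne_top hκ hE.ne⟩⟩) hle
    refine ne_of_eq_of_ne (lintegral_congr fun x ↦ ?_) hX.ne
    have hset : MeasurableSet {y | ρ / 2 ≤ edist (u x) (u y)} :=
      measurableSet_le measurable_const (hum.comp (measurable_const.prodMk measurable_id))
    rw [← lintegral_indicator hset]
    refine lintegral_congr fun y ↦ ?_
    simp only [F, indicator_apply, mem_ofPred_eq]
    split_ifs <;> simp
  have hA : ∫⁻ x, ∫⁻ y, cutoff (W x y) ^ p / edist x y ^ ((m : ℝ) + s * p) ∂ν ∂ν ≤ κ * G := by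
    rw [hGdef, ← lintegral_const_mul' _ _ hκ]
    refine lintegral_mono fun x ↦ ?_
    rw [← lintegral_const_mul' _ _ hκ]
    refine lintegral_mono fun y ↦ ?_
    rw [← mul_div_assoc]
    refine ENNReal.div_le_div_right ?_ _
    unfold cutoff
    split_ifs with h
    · have h1 : edist (u x) (u y) < δ := by
        have := (ENNReal.div_lt_iff (Or.inl hδ0) (Or.inl hδt)).1 h
        rwa [one_mul] at this
      have h2 := hq _ _ (h1.trans_le (hδρ.trans ENNReal.half_le_self))
      calc W x y ^ p = κ * edist (u x) (u y) ^ p := by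
            simp only [W, κ]
            rw [ENNReal.div_rpow_of_nonneg _ _ hp0.le, div_eq_mul_inv, mul_comm]
        _ ≤ _ := mul_le_mul' le_rfl (ENNReal.rpow_le_rpow h2 hp0.le)
    · rw [ENNReal.zero_rpow_of_pos hp0]; exact zero_le
  have hmain := hC hW hXW
  have hGW : gagliardoEnergy m ν (sFlat m s p) p u =
      δ ^ p * ∫⁻ x, ∫⁻ y, W x y ^ p / edist x y ^ ((m : ℝ) + sFlat m s p * p) ∂ν ∂ν := by
    rw [← lintegral_const_mul' _ _ hδpt]
    refine lintegral_congr fun x ↦ ?_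
    rw [← lintegral_const_mul' _ _ hδpt]
    refine lintegral_congr fun y ↦ ?_
    rw [edist_comm y x, edist_comm (u y), ← mul_div_assoc]
    congr 1
    simp only [W]
    rw [← ENNReal.mul_rpow_of_nonneg _ _ hp0.le, ENNReal.mul_div_cancel hδ0 hδt]
  rw [hGW]
  calc _ ≤ δ ^ p * (C * (κ * G + (κ * G) ^ (1 / s))) := by
        refine mul_le_mul' le_rfl (hmain.trans (mul_le_mul' le_rfl
          (add_le_add hA (ENNReal.rpow_le_rpow hA hs1))))
    _ = δ ^ p * (C * (κ * G + κ ^ (1 / s) * G ^ (1 / s))) := by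
        rw [ENNReal.mul_rpow_of_nonneg _ _ hs1]
    _ ≤ δ ^ p * (C * ((κ + κ ^ (1 / s)) * G + (κ + κ ^ (1 / s)) * G ^ (1 / s))) := by
        gcongr
        · exact le_self_add
        · exact le_add_self
    _ = _ := by ring

/-- Without restriction on the jumps, the kernel `1 / d ^ (m + 1)` is not integrable. -/
lemma lintegral_inv_edist_eq_top_of_chart [SFinite ν] (c : BilipschitzChart ν μ) :
    ∫⁻ x, ∫⁻ y, 1 / edist x y ^ (finrank ℝ E + 1 : ℝ) ∂ν ∂ν = ⊤ := by
  set d : ℝ := (finrank ℝ E : ℝ)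
  have hd : 0 ≤ d + 1 := by positivity
  have hpt : ∀ a ∈ c.K, ∫⁻ b in c.K, 1 / edist a b ^ (d + 1) ∂μ = ⊤ := by
    intro a ha
    have hk (k : ℕ) : 2 ^ (k : ℝ) * μ c.K ≤ ∫⁻ b in c.K, 1 / edist a b ^ (d + 1) ∂μ := by
      calc 2 ^ (k : ℝ) * μ c.K = 2 ^ (k * (d + 1)) * (2 ^ (-(k * d)) * μ c.K) := by
            rw [← mul_assoc, ENNReal.two_rpow_mul_two_rpow]
            ring_nf
        _ ≤ 2 ^ (k * (d + 1)) * μ (nearSet c.K k a) := by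
            refine mul_le_mul' le_rfl (le_measure_nearSet μ c.convex_K (fun x hx y hy ↦
              (c.edist_le_of_mem_K x hx y hy).trans ?_) k ha)
            rw [one_div]; exact ENNReal.inv_le_one.2 (by norm_num)
        _ = ∫⁻ _ in nearSet c.K k a, 2 ^ (k * (d + 1)) ∂μ := (setLIntegral_const _ _).symm
        _ ≤ ∫⁻ b in nearSet c.K k a, 1 / edist a b ^ (d + 1) ∂μ := by
            refine setLIntegral_mono' (c.measurableSet_K.nearSet k a) fun b hb ↦ ?_
            rw [one_div, ← neg_neg (k * (d + 1)), ← ENNReal.inv_two_rpow, ← neg_mul,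
              ENNReal.rpow_mul]
            exact ENNReal.inv_le_inv.2 (ENNReal.rpow_le_rpow hb.2 hd)
        _ ≤ _ := lintegral_mono_set (nearSet_subset _ _ _)
    by_contra h
    have hK := c.measure_K_ne_zero
    obtain ⟨k, hk'⟩ := ENNReal.exists_nat_gt (ENNReal.div_ne_top h hK)
    have h1 : (k : ℝ≥0∞) ≤ 2 ^ (k : ℝ) := by
      rw [ENNReal.rpow_natCast]; exact_mod_cast Nat.lt_two_pow_self.le
    have h2 := (ENNReal.div_lt_iff (Or.inl hK) (Or.inl c.measure_K_ne_top)).1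
      (hk'.trans_le h1)
    exact absurd (hk k) (not_le.2 h2)
  have h1 : ∫⁻ a in c.K, ∫⁻ b in c.K, 1 / edist a b ^ (d + 1) ∂μ ∂μ = ⊤ := by
    rw [setLIntegral_congr_fun c.measurableSet_K hpt, setLIntegral_const,
      ENNReal.top_mul c.measure_K_ne_zero]
  have h2 := c.lintegral_kernel_invFun_le (F := fun _ _ ↦ 1) measurable_const hd
  rw [h1, top_le_iff] at h2
  refine top_le_iff.1 ?_
  have h3 : ∫⁻ x in c.U, ∫⁻ y in c.U, 1 / edist x y ^ (d + 1) ∂ν ∂ν = ⊤ := by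
    by_contra h
    exact ENNReal.mul_ne_top (ENNReal.mul_ne_top (ENNReal.pow_ne_top ENNReal.coe_ne_top)
      (ENNReal.rpow_ne_top_of_nonneg hd ENNReal.coe_ne_top)) h h2
  rw [← h3]
  exact (setLIntegral_le_lintegral _ _).trans (lintegral_mono fun x ↦ setLIntegral_le_lintegral _ _)

end

lemma isContinuousRiemannianBundle_of_contMDiff {m : ℕ} {H : Type*} [TopologicalSpace H]
    (I : ModelWithCorners ℝ (EuclideanSpace ℝ (Fin m)) H)
    (M : Type*) [EMetricSpace M] [ChartedSpace H M] [IsManifold I ∞ M]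
    [RiemannianBundle (fun x : M ↦ TangentSpace I x)]
    [h : IsContMDiffRiemannianBundle I ∞ (EuclideanSpace ℝ (Fin m))
      (fun x : M ↦ TangentSpace I x)] :
    IsContinuousRiemannianBundle (EuclideanSpace ℝ (Fin m)) (fun x : M ↦ TangentSpace I x) := by
  obtain ⟨g, hg, hgi⟩ := h.exists_contMDiff
  exact ⟨g, hg.continuous, hgi⟩

/-- Points at finite distance are in the same component. -/
lemma mem_connectedComponent_of_edist_ne_top {E H : Type*} [NormedAddCommGroup E] [NormedSpace ℝ E]
    [TopologicalSpace H] (I : ModelWithCorners ℝ E H)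
    {M : Type*} [EMetricSpace M] [ChartedSpace H M]
    [RiemannianBundle (fun x : M ↦ TangentSpace I x)] [IsRiemannianManifold I M] {x y : M}
    (h : edist x y ≠ ⊤) : y ∈ connectedComponent x := by
  have h' := h.lt_top
  rw [IsRiemannianManifold.out (I := I)] at h'
  obtain ⟨γ, h0, h1, hγ, -⟩ := exists_lt_of_riemannianEDist_lt h'
  have hc : IsPreconnected (γ '' Icc 0 1) := isPreconnected_Icc.image γ hγ.continuousOn
  exact hc.subset_connectedComponent ⟨0, by simp, h0⟩ ⟨1, by simp, h1⟩

/-- Below the injectivity radius, a Riemannian covering does not decrease distances. -/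
lemma IsRiemannianCovering.edist_le_of_lt_injectivityRadius {n : ℕ} {N' N : Type*}
    [EMetricSpace N] [ChartedSpace (EuclideanSpace ℝ (Fin n)) N]
    [IsManifold (𝓡 n) ∞ N] [RiemannianBundle (fun x : N ↦ TangentSpace (𝓡 n) x)]
    [IsContMDiffRiemannianBundle (𝓡 n) ∞ (EuclideanSpace ℝ (Fin n))
      (fun x : N ↦ TangentSpace (𝓡 n) x)]
    [IsRiemannianManifold (𝓡 n) N]
    [EMetricSpace N'] [ChartedSpace (EuclideanSpace ℝ (Fin n)) N']
    [IsManifold (𝓡 n) ∞ N'] [RiemannianBundle (fun x : N' ↦ TangentSpace (𝓡 n) x)]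
    [IsContMDiffRiemannianBundle (𝓡 n) ∞ (EuclideanSpace ℝ (Fin n))
      (fun x : N' ↦ TangentSpace (𝓡 n) x)]
    [IsRiemannianManifold (𝓡 n) N'] {q : N' → N}
    (hq : IsRiemannianCovering (n := n) q) {x y : N'}
    (hxy : edist x y < injectivityRadius n N) : edist x y ≤ edist (q x) (q y) := by
  obtain ⟨r, hr⟩ := lt_iSup_iff.1 hxy
  obtain ⟨h, hr⟩ := lt_iSup_iff.1 hr
  exact hq.edist_le h.2 hr

theorem exists_gagliardoEnergy_lifting_le {m : ℕ} {s p : ℝ} (hs₀ : 0 < s) (hs₁ : s < 1)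
    (hp : 1 < p) (hsp : 1 < s * p) (hm₁ : 1 - s < s * p / m) (hm₂ : s * p / m < 1) (n : ℕ)
    (H : Type*) [TopologicalSpace H] (I : ModelWithCorners ℝ (EuclideanSpace ℝ (Fin m)) H)
    (M : Type*) [EMetricSpace M] [ChartedSpace H M] [IsManifold I ∞ M]
    [RiemannianBundle (fun x : M ↦ TangentSpace I x)]
    [IsContMDiffRiemannianBundle I ∞ (EuclideanSpace ℝ (Fin m))
      (fun x : M ↦ TangentSpace I x)]
    [IsRiemannianManifold I M] [CompactSpace M] [MeasurableSpace M] [BorelSpace M]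
    (N : Type*) [EMetricSpace N] [ChartedSpace (EuclideanSpace ℝ (Fin n)) N]
    [IsManifold (𝓡 n) ∞ N] [RiemannianBundle (fun x : N ↦ TangentSpace (𝓡 n) x)]
    [IsContMDiffRiemannianBundle (𝓡 n) ∞ (EuclideanSpace ℝ (Fin n))
      (fun x : N ↦ TangentSpace (𝓡 n) x)]
    [IsRiemannianManifold (𝓡 n) N] [MeasurableSpace N] [BorelSpace N]
    (N' : Type*) [EMetricSpace N'] [ChartedSpace (EuclideanSpace ℝ (Fin n)) N']
    [IsManifold (𝓡 n) ∞ N'] [RiemannianBundle (fun x : N' ↦ TangentSpace (𝓡 n) x)]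
    [IsContMDiffRiemannianBundle (𝓡 n) ∞ (EuclideanSpace ℝ (Fin n))
      (fun x : N' ↦ TangentSpace (𝓡 n) x)]
    [IsRiemannianManifold (𝓡 n) N'] [SecondCountableTopology N']
    [MeasurableSpace N'] [BorelSpace N']
    (q : N' → N) (hq : IsRiemannianCovering (n := n) q) :
    ∃ C : ℝ≥0, ∀ u' : M → N',
      MemLiftingSpace m (μHE[m] : Measure M) (injectivityRadius n N / 2) u' →
      MemFracSobolev m (μHE[m] : Measure M) s p (q ∘ u') →
        MemFracSobolev m (μHE[m] : Measure M) (sFlat m s p) p u' ∧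
        gagliardoEnergy m (μHE[m] : Measure M) (sFlat m s p) p u' ≤
          C * (gagliardoEnergy m (μHE[m] : Measure M) s p (q ∘ u') +
            gagliardoEnergy m (μHE[m] : Measure M) s p (q ∘ u') ^ (1 / s)) := by
  have := isContinuousRiemannianBundle_of_contMDiff I M
  have hchart : ∀ (x : M), ∀ V ∈ 𝓝 x, ∃ c : BilipschitzChart (μHE[m] : Measure M)
      (volume : Measure (EuclideanSpace ℝ (Fin m))), x ∈ c.U ∧ c.U ⊆ V :=
    fun x V hV ↦ exists_bilipschitzChart I x hV
  have hfin := isFiniteMeasure_of_charts hchart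
  -- All the quantities are unchanged on null sets, so a measurable representative may be used.
  suffices h : ∃ C : ℝ≥0, ∀ u' : M → N', Measurable u' →
      ∫⁻ x, ∫⁻ y in {y | injectivityRadius n N / 2 ≤ edist (u' x) (u' y)},
        1 / edist x y ^ ((m : ℝ) + 1) ∂(μHE[m] : Measure M) ∂(μHE[m] : Measure M) < ⊤ →
      gagliardoEnergy m (μHE[m] : Measure M) s p (q ∘ u') < ⊤ →
      gagliardoEnergy m (μHE[m] : Measure M) (sFlat m s p) p u' ≤
          C * (gagliardoEnergy m (μHE[m] : Measure M) s p (q ∘ u') +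
            gagliardoEnergy m (μHE[m] : Measure M) s p (q ∘ u') ^ (1 / s)) by
    obtain ⟨C, hC⟩ := h
    refine ⟨C, fun u' hX hu ↦ ?_⟩
    obtain ⟨hm, hX⟩ := hX
    have hae := hm.ae_eq_mk
    have hqae : q ∘ u' =ᵐ[μHE[m]] q ∘ hm.mk u' := hae.fun_comp q
    have hle : gagliardoEnergy m (μHE[m] : Measure M) (sFlat m s p) p u' ≤
          C * (gagliardoEnergy m (μHE[m] : Measure M) s p (q ∘ u') +
            gagliardoEnergy m (μHE[m] : Measure M) s p (q ∘ u') ^ (1 / s)) := by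
      rw [gagliardoEnergy_congr hae, gagliardoEnergy_congr hqae]
      refine hC _ hm.measurable_mk (lt_of_eq_of_lt ?_ hX) ?_
      · refine lintegral_congr_ae (hae.mono fun x hx ↦ ?_)
        refine setLIntegral_congr (Filter.eventuallyEq_set.2 (hae.mono fun y hy ↦ ?_))
        simp only [mem_ofPred_eq, hx, hy]
      · rw [← gagliardoEnergy_congr hqae]
        exact hu.2
    refine ⟨⟨hm, hle.trans_lt ?_⟩, hle⟩
    exact ENNReal.mul_lt_top ENNReal.coe_lt_top (ENNReal.add_lt_top.2
      ⟨hu.2, ENNReal.rpow_lt_top_of_nonneg (by positivity) hu.2.ne⟩)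
  rcases isEmpty_or_nonempty M with hM | ⟨⟨x⟩⟩
  · refine ⟨0, fun u' _ _ _ ↦ ?_⟩
    have : (μHE[m] : Measure M) = 0 := Measure.eq_zero_of_isEmpty _
    simp [gagliardoEnergy, this]
  -- If the radius were zero, the condition defining X would bear on all pairs of points, where the
  -- kernel of order m + 1 is not integrable; the claim would hold vacuously. Positivity of the
  -- radius is thus never needed.
  by_cases hi : injectivityRadius n N = 0
  · obtain ⟨c, -, -⟩ := hchart x univ Filter.univ_mem
    have h := lintegral_inv_edist_eq_top_of_chart c
    refine ⟨0, fun u' _ hX _ ↦ absurd hX ?_⟩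
    rw [finrank_euclideanSpace_fin] at h
    simp [hi, -one_div, h]
  · exact exists_gagliardoEnergy_le_of_charts hchart
      (fun x y ↦ mem_connectedComponent_of_edist_ne_top I) hi
      (fun x y ↦ hq.edist_le_of_lt_injectivityRadius) finrank_euclideanSpace_fin
      hs₀ hs₁ hp hsp hm₁ hm₂

/-! ### Optimality: radial powers -/

section KernelScaling

open Module

variable {E : Type*} [NormedAddCommGroup E] [NormedSpace ℝ E] [FiniteDimensional ℝ E]
  [MeasurableSpace E] [BorelSpace E] (μ : Measure E) [μ.IsAddHaarMeasure]

lemma lintegral_comp_smul (f : E → ℝ≥0∞) {r : ℝ} (hr : 0 < r) :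
    ∫⁻ x, f (r • x) ∂μ = ENNReal.ofReal r ^ (-(finrank ℝ E : ℝ)) * ∫⁻ x, f x ∂μ := by
  have h := (Homeomorph.smulOfNeZero r hr.ne').measurableEmbedding.lintegral_map (μ := μ) f
  have h2 : μ.map (Homeomorph.smulOfNeZero r hr.ne') = μ.map (r • ·) := rfl
  rw [h2, Measure.map_addHaar_smul μ hr.ne', lintegral_smul_measure] at h
  rw [abs_of_pos (by positivity), ENNReal.ofReal_inv_of_pos (by positivity),
    ENNReal.ofReal_pow hr.le, smul_eq_mul] at h
  rw [ENNReal.rpow_neg, ENNReal.rpow_natCast, h]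
  rfl

lemma setLIntegral_ball_enorm_rpow_lt_top (hd : 1 ≤ finrank ℝ E) {a : ℝ} (ha : a < finrank ℝ E) :
    ∫⁻ x in Metric.ball 0 1, ‖x‖ₑ ^ (-a) ∂μ < ⊤ := by
  have hE : Nontrivial E := Module.nontrivial_of_finrank_pos (R := ℝ) (by omega)
  have h : IntegrableOn (fun x : E ↦ ‖x‖ ^ (-a)) (Metric.ball 0 1) μ :=
    integrableOn_ball_of_norm_le_rpow hd ha (C := 1)
      (Filter.Eventually.of_forall fun x ↦ by
        rw [Real.norm_of_nonneg (by positivity), one_mul])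
      (measurable_norm.pow_const _).aestronglyMeasurable
  refine lt_of_eq_of_lt (lintegral_congr_ae (ae_restrict_of_ae ?_)) h.hasFiniteIntegral
  have h0 : ∀ᵐ x ∂μ, x ≠ 0 := by
    rw [ae_iff]; simp
  refine h0.mono fun x hx ↦ ?_
  have hx' : 0 < ‖x‖ := norm_pos_iff.2 hx
  simp only
  rw [Real.enorm_of_nonneg (by positivity), ← ofReal_norm, ENNReal.ofReal_rpow_of_pos hx']

/-- The truncated kernel of a Lipschitz function. -/
lemma exists_lintegral_min_kernel_le (hd : 1 ≤ finrank ℝ E) {t p : ℝ} (ht : 0 < t) (htp : t < p) :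
    ∃ C : ℝ≥0, ∀ (A : ℝ) (x : E), 0 < A →
      ∫⁻ y, min (ENNReal.ofReal A * edist x y) 1 ^ p / edist x y ^ (finrank ℝ E + t) ∂μ ≤
        C * ENNReal.ofReal A ^ t := by
  set d : ℝ := (finrank ℝ E : ℝ)
  have hd0 : 0 ≤ d := by positivity
  have hp : 0 < p := ht.trans htp
  -- The integral for A = 1 and x = 0, finite near the origin because t < p and at infinity because
  -- 0 < t. Translation and dilation by A reduce the general case to it.
  set K := ∫⁻ y : E, min ‖y‖ₑ 1 ^ p / ‖y‖ₑ ^ (d + t) ∂μ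
  have hK : K ≠ ⊤ := by
    obtain ⟨C, hC⟩ := lintegral_kernel_tail_le μ ht
    have h1 := hC 0 1
    have h2 := setLIntegral_ball_enorm_rpow_lt_top μ hd (a := d + t - p) (by linarith)
    rw [← lintegral_indicator Metric.isOpen_ball.measurableSet] at h2
    refine ne_top_of_le_ne_top (ENNReal.add_ne_top.2 ⟨h2.ne, ?_⟩)
      ((lintegral_mono fun y ↦ ?_).trans_eq (lintegral_add_right _
      (g := fun y ↦ if 1 ≤ edist 0 y then (edist 0 y ^ (d + t))⁻¹ else 0) ?_))
    · exact ne_top_of_le_ne_top (by simp) h1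
    · have he : edist 0 y = ‖y‖ₑ := by rw [edist_comm, edist_eq_enorm_sub, sub_zero]
      rw [he]
      rcases eq_or_ne y 0 with rfl | hy
      · simp [ENNReal.zero_rpow_of_pos hp]
      have hy0 : ‖y‖ₑ ≠ 0 := by simpa using hy
      by_cases h : ‖y‖ < 1
      · refine le_trans ?_ le_self_add
        rw [indicator_of_mem (mem_ball_zero_iff.2 h), div_eq_mul_inv, ← ENNReal.rpow_neg]
        calc _ ≤ ‖y‖ₑ ^ p * ‖y‖ₑ ^ (-(d + t)) :=
              mul_le_mul' (ENNReal.rpow_le_rpow (min_le_left _ _) hp.le) le_rfl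
          _ = _ := by
              rw [← ENNReal.rpow_add _ _ hy0 enorm_ne_top]; ring_nf
      · refine le_trans ?_ le_add_self
        have h' : 1 ≤ ‖y‖ₑ := by
          rw [← ofReal_norm]; exact ENNReal.one_le_ofReal.2 (not_lt.1 h)
        rw [if_pos h', ← one_div]
        refine ENNReal.div_le_div_right ?_ _
        exact (ENNReal.rpow_le_rpow (min_le_right _ _) hp.le).trans_eq (ENNReal.one_rpow _)
    · exact Measurable.ite (measurableSet_le measurable_const (by fun_prop)) (by fun_prop)
        measurable_const
  refine ⟨K.toNNReal, fun A x hA ↦ le_of_eq ?_⟩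
  rw [ENNReal.coe_toNNReal hK]
  have hA0 : ENNReal.ofReal A ≠ 0 := (ENNReal.ofReal_pos.2 hA).ne'
  have hAt : ENNReal.ofReal A ≠ ⊤ := ENNReal.ofReal_ne_top
  have hs := lintegral_comp_smul μ (fun y : E ↦ min ‖y‖ₑ 1 ^ p / ‖y‖ₑ ^ (d + t)) hA
  have h1 : ∫⁻ y, min (ENNReal.ofReal A * edist x y) 1 ^ p / edist x y ^ (d + t) ∂μ =
      ∫⁻ y, min (ENNReal.ofReal A * ‖y‖ₑ) 1 ^ p / ‖y‖ₑ ^ (d + t) ∂μ := by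
    rw [← lintegral_sub_right_eq_self (fun y ↦
      min (ENNReal.ofReal A * ‖y‖ₑ) 1 ^ p / ‖y‖ₑ ^ (d + t)) x]
    simp only [edist_comm x, edist_eq_enorm_sub]
  have h2 (y : E) : min (ENNReal.ofReal A * ‖y‖ₑ) 1 ^ p / ‖y‖ₑ ^ (d + t) =
      ENNReal.ofReal A ^ (d + t) * (min ‖A • y‖ₑ 1 ^ p / ‖A • y‖ₑ ^ (d + t)) := by
    have h3 : ‖A • y‖ₑ = ENNReal.ofReal A * ‖y‖ₑ := by
      rw [enorm_smul, Real.enorm_of_nonneg hA.le]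
    have h4 : ENNReal.ofReal A ^ (d + t) ≠ 0 := by simp [ENNReal.rpow_eq_zero_iff, hA0, hAt]
    have h5 : ENNReal.ofReal A ^ (d + t) ≠ ⊤ := ENNReal.rpow_ne_top_of_nonneg (by linarith) hAt
    rw [h3, ENNReal.mul_rpow_of_nonneg (ENNReal.ofReal A) _ (by linarith : 0 ≤ d + t),
      ← mul_div_assoc, ENNReal.mul_div_mul_left _ _ h4 h5]
  rw [h1]
  simp only [h2]
  rw [lintegral_const_mul' _ _ (ENNReal.rpow_ne_top_of_nonneg (by linarith) hAt), hs, ← mul_assoc,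
    ← ENNReal.rpow_add _ _ hA0 hAt, mul_comm]
  congr 2
  ring

end KernelScaling

/-- The function `x ↦ x ^ (-γ)` is locally Lipschitz on `(0, ∞)`. -/
lemma Real.rpow_neg_sub_rpow_neg_le {γ a b : ℝ} (hγ : 0 < γ) (ha : 0 < a) (hab : a ≤ b) :
    a ^ (-γ) - b ^ (-γ) ≤ γ * a ^ (-(γ + 1)) * (b - a) := by
  have hb : 0 < b := ha.trans_le hab
  have h1 : 1 - γ * (b / a - 1) ≤ (b / a) ^ (-γ) := by
    rw [Real.rpow_def_of_pos (by positivity)]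
    have h2 := Real.add_one_le_exp (Real.log (b / a) * -γ)
    have h3 := Real.log_le_sub_one_of_pos (x := b / a) (by positivity)
    nlinarith
  have h4 : b ^ (-γ) = a ^ (-γ) * (b / a) ^ (-γ) := by
    rw [← Real.mul_rpow ha.le (by positivity), mul_div_cancel₀ _ ha.ne']
  have h5 : a ^ (-(γ + 1)) = a ^ (-γ) / a := by
    rw [neg_add, ← sub_eq_add_neg, Real.rpow_sub_one ha.ne']
  have h6 : 0 < a ^ (-γ) := by positivity
  calc a ^ (-γ) - b ^ (-γ) = a ^ (-γ) * (1 - (b / a) ^ (-γ)) := by rw [h4]; ring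
    _ ≤ a ^ (-γ) * (γ * (b / a - 1)) := by gcongr; linarith
    _ = _ := by rw [h5]; field_simp

section RadialPower

open Module

variable {E : Type*} [NormedAddCommGroup E] [NormedSpace ℝ E]

lemma edist_norm_rpow_neg_le_of_norm_le {γ : ℝ} (hγ : 0 < γ) {x y : E} (hx : x ≠ 0)
    (hxy : ‖x‖ ≤ ‖y‖) : edist (‖x‖ ^ (-γ)) (‖y‖ ^ (-γ)) ≤
      ENNReal.ofReal (γ * ‖x‖ ^ (-(γ + 1))) * edist x y := by
  have hx0 : 0 < ‖x‖ := norm_pos_iff.2 hx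
  rw [edist_dist, edist_dist, ← ENNReal.ofReal_mul (by positivity)]
  refine ENNReal.ofReal_le_ofReal ?_
  rw [Real.dist_eq, abs_of_nonneg (sub_nonneg.2
    (Real.rpow_le_rpow_of_nonpos hx0 hxy (neg_nonpos.2 hγ.le)))]
  refine (Real.rpow_neg_sub_rpow_neg_le hγ hx0 hxy).trans ?_
  gcongr
  rw [dist_comm, dist_eq_norm]
  exact norm_sub_norm_le _ _

/-- The Lipschitz bound holds with the slope at the point nearer to the origin. Adding the two
possibilities makes the bound symmetric without ordering the points. -/
lemma min_edist_norm_rpow_neg_le {γ p : ℝ} (hγ : 0 < γ) (hp : 0 < p) {x y : E} (hx : x ≠ 0)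
    (hy : y ≠ 0) : min (edist (‖x‖ ^ (-γ)) (‖y‖ ^ (-γ))) 1 ^ p ≤
      min (ENNReal.ofReal (γ * ‖x‖ ^ (-(γ + 1))) * edist x y) 1 ^ p +
        min (ENNReal.ofReal (γ * ‖y‖ ^ (-(γ + 1))) * edist y x) 1 ^ p := by
  rcases le_total ‖x‖ ‖y‖ with h | h
  · refine le_trans (ENNReal.rpow_le_rpow (min_le_min_right _ ?_) hp.le) le_self_add
    exact edist_norm_rpow_neg_le_of_norm_le hγ hx h
  · refine le_trans (ENNReal.rpow_le_rpow (min_le_min_right _ ?_) hp.le) le_add_self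
    rw [edist_comm (‖x‖ ^ (-γ))]
    exact edist_norm_rpow_neg_le_of_norm_le hγ hy h

variable [FiniteDimensional ℝ E] [MeasurableSpace E] [BorelSpace E] (μ : Measure E)
  [μ.IsAddHaarMeasure]

lemma lintegral_lintegral_add_swap {α : Type*} [MeasurableSpace α] {ν : Measure α} [SFinite ν]
    {f : α → α → ℝ≥0∞} (hf : Measurable fun z : α × α ↦ f z.1 z.2) :
    ∫⁻ x, (∫⁻ y, f x y + f y x ∂ν) ∂ν = 2 * ∫⁻ x, (∫⁻ y, f x y ∂ν) ∂ν := by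
  have hsum (x : α) : ∫⁻ y, f x y + f y x ∂ν = (∫⁻ y, f x y ∂ν) + ∫⁻ y, f y x ∂ν := by
    have hx : Measurable fun y ↦ f x y := hf.comp (measurable_const.prodMk measurable_id)
    exact lintegral_add_left hx _
  have hm : Measurable fun x ↦ ∫⁻ y, f x y ∂ν := hf.lintegral_prod_right'
  simp only [hsum]
  rw [lintegral_add_left hm, two_mul, lintegral_lintegral_swap (f := f) hf.aemeasurable]

/-- Integrating out y in the truncated kernel with slope |x|^(-(γ+1)) leaves a multiple of
|x|^(-(γ+1)t), which is integrable on the ball exactly because (γ + 1) t < d. -/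
lemma lintegral_min_edist_norm_rpow_neg_lt_top (hd : 1 ≤ finrank ℝ E) {γ t p : ℝ} (hγ : 0 < γ)
    (ht : 0 < t) (htp : t < p) (hγt : (γ + 1) * t < finrank ℝ E) :
    ∫⁻ x in Metric.ball 0 1, (∫⁻ y in Metric.ball 0 1,
      min (edist (‖x‖ ^ (-γ)) (‖y‖ ^ (-γ))) 1 ^ p / edist x y ^ (finrank ℝ E + t) ∂μ) ∂μ < ⊤ := by
  have hp : 0 < p := ht.trans htp
  obtain ⟨C, hC⟩ := exists_lintegral_min_kernel_le μ hd ht htp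
  have hE : Nontrivial E := Module.nontrivial_of_finrank_pos (R := ℝ) (by omega)
  set B : Set E := Metric.ball 0 1
  set d : ℝ := (finrank ℝ E : ℝ)
  have h0 : ∀ᵐ x ∂μ.restrict B, x ≠ 0 := ae_restrict_of_ae (by rw [ae_iff]; simp)
  set Φ : E → E → ℝ≥0∞ := fun x y ↦
    min (ENNReal.ofReal (γ * ‖x‖ ^ (-(γ + 1))) * edist x y) 1 ^ p / edist x y ^ (d + t)
  have hΦ : Measurable fun z : E × E ↦ Φ z.1 z.2 := by fun_prop
  have hfirst : ∫⁻ x in B, (∫⁻ y in B, Φ x y ∂μ) ∂μ < ⊤ := by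
    have h1 := setLIntegral_ball_enorm_rpow_lt_top μ hd hγt
    have hD : C * ENNReal.ofReal γ ^ t ≠ ⊤ := ENNReal.mul_ne_top ENNReal.coe_ne_top
      (ENNReal.rpow_ne_top_of_nonneg ht.le ENNReal.ofReal_ne_top)
    refine lt_of_le_of_lt ?_ (ENNReal.mul_lt_top hD.lt_top h1)
    rw [← lintegral_const_mul' _ _ hD]
    refine lintegral_mono_ae (h0.mono fun x hx ↦ ?_)
    have hx0 : 0 < ‖x‖ := norm_pos_iff.2 hx
    refine (setLIntegral_le_lintegral _ _).trans ((hC _ x (by positivity)).trans_eq ?_)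
    rw [ENNReal.ofReal_mul hγ.le, ENNReal.mul_rpow_of_nonneg _ _ ht.le, ← mul_assoc,
      ← ENNReal.ofReal_rpow_of_pos hx0, ofReal_norm, ← ENNReal.rpow_mul, neg_mul]
  have hle : ∫⁻ x in B, (∫⁻ y in B,
      min (edist (‖x‖ ^ (-γ)) (‖y‖ ^ (-γ))) 1 ^ p / edist x y ^ (d + t) ∂μ) ∂μ ≤
      ∫⁻ x in B, (∫⁻ y in B, Φ x y + Φ y x ∂μ) ∂μ := by
    refine lintegral_mono_ae (h0.mono fun x hx ↦ lintegral_mono_ae (h0.mono fun y hy ↦ ?_))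
    simp only [Φ]
    rw [edist_comm y x, ← ENNReal.add_div]
    refine ENNReal.div_le_div_right ((min_edist_norm_rpow_neg_le hγ hp hx hy).trans_eq ?_) _
    rw [edist_comm y x]
  refine hle.trans_lt ?_
  rw [lintegral_lintegral_add_swap hΦ]
  exact ENNReal.mul_lt_top ENNReal.ofNat_lt_top hfirst

lemma setLIntegral_ball_smul (f : E → ℝ≥0∞) {r : ℝ} (hr : 0 < r) :
    ∫⁻ x in Metric.ball 0 r, f x ∂μ =
      ENNReal.ofReal r ^ (finrank ℝ E : ℝ) * ∫⁻ x in Metric.ball 0 1, f (r • x) ∂μ := by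
  have hr0 : ENNReal.ofReal r ≠ 0 := (ENNReal.ofReal_pos.2 hr).ne'
  rw [← lintegral_indicator Metric.isOpen_ball.measurableSet,
    ← lintegral_indicator Metric.isOpen_ball.measurableSet]
  have h := lintegral_comp_smul μ ((Metric.ball 0 r).indicator f) hr
  have h2 (x : E) : (Metric.ball 0 r).indicator f (r • x) =
      (Metric.ball 0 1).indicator (fun x ↦ f (r • x)) x := by
    have h3 : r • x ∈ Metric.ball (0 : E) r ↔ x ∈ Metric.ball (0 : E) 1 := by
      rw [mem_ball_zero_iff, mem_ball_zero_iff, norm_smul, Real.norm_of_nonneg hr.le]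
      constructor <;> intro h <;> nlinarith
    by_cases hx : x ∈ Metric.ball (0 : E) 1
    · rw [indicator_of_mem hx, indicator_of_mem (h3.2 hx)]
    · rw [indicator_of_notMem hx, indicator_of_notMem (mt h3.1 hx)]
  simp only [h2] at h
  rw [h, ← mul_assoc, ← ENNReal.rpow_add _ _ hr0 ENNReal.ofReal_ne_top, add_neg_cancel,
    ENNReal.rpow_zero, one_mul]

/-- A kernel that is homogeneous under the dilation of ratio `r`, to an order at which the integral
on the smaller ball is not smaller than the one on the larger ball, is not integrable. -/
lemma lintegral_eq_top_of_dilation [Nontrivial E] {T : E → E → ℝ≥0∞}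
    (hT : Measurable fun z : E × E ↦ T z.1 z.2) {r b a : ℝ} (hr : 0 < r) (hrb : r < b) (hb : b < 1)
    (hTr : ∀ x y, T (r • x) (r • y) = ENNReal.ofReal r ^ a * T x y)
    (ha : finrank ℝ E + finrank ℝ E + a ≤ 0)
    (hpos : ∀ x y, r < ‖x‖ → ‖x‖ < b → b < ‖y‖ → T x y ≠ 0) :
    ∫⁻ x in Metric.ball 0 1, (∫⁻ y in Metric.ball 0 1, T x y ∂μ) ∂μ = ⊤ := by
  set d : ℝ := (finrank ℝ E : ℝ)
  have hTx (x : E) : Measurable fun y ↦ T x y := hT.comp (measurable_const.prodMk measurable_id)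
  set F := ∫⁻ x in Metric.ball 0 1, (∫⁻ y in Metric.ball 0 1, T x y ∂μ) ∂μ with hFdef
  set ρ := ENNReal.ofReal r
  have hρ0 : ρ ≠ 0 := (ENNReal.ofReal_pos.2 hr).ne'
  have hρt : ρ ≠ ⊤ := ENNReal.ofReal_ne_top
  have hρ1 : ρ ≤ 1 := by
    rw [← ENNReal.ofReal_one]; exact ENNReal.ofReal_le_ofReal (by linarith)
  have hcne : ρ ^ a ≠ ⊤ := by simp [ENNReal.rpow_eq_top_iff, hρ0, hρt]
  have hF : F ≤ ∫⁻ x in Metric.ball 0 r, (∫⁻ y in Metric.ball 0 r, T x y ∂μ) ∂μ := by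
    have h1 : ∫⁻ x in Metric.ball 0 r, (∫⁻ y in Metric.ball 0 r, T x y ∂μ) ∂μ =
        ρ ^ d * (ρ ^ d * (ρ ^ a * F)) := by
      rw [setLIntegral_ball_smul μ _ hr]
      congr 1
      rw [← lintegral_const_mul' _ _ hcne,
        ← lintegral_const_mul' _ _ (ENNReal.rpow_ne_top_of_nonneg (by positivity) hρt)]
      refine lintegral_congr fun x ↦ ?_
      rw [setLIntegral_ball_smul μ _ hr, ← lintegral_const_mul' _ _ hcne]
      simp only [hTr]
      rfl
    rw [h1, ← mul_assoc, ← mul_assoc, ← ENNReal.rpow_add _ _ hρ0 hρt,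
      ← ENNReal.rpow_add _ _ hρ0 hρt]
    refine le_mul_of_one_le_left zero_le ?_
    calc (1 : ℝ≥0∞) = ρ ^ (0 : ℝ) := ENNReal.rpow_zero.symm
      _ ≤ _ := ENNReal.rpow_le_rpow_of_exponent_ge hρ1 ha
  set D : Set E := Metric.ball 0 1 \ Metric.ball 0 r
  have hDm : MeasurableSet D :=
    Metric.isOpen_ball.measurableSet.diff Metric.isOpen_ball.measurableSet
  have hBD : Metric.ball (0 : E) 1 = Metric.ball 0 r ∪ D :=
    (union_sdiff_cancel (Metric.ball_subset_ball (by linarith))).symm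
  set R := ∫⁻ x in D, (∫⁻ y in D, T x y ∂μ) ∂μ
  -- By homogeneity the smaller ball already carries at least F, and the pairs in the shell D add R.
  -- If F were finite, R would vanish, against the positivity of the kernel between two annuli.
  have hFR : F + R ≤ F := by
    have h1 : F = (∫⁻ x in Metric.ball 0 r, (∫⁻ y in Metric.ball 0 1, T x y ∂μ) ∂μ) +
        ∫⁻ x in D, (∫⁻ y in Metric.ball 0 1, T x y ∂μ) ∂μ := by
      rw [← lintegral_union hDm disjoint_sdiff_right, ← hBD]
    calc F + R ≤ (∫⁻ x in Metric.ball 0 r, (∫⁻ y in Metric.ball 0 r, T x y ∂μ) ∂μ) + R := by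
          gcongr
      _ ≤ (∫⁻ x in Metric.ball 0 r, (∫⁻ y in Metric.ball 0 1, T x y ∂μ) ∂μ) +
        ∫⁻ x in D, (∫⁻ y in Metric.ball 0 1, T x y ∂μ) ∂μ := by
          refine add_le_add (lintegral_mono fun x ↦ lintegral_mono_set ?_)
            (lintegral_mono fun x ↦ lintegral_mono_set ?_)
          · exact Metric.ball_subset_ball (hrb.trans hb).le
          · exact sdiff_subset
      _ = F := h1.symm
  by_contra hFt
  have hR : R = 0 := by
    have h1 : F + R ≤ F + 0 := by rwa [add_zero]
    exact le_zero_iff.1 ((ENNReal.add_le_add_iff_left hFt).1 h1)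
  refine absurd hR (ne_of_gt ?_)
  have hann (a b : ℝ) (ha : 0 ≤ a) (hab : a < b) : 0 < μ {x | a < ‖x‖ ∧ ‖x‖ < b} := by
    have ho : IsOpen {x : E | a < ‖x‖ ∧ ‖x‖ < b} :=
      (isOpen_lt continuous_const continuous_norm).inter (isOpen_lt continuous_norm continuous_const)
    obtain ⟨x, hx⟩ := exists_norm_eq E (c := (a + b) / 2) (by linarith)
    exact ho.measure_pos μ ⟨x, by constructor <;> rw [hx] <;> linarith⟩
  have hmR : Measurable fun x ↦ ∫⁻ y in D, T x y ∂μ := hT.lintegral_prod_right'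
  refine (setLIntegral_pos_iff hmR).2 ((hann r b hr.le hrb).trans_le
    (measure_mono fun x hx ↦ ⟨(ne_of_gt ((setLIntegral_pos_iff (hTx x)).2
      ((hann b 1 (by linarith) hb).trans_le
        (measure_mono fun y hy ↦ ⟨hpos x y hx.1 hx.2 hy.1, ?_⟩)))), ?_⟩))
  · exact ⟨mem_ball_zero_iff.2 hy.2, fun h ↦
      (mem_ball_zero_iff.1 h).not_gt (hrb.trans hy.1)⟩
  · exact ⟨mem_ball_zero_iff.2 (hx.2.trans hb), fun h ↦ (mem_ball_zero_iff.1 h).not_gt hx.1⟩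

/-- The integrand is homogeneous of degree -γp - (d + σp). With 2d from the two volume elements the
total degree is d - (γ + σ) p ≤ 0, so dilation cannot make the integral smaller. The equality case
is included, which a direct computation would show as a logarithmic divergence. -/
lemma lintegral_edist_norm_rpow_neg_eq_top (hd : 1 ≤ finrank ℝ E) {γ σ p : ℝ} (hγ : 0 < γ)
    (hp : 0 < p) (hσ : 0 ≤ finrank ℝ E + σ * p) (hγσ : finrank ℝ E ≤ (γ + σ) * p) :
    ∫⁻ x in Metric.ball 0 1, (∫⁻ y in Metric.ball 0 1,
      edist (‖y‖ ^ (-γ)) (‖x‖ ^ (-γ)) ^ p / edist y x ^ (finrank ℝ E + σ * p) ∂μ) ∂μ = ⊤ := by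
  have hE : Nontrivial E := Module.nontrivial_of_finrank_pos (R := ℝ) (by omega)
  have hm : Measurable fun z : E × E ↦
      edist (‖z.2‖ ^ (-γ)) (‖z.1‖ ^ (-γ)) ^ p / edist z.2 z.1 ^ (finrank ℝ E + σ * p) := by fun_prop
  have hr : (0 : ℝ) < 1 / 2 := by norm_num
  refine lintegral_eq_top_of_dilation μ (r := 1 / 2) (b := 3 / 4)
    (a := -γ * p - (finrank ℝ E + σ * p)) hm hr (by norm_num) (by norm_num) (fun x y ↦ ?_)
    (by linarith) (fun x y hx hxy hy ↦ ?_)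
  · generalize (1 : ℝ) / 2 = r at hr
    set ρ := ENNReal.ofReal r
    have hρ0 : ρ ≠ 0 := (ENNReal.ofReal_pos.2 hr).ne'
    have hρt : ρ ≠ ⊤ := ENNReal.ofReal_ne_top
    have h1 (x : E) : ‖r • x‖ ^ (-γ) = r ^ (-γ) • ‖x‖ ^ (-γ) := by
      rw [norm_smul, Real.norm_of_nonneg hr.le, Real.mul_rpow hr.le (norm_nonneg _), smul_eq_mul]
    have h2 : edist (r • y) (r • x) = ρ * edist y x := by
      rw [edist_smul₀, ENNReal.smul_def, smul_eq_mul, ← enorm_eq_nnnorm,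
        Real.enorm_of_nonneg hr.le]
    have h3 : edist (‖r • y‖ ^ (-γ)) (‖r • x‖ ^ (-γ)) =
        ρ ^ (-γ) * edist (‖y‖ ^ (-γ)) (‖x‖ ^ (-γ)) := by
      rw [h1, h1, edist_smul₀, ENNReal.smul_def, smul_eq_mul, ← enorm_eq_nnnorm,
        Real.enorm_of_nonneg (by positivity), ENNReal.ofReal_rpow_of_pos hr]
    rw [h2, h3, ENNReal.mul_rpow_of_nonneg _ _ hp.le, ENNReal.mul_rpow_of_nonneg _ _ hσ,
      ENNReal.rpow_sub _ _ hρ0 hρt, ENNReal.rpow_mul]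
    rw [ENNReal.mul_div_mul_comm]
    · exact Or.inl (by simp [ENNReal.rpow_eq_zero_iff, hρ0, hρt])
    · exact Or.inl (ENNReal.rpow_ne_top_of_nonneg hσ hρt)
  · have hne : edist (‖y‖ ^ (-γ)) (‖x‖ ^ (-γ)) ≠ 0 := by
      refine edist_pos.2 ?_ |>.ne'
      exact (Real.rpow_lt_rpow_of_neg (hr.trans hx) (hxy.trans hy) (neg_neg_of_pos hγ)).ne
    refine (ENNReal.div_pos ?_ (ENNReal.rpow_ne_top_of_nonneg hσ (edist_ne_top _ _))).ne'
    simp [ENNReal.rpow_eq_zero_iff, hne, edist_ne_top, hp.not_gt]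

end RadialPower

/-- The projection is 1-Lipschitz and the circle has diameter π; the single factor π covers both
bounds. -/
lemma AddCircle.edist_coe_le (a b : ℝ) :
    edist (a : AddCircle (2 * Real.pi)) (b : AddCircle (2 * Real.pi)) ≤
      ENNReal.ofReal Real.pi * min (edist a b) 1 := by
  have hpi := Real.pi_pos
  have h1 : edist (a : AddCircle (2 * Real.pi)) (b : AddCircle (2 * Real.pi)) =
      ENNReal.ofReal ‖((a - b : ℝ) : AddCircle (2 * Real.pi))‖ := by
    rw [edist_dist, dist_eq_norm, ← AddCircle.coe_sub]
  rw [h1]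
  rcases le_total (edist a b) 1 with h | h
  · rw [min_eq_left h, edist_dist, ← ENNReal.ofReal_mul hpi.le]
    refine ENNReal.ofReal_le_ofReal ((QuotientAddGroup.norm_mk_le_norm).trans ?_)
    rw [dist_eq_norm]
    have := Real.pi_gt_three
    nlinarith [norm_nonneg (a - b)]
  · rw [min_eq_right h, mul_one]
    refine ENNReal.ofReal_le_ofReal
      ((AddCircle.norm_le_half_period (2 * Real.pi) (by positivity)).trans_eq ?_)
    rw [abs_of_pos (by positivity)]
    ring

/-- The optimality of the exponent `s♭`: the function `x ↦ |x| ^ (-γ)` for a suitable `γ`. -/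
theorem exists_gagliardoEnergy_eq_top {m : ℕ} {s p : ℝ} (hs₀ : 0 < s) (hs₁ : s < 1) (hp : 1 < p)
    (hsp : 1 < s * p) (hm₂ : s * p / m < 1) (hm₀ : 0 < m) {σ : ℝ} (hσ : sFlat m s p < σ)
    (hσ₀ : 0 ≤ (m : ℝ) + σ * p) :
    ∃ f : EuclideanSpace ℝ (Fin m) → ℝ,
      MemLiftingSpace m (volume.restrict (Metric.ball 0 1)) (ENNReal.ofReal (Real.pi / 2)) f ∧
      MemFracSobolev m (volume.restrict (Metric.ball 0 1)) s p
        (fun x ↦ (f x : AddCircle (2 * Real.pi))) ∧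
      gagliardoEnergy m (volume.restrict (Metric.ball 0 1)) σ p f = ⊤ := by
  have hp0 : 0 < p := by linarith
  have hm0 : (0 : ℝ) < m := by exact_mod_cast hm₀
  have hsp0 : 0 < s * p := by positivity
  have hsm : s * p < m := (div_lt_one hm0).1 hm₂
  have hqp : s * p < p := by nlinarith
  have h1 : 0 < (m : ℝ) / (s * p) - 1 := by rw [sub_pos, one_lt_div hsp0]; exact hsm
  have h2 : (m : ℝ) / p - σ < m / (s * p) - 1 := by
    have h3 : (m : ℝ) / p - sFlat m s p = m / (s * p) - 1 := by
      rw [sFlat]; field_simp; ring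
    linarith
  -- The upper bound on γ means (γ + 1) s p < m and the lower one gives (γ + σ) p ≥ m. The window is
  -- nonempty since m/p - s♭ = m/(sp) - 1, and it contains positive numbers since sp < m.
  obtain ⟨γ, hγ1, hγ2⟩ := exists_between (max_lt h1 h2)
  have hγ : 0 < γ := (le_max_left _ _).trans_lt hγ1
  have hγσ : (m : ℝ) ≤ (γ + σ) * p := by
    have h3 : (m : ℝ) / p < γ + σ := by linarith [(le_max_right 0 ((m : ℝ) / p - σ)).trans_lt hγ1]
    exact ((div_lt_iff₀ hp0).1 h3).le
  have hγq : (γ + 1) * (s * p) < m := by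
    have h3 : γ + 1 < m / (s * p) := by linarith
    exact (lt_div_iff₀ hsp0).1 h3
  have hd : 1 ≤ Module.finrank ℝ (EuclideanSpace ℝ (Fin m)) := by
    rw [finrank_euclideanSpace_fin]; omega
  have hq := lintegral_min_edist_norm_rpow_neg_lt_top
    (volume : Measure (EuclideanSpace ℝ (Fin m))) hd hγ hsp0 hqp
    (by rw [finrank_euclideanSpace_fin]; exact hγq)
  -- The same bound with t = 1 handles the kernel of order m + 1 of the lifting space; 1 < sp makes
  -- its condition weaker than the one for sp.
  have h1' := lintegral_min_edist_norm_rpow_neg_lt_top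
    (volume : Measure (EuclideanSpace ℝ (Fin m))) hd hγ one_pos hp
    (by rw [finrank_euclideanSpace_fin]; nlinarith)
  have htop := lintegral_edist_norm_rpow_neg_eq_top
    (volume : Measure (EuclideanSpace ℝ (Fin m))) (σ := σ) hd hγ hp0
    (by rw [finrank_euclideanSpace_fin]; exact hσ₀)
    (by rw [finrank_euclideanSpace_fin]; exact hγσ)
  rw [finrank_euclideanSpace_fin] at hq h1' htop
  have hf : Measurable fun x : EuclideanSpace ℝ (Fin m) ↦ ‖x‖ ^ (-γ) := by fun_prop
  refine ⟨fun x ↦ ‖x‖ ^ (-γ), ⟨hf.aemeasurable, lt_of_le_of_lt ?_ h1'⟩,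
    ⟨(AddCircle.measurable_mk'.comp hf).aemeasurable, ?_⟩, htop⟩
  · refine lintegral_mono fun x ↦ ?_
    have hS : MeasurableSet {y : EuclideanSpace ℝ (Fin m) |
        ENNReal.ofReal (Real.pi / 2) ≤ edist (‖x‖ ^ (-γ)) (‖y‖ ^ (-γ))} :=
      measurableSet_le measurable_const (by fun_prop)
    refine (setLIntegral_mono' hS fun y hy ↦ ?_).trans (setLIntegral_le_lintegral _ _)
    refine ENNReal.div_le_div_right ?_ _
    -- As π / 2 > 1, the truncated difference equals 1 on the set of jumps.
    have h3 : 1 ≤ edist (‖x‖ ^ (-γ)) (‖y‖ ^ (-γ)) := le_trans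
      (ENNReal.one_le_ofReal.2 (by linarith [Real.pi_gt_three])) hy
    rw [min_eq_right h3, ENNReal.one_rpow]
  · have hc : ENNReal.ofReal Real.pi ^ p ≠ ⊤ :=
      ENNReal.rpow_ne_top_of_nonneg hp0.le ENNReal.ofReal_ne_top
    refine lt_of_le_of_lt ?_ (ENNReal.mul_lt_top hc.lt_top hq)
    rw [← lintegral_const_mul' _ _ hc]
    refine lintegral_mono fun x ↦ ?_
    rw [← lintegral_const_mul' _ _ hc]
    refine lintegral_mono fun y ↦ ?_
    rw [edist_comm y x, ← mul_div_assoc, ← ENNReal.mul_rpow_of_nonneg _ _ hp0.le]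
    refine ENNReal.div_le_div_right (ENNReal.rpow_le_rpow ?_ hp0.le) _
    rw [edist_comm]
    exact AddCircle.edist_coe_le _ _

end

theorem mainTheorem10 (m : ℕ) (s p : ℝ) (hs₀ : 0 < s) (hs₁ : s < 1) (hp : 1 < p)
    (hsp : 1 < s * p) (hm₁ : 1 - s < s * p / m) (hm₂ : s * p / m < 1) :
    (∀ (n : ℕ)
      -- `M`: a compact Riemannian manifold of dimension `m`, possibly with boundary
      (H : Type*) [TopologicalSpace H] (I : ModelWithCorners ℝ (EuclideanSpace ℝ (Fin m)) H)
      (M : Type*) [EMetricSpace M] [ChartedSpace H M] [IsManifold I ∞ M]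
      [RiemannianBundle (fun x : M ↦ TangentSpace I x)]
      [IsContMDiffRiemannianBundle I ∞ (EuclideanSpace ℝ (Fin m))
        (fun x : M ↦ TangentSpace I x)]
      [IsRiemannianManifold I M] [CompactSpace M] [MeasurableSpace M] [BorelSpace M]
      -- `N`: a compact Riemannian manifold
      (N : Type*) [EMetricSpace N] [ChartedSpace (EuclideanSpace ℝ (Fin n)) N]
      [IsManifold (𝓡 n) ∞ N] [RiemannianBundle (fun x : N ↦ TangentSpace (𝓡 n) x)]
      [IsContMDiffRiemannianBundle (𝓡 n) ∞ (EuclideanSpace ℝ (Fin n))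
        (fun x : N ↦ TangentSpace (𝓡 n) x)]
      [IsRiemannianManifold (𝓡 n) N] [CompactSpace N] [MeasurableSpace N] [BorelSpace N]
      -- `N'`: the covering Riemannian manifold
      (N' : Type*) [EMetricSpace N'] [ChartedSpace (EuclideanSpace ℝ (Fin n)) N']
      [IsManifold (𝓡 n) ∞ N'] [RiemannianBundle (fun x : N' ↦ TangentSpace (𝓡 n) x)]
      [IsContMDiffRiemannianBundle (𝓡 n) ∞ (EuclideanSpace ℝ (Fin n))
        (fun x : N' ↦ TangentSpace (𝓡 n) x)]
      [IsRiemannianManifold (𝓡 n) N'] [SecondCountableTopology N']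
      [MeasurableSpace N'] [BorelSpace N']
      (q : N' → N), IsRiemannianCovering (n := n) q →
      ∃ C : ℝ≥0, ∀ u' : M → N',
        MemLiftingSpace m (μHE[m] : Measure M) (injectivityRadius n N / 2) u' →
        MemFracSobolev m (μHE[m] : Measure M) s p (q ∘ u') →
          MemFracSobolev m (μHE[m] : Measure M) (sFlat m s p) p u' ∧
          gagliardoEnergy m (μHE[m] : Measure M) (sFlat m s p) p u' ≤
            C * (gagliardoEnergy m (μHE[m] : Measure M) s p (q ∘ u') +
              gagliardoEnergy m (μHE[m] : Measure M) s p (q ∘ u') ^ (1 / s))) ∧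
    -- optimality of the exponent, for the covering `ℝ → ℝ / 2πℤ` of the unit circle (with its
    -- geodesic distance and injectivity radius `π`) and maps on the unit ball of `ℝ ^ m`
    (∀ σ : ℝ, sFlat m s p < σ → σ < 1 →
      ∃ f : EuclideanSpace ℝ (Fin m) → ℝ,
        MemLiftingSpace m (volume.restrict (Metric.ball 0 1))
          (ENNReal.ofReal (Real.pi / 2)) f ∧
        MemFracSobolev m (volume.restrict (Metric.ball 0 1)) s p
          (fun x ↦ (f x : AddCircle (2 * Real.pi))) ∧
        gagliardoEnergy m (volume.restrict (Metric.ball 0 1)) σ p f = ⊤) := by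
  refine ⟨fun n H _ I M _ _ _ _ _ _ _ _ _ N _ _ _ _ _ _ _ _ _ N' _ _ _ _ _ _ _ _ _ q hq ↦
    exists_gagliardoEnergy_lifting_le hs₀ hs₁ hp hsp hm₁ hm₂ n H I M N N' q hq,
    fun σ hσ _ ↦ ?_⟩
  have hm₀ : 0 < m := by
    rcases Nat.eq_zero_or_pos m with rfl | h
    · simp at hm₁; linarith
    · exact h
  have hm : (0 : ℝ) < m := by exact_mod_cast hm₀
  -- This is the condition 1 - s < sp / m; it makes σ positive, so that the exponent m + σp of the
  -- kernel is nonnegative.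
  have hflat : 0 < sFlat m s p := by
    rw [lt_div_iff₀ hm] at hm₁
    have h : sFlat m s p = (s * p - (1 - s) * m) / (s * p) := by rw [sFlat]; field_simp; ring
    rw [h]
    exact div_pos (by linarith) (by positivity)
  have hσ₀ : 0 ≤ σ := (hflat.trans hσ).le
  exact exists_gagliardoEnergy_eq_top hs₀ hs₁ hp hsp hm₂ hm₀ hσ (by positivity)
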